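/- **Setting.** Let $H$ be a separable real Hilbert space and let $A$ be a nonnegative self-adjoint (possibly unbounded) linear operator on $H$ with dense domain. By the spectral theorem $A$ is unitarily equivalent to a multiplication operator; fix such a representation, that is, a measure space $(M,\mu)$, a measurable function $a:M\to[0,+\infty)$ and a unitary operator $u\mapsto \hat u$ from $H$ onto $L^2(M,\mu)$ such that $u\in D(A)$ if and only if $a^2\hat u\in L^2(M,\mu)$, and $\widehat{Au}=a^2\hat u$. (If $A$ has a complete orthonormal system of eigenvectors $e_k$ with eigenvalues $\lambda_k^2$, one takes $\hat u=(\langle u,e_k\rangle)_k$, $a=(\lambda_k)_k$ and the counting measure, and the integrals below are sums over $k$.) For $\alpha\ge 0$ put $D(A^{\alpha})=\{u\in H:\int_M a^{4\alpha}|\hat u|^2\,d\mu<+\infty\}$ and $|A^\alpha u|^2=\int_M a^{4\alpha}|\hat u|^2\,d\mu$. Let $\varphi:[0,+\infty)\to[1,+\infty)$ be a function such that $\varphi\circ a$ is $\mu$-measurable. For $r>0$ and $\alpha\ge 0$ let $\mathcal G_{\varphi,r,\alpha}(A)$ be the space of all $u\in H$ with $$\|u\|_{\varphi,r,\alpha}^2:=\int_M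 a^{4\alpha}|\hat u|^2\exp(r\varphi(a))\,d\mu<+\infty ,$$ with the norm $(|u|^2+\|u\|_{\varphi,r,\alpha}^2)^{1/2}$. For $\beta\ge 0$ and a sequence $\{\rho_n\}$ of positive real numbers with $\rho_n\to+\infty$ let $\mathcal{GM}^{(\beta)}_{\varphi,\{\rho_n\},\alpha}(A)$ be the set of all $u\in H$ such that $$\int_{\{a>\rho_n\}}a^{4\alpha}|\hat u|^2\exp\left(\rho_n^{\beta}\varphi(a)\right)d\mu\le\rho_n\qquad\forall n\in\mathbb N .$$ Let $\omega:[0,+\infty)\to[0,+\infty)$ be a continuity modulus, that is, a continuous nondecreasing function with $\omega(0)=0$ and $\omega(x+y)\le\omega(x)+\omega(y)$ for all $x,y\ge 0$. Let $m:[0,+\infty)\to[0,+\infty)$ be $\omega$-continuous, that is, there is a constant $L$ with $|m(x)-m(y)|\le L\,\omega(|x-y|)$ for all $x,y\ge0$. Consider the Kirchhoff problem $$u''(t)+m\left(|A^{1/2}u(t)|^2\right)Au(t)=0\quad (t\ge 0),\qquad u(0)=u_0,\quad u'(0)=u_1, \qquad (*)$$ where the equation is understood in the weak sense: for every $w\in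 D(A)$ and every $t\ge 0$ the function $s\mapsto\langle u'(s),w\rangle$ is differentiable at $t$ (from the right if $t=0$) with derivative $-m(|A^{1/2}u(t)|^2)\langle u(t),Aw\rangle$. The equation is called strictly hyperbolic if $\inf_{\sigma\ge0}m(\sigma)>0$ and weakly hyperbolic if $\inf_{\sigma\ge0}m(\sigma)=0$. Suppose that there is a constant $\Lambda$ such that one of the following holds: * the equation is strictly hyperbolic, $\beta=2$, and $\sigma\,\omega(1/\sigma)\le\Lambda\varphi(\sigma)$ for every $\sigma>0$; * the equation is weakly hyperbolic, $\beta=3$, and $\sigma\le\Lambda\,\varphi\!\left(\sigma/\sqrt{\omega(1/\sigma)}\right)$ for every $\sigma>0$ (where a quotient with denominator $0$ is read as $0$; this occurs only if $\omega\equiv 0$, and then the condition fails). **Theorem (Global existence).** Let $\{\rho_n\}$ be a sequence of positive real numbers with $\rho_n\to+\infty$, and let $$(u_0,u_1)\in\mathcal{GM}^{(\beta)}_{\varphi,\{\rho_n\},3/4}(A)\times\mathcal{GM}^{(\beta)}_{\varphi,\{\rho_n\},1/4}(A).$$ Assume in addition that $(u_0,u_1)\in\mathcal G_{\varphi,r,3/4}(A)\times\mathcal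 G_{\varphi,r,1/4}(A)$ for every $r>0$ (this is automatic when $\varphi$ is bounded on bounded sets, for instance when $\varphi$ is continuous). Then problem $(*)$ admits at least one global solution $u$ such that, for every $r>0$, $$u\in C^1\left([0,+\infty);\mathcal G_{\varphi,r,1/4}(A)\right)\cap C^0\left([0,+\infty);\mathcal G_{\varphi,r,3/4}(A)\right).$$ -/

import Mathlib

open MeasureTheory Set Filter Topology

noncomputable section

namespace Kirchhoff

/-- A representation of the operator `A` as a multiplication operator: a unitary operator `U`
from `H` onto the real space `L²(M, μ)` and a measurable `a : M → [0, ∞)` such that `A`,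
including its domain, corresponds to multiplication by `a²`. If `A` has a complete orthonormal
system of eigenvectors `e k` with `A (e k) = (l k)² • e k`, one takes for `M` the index set with
the counting measure, `U u k = ⟪u, e k⟫` and `a = l`. -/
structure SpectralRep {H : Type*} [NormedAddCommGroup H] [InnerProductSpace ℝ H]
    (A : H →ₗ.[ℝ] H) {M : Type*} [MeasurableSpace M] (μ : Measure M) where
  /-- the unitary operator -/
  U : H ≃ₗᵢ[ℝ] Lp ℝ 2 μ
  /-- the multiplier; it plays the role of the sequence of the square roots of the eigenvalues -/
  a : M → ℝ
  measurable_a : Measurable a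
  a_nonneg : ∀ ξ, 0 ≤ a ξ
  mem_domain_iff : ∀ u : H, u ∈ A.domain ↔ MemLp (fun ξ => a ξ ^ 2 * U u ξ) 2 μ
  apply_eq : ∀ u : A.domain, (U (A u) : M → ℝ) =ᵐ[μ] fun ξ => a ξ ^ 2 * U (u : H) ξ

/-- A continuity modulus: a continuous nondecreasing subadditive `ω : [0, ∞) → [0, ∞)`
with `ω 0 = 0`. -/
structure IsContinuityModulus (ω : ℝ → ℝ) : Prop where
  continuousOn : ContinuousOn ω (Ici 0)
  monotoneOn : MonotoneOn ω (Ici 0)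
  nonneg : ∀ x, 0 ≤ x → 0 ≤ ω x
  map_zero : ω 0 = 0
  subadditive : ∀ x y, 0 ≤ x → 0 ≤ y → ω (x + y) ≤ ω x + ω y

/-- `m` is `ω`-continuous on `[0, ∞)`. -/
def IsOmegaContinuous (ω m : ℝ → ℝ) : Prop :=
  ∃ L : ℝ, ∀ x y : ℝ, 0 ≤ x → 0 ≤ y → |m x - m y| ≤ L * ω |x - y|

/-- The infimum of `m` over `[0, ∞)`. -/
def hyperbolicityConst (m : ℝ → ℝ) : ℝ := sInf (m '' Ici 0)

/-- The equation is strictly hyperbolic. -/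
def StrictlyHyperbolic (m : ℝ → ℝ) : Prop := 0 < hyperbolicityConst m

/-- The equation is weakly (degenerate) hyperbolic. -/
def WeaklyHyperbolic (m : ℝ → ℝ) : Prop := hyperbolicityConst m = 0

section Spaces

variable {H : Type*} [NormedAddCommGroup H] [InnerProductSpace ℝ H]
  {A : H →ₗ.[ℝ] H} {M : Type*} [MeasurableSpace M] {μ : Measure M}

/-- The domain of the power `A ^ α`. -/
def powDomain (R : SpectralRep A μ) (α : ℝ) : Set H :=
  {u | Integrable (fun ξ => R.a ξ ^ (4 * α) * R.U u ξ ^ 2) μ}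

/-- The number `|A ^ α u|²`, for `u` in the domain of `A ^ α`. -/
def powNormSq (R : SpectralRep A μ) (α : ℝ) (u : H) : ℝ :=
  ∫ ξ, R.a ξ ^ (4 * α) * R.U u ξ ^ 2 ∂μ

/-- The squared weighted seminorm `∫ a^(4α) |U u|² exp (r φ(a)) dμ`, which may be infinite. -/
def gevreySeminormSq (R : SpectralRep A μ) (φ : ℝ → ℝ) (r α : ℝ) (u : H) : ENNReal :=
  ∫⁻ ξ, ENNReal.ofReal
    (R.a ξ ^ (4 * α) * R.U u ξ ^ 2 * Real.exp (r * φ (R.a ξ))) ∂μ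

/-- The generalized Gevrey space of parameters `φ, r, α`. -/
def gevreySpace (R : SpectralRep A μ) (φ : ℝ → ℝ) (r α : ℝ) : Set H :=
  {u | gevreySeminormSq R φ r α u < ⊤}

/-- The square of the norm of the generalized Gevrey space. -/
def gevreyNormSq (R : SpectralRep A μ) (φ : ℝ → ℝ) (r α : ℝ) (u : H) : ENNReal :=
  ENNReal.ofReal (‖u‖ ^ 2) + gevreySeminormSq R φ r α u

/-- The generalized Gevrey-Manfrin space of parameters `β, φ, ρ, α`: only the frequencies
`a ξ > ρ n` enter the `n`-th condition. -/
def gevreyManfrinSpace (R : SpectralRep A μ) (β : ℝ) (φ : ℝ → ℝ) (ρ : ℕ → ℝ) (α : ℝ) :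
    Set H :=
  {u | ∀ n : ℕ,
    ∫⁻ ξ in {ξ | ρ n < R.a ξ}, ENNReal.ofReal
      (R.a ξ ^ (4 * α) * R.U u ξ ^ 2 * Real.exp (ρ n ^ β * φ (R.a ξ))) ∂μ
        ≤ ENNReal.ofReal (ρ n)}

/-- `u ∈ C⁰([0, ∞); G)`, where `G` is the generalized Gevrey space with its norm. -/
def ContinuousInto (R : SpectralRep A μ) (φ : ℝ → ℝ) (r α : ℝ) (u : ℝ → H) : Prop :=
  (∀ t, 0 ≤ t → u t ∈ gevreySpace R φ r α) ∧
  ∀ t, 0 ≤ t →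
    Tendsto (fun s => gevreyNormSq R φ r α (u s - u t)) (𝓝[Ici 0] t) (𝓝 0)

/-- `u ∈ C¹([0, ∞); G)` with derivative `u'`, where `G` is the generalized Gevrey space with
its norm. -/
def ContDiffInto (R : SpectralRep A μ) (φ : ℝ → ℝ) (r α : ℝ) (u u' : ℝ → H) : Prop :=
  ContinuousInto R φ r α u ∧ ContinuousInto R φ r α u' ∧
  ∀ t, 0 ≤ t →
    Tendsto (fun s => gevreyNormSq R φ r α ((s - t)⁻¹ • (u s - u t) - u' t))
      (𝓝[Ici 0 \ {t}] t) (𝓝 0)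

/-- `u`, with derivative `u'`, is a global solution of
`u'' + m(|A^(1/2) u|²) A u = 0`, `u(0) = u₀`, `u'(0) = u₁`. Since `A u(t)` need not belong to `H`
(for `u(t)` in the domain of `A^(3/4)` it lies in the dual of the domain of `A^(1/4)`), the
equation is tested against the elements of the domain of `A`. -/
structure IsGlobalSolution (R : SpectralRep A μ) (m : ℝ → ℝ) (u₀ u₁ : H) (u u' : ℝ → H) :
    Prop where
  initial : u 0 = u₀
  initial' : u' 0 = u₁
  hasDeriv : ∀ t, 0 ≤ t → HasDerivWithinAt u (u' t) (Ici 0) t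
  mem_domain : ∀ t, 0 ≤ t → u t ∈ powDomain R (1 / 2)
  equation : ∀ t, 0 ≤ t → ∀ w : A.domain,
    HasDerivWithinAt (fun s => inner ℝ (u' s) (w : H))
      (-(m (powNormSq R (1 / 2) (u t)) * inner ℝ (u t) (A w))) (Ici 0) t

end Spaces

end Kirchhoff

end

/-! In the spectral representation each component of `u` solves `w'' = -c(t) a² w` with the common
coefficient `c = m(|A^(1/2) u|²)`. Once a function `τ` is put in place of `|A^(1/2) u|²` the problem
is linear and decouples (`wave`). What is sought is a `τ` that equals the `potential` it generates.

Everything rests on a bound for `potentialDeriv`, the derivative of `|A^(1/2) u|²`. If it is at most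
`K = q ^ j`, the coefficient has the modulus `L ω(K ·)`, and a component of frequency `a` is
amplified by at most a constant times `exp (C (1 + T) q φ(a))` (`HasGrowth`), with `j = 1` in the
strictly and `j = 2` in the weakly hyperbolic case. This follows from the energy `w'² + b a² w²`,
where `b` is a mean of `c` over a time scale adapted to `a`, raised by a small constant in the
degenerate case.

The a priori estimate (`Setting.exists_apriori`) splits the integral `potentialDeriv` at a frequency
`ρ`. Below `ρ` the Hamiltonian `|u'|² + ∫₀^(|A^(1/2) u|²) m` bounds it by `κ₀ ρ ^ j`. Above `ρ`,
with `q = κ ρ`, the growth rate is linear in `ρ`, whereas the Gevrey-Manfrin condition provides a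
weight of at least `exp (ρ² φ(a))`; for a large `ρ` taken from the sequence this part is at most `1
/ 2`. Hence the bound `K = (κ ρ) ^ j` improves itself, and it holds on all of `[0, T]` by
continuity.

Solutions come from equations whose coefficient has a delay `ε`, which finitely many iterations
solve (`Setting.exists_delayed`). For small `ε` the Hamiltonian is almost conserved and the a priori
estimate is uniform, so Arzelà-Ascoli gives a limit as `ε → 0`, which is the required fixed point
(`Setting.exists_fixed`). The growth estimate with the data in all the Gevrey spaces dominates every
integral (`Setting.exists_domination`) and gives the regularity of `u`. -/

namespace Kirchhoff

/-! ### Linear equations in a Banach space by Picard series. -/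

section LinearODE

/-- The terms of the Picard series of the linear equation `x' = A(t) x`. -/
noncomputable def picardTerm {E : Type*} [NormedAddCommGroup E] [NormedSpace ℝ E]
    (A : ℝ → E →L[ℝ] E) (x : E) : ℕ → ℝ → E
  | 0 => fun _ => x
  | k + 1 => fun t => ∫ s in (0 : ℝ)..t, A s (picardTerm A x k s)

variable {E : Type*} [NormedAddCommGroup E] [NormedSpace ℝ E]

theorem continuous_picardTerm {A : ℝ → E →L[ℝ] E} (hA : Continuous A) (x : E) (k : ℕ) :
    Continuous (picardTerm A x k) := by
  induction k with
  | zero => exact continuous_const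
  | succ k ih =>
    exact intervalIntegral.continuous_primitive
      (fun a b => (hA.clm_apply ih).intervalIntegrable a b) 0

theorem hasDerivAt_picardTerm_succ [CompleteSpace E] {A : ℝ → E →L[ℝ] E} (hA : Continuous A)
    (x : E) (k : ℕ)
    (t : ℝ) : HasDerivAt (picardTerm A x (k + 1)) (A t (picardTerm A x k t)) t :=
  ((hA.clm_apply (continuous_picardTerm hA x k)).integral_hasStrictDerivAt 0 t).hasDerivAt

theorem norm_picardTerm_le {A : ℝ → E →L[ℝ] E} {x : E} {T B : ℝ}
    (hB : ∀ t, |t| ≤ T → ‖A t‖ ≤ B) (k : ℕ) (t : ℝ) (ht : |t| ≤ T) :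
    ‖picardTerm A x k t‖ ≤ ‖x‖ * ((B * |t|) ^ k / k.factorial) := by
  have hB0 : 0 ≤ B := (norm_nonneg _).trans (hB t ht)
  induction k generalizing t with
  | zero => simp [picardTerm]
  | succ k ih =>
    have h1 : ‖picardTerm A x (k + 1) t‖ ≤
        |∫ s in (0 : ℝ)..t, ‖x‖ * B ^ (k + 1) / k.factorial * |s - 0| ^ k| := by
      refine intervalIntegral.norm_integral_le_abs_of_norm_le ?_ ?_
      · filter_upwards [ae_restrict_mem measurableSet_uIoc] with s hs
        have hs' : |s| ≤ T := by
          refine le_trans ?_ ht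
          rcases le_total 0 t with h | h
          · rw [uIoc_of_le h] at hs
            rw [abs_of_pos hs.1, abs_of_nonneg h]; exact hs.2
          · rw [uIoc_of_ge h] at hs
            rw [abs_of_nonpos hs.2, abs_of_nonpos h]; linarith [hs.1]
        calc ‖A s (picardTerm A x k s)‖ ≤ ‖A s‖ * ‖picardTerm A x k s‖ := (A s).le_opNorm _
          _ ≤ B * (‖x‖ * ((B * |s|) ^ k / k.factorial)) := by
            gcongr
            · exact hB s hs'
            · exact ih s hs'
          _ = _ := by rw [sub_zero, mul_pow, pow_succ]; ring
      · exact Continuous.intervalIntegrable (by fun_prop) _ _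
    refine h1.trans (le_of_eq ?_)
    rw [intervalIntegral.integral_const_mul, abs_mul, intervalIntegral.abs_intervalIntegral_eq,
      integral_pow_abs_sub_uIoc, abs_of_nonneg (by positivity), abs_of_nonneg (by positivity),
      sub_zero, Nat.factorial_succ]
    push_cast
    field_simp
    rw [mul_pow]
    ring

/-- A linear equation with continuous coefficients has a solution on the whole line. -/
theorem exists_linear_ode_solution [CompleteSpace E] {A : ℝ → E →L[ℝ] E} (hA : Continuous A) (x : E) :
    ∃ y : ℝ → E, y 0 = x ∧ ∀ t, HasDerivAt y (A t (y t)) t := by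
  refine ⟨fun t => ∑' k, picardTerm A x k t, ?_, fun t => ?_⟩
  · have : ∀ k, k ≠ 0 → picardTerm A x k 0 = 0 := by
      rintro (_ | k) hk
      · exact absurd rfl hk
      · simp [picardTerm]
    exact tsum_eq_single 0 this
  · obtain ⟨B, hB⟩ : ∃ B, ∀ s, |s| ≤ |t| + 1 → ‖A s‖ ≤ B := by
      obtain ⟨B, hB⟩ := (isCompact_Icc (a := -(|t| + 1)) (b := |t| + 1)).exists_bound_of_continuousOn
        hA.continuousOn
      exact ⟨B, fun s hs => hB s (abs_le.mp hs)⟩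
    have hB0 : 0 ≤ B := (norm_nonneg _).trans (hB 0 (by simp; positivity))
    have hbd : ∀ k s, |s| ≤ |t| + 1 → ‖picardTerm A x k s‖ ≤
        ‖x‖ * ((B * (|t| + 1)) ^ k / k.factorial) := fun k s hs =>
      (norm_picardTerm_le hB k s hs).trans (by gcongr)
    have hsum : Summable fun k : ℕ => ‖x‖ * ((B * (|t| + 1)) ^ k / k.factorial) :=
      (Real.summable_pow_div_factorial _).mul_left _
    have hs : ∀ s, |s| ≤ |t| + 1 → Summable fun k => picardTerm A x k s := fun s hs =>
      Summable.of_norm_bounded hsum fun k => hbd k s hs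
    -- The constant term of index `0` is left out. The derivative of the term `k + 1` is `A s`
    -- applied to the term `k`, so the derived series is `A` applied to the full sum.
    have hder := hasDerivAt_tsum_of_isPreconnected (𝕜 := ℝ)
      (g := fun k => picardTerm A x (k + 1)) (g' := fun k s => A s (picardTerm A x k s))
      (t := Ioo (-(|t| + 1)) (|t| + 1)) (y₀ := t) (y := t)
      (hsum.mul_left B) isOpen_Ioo isPreconnected_Ioo
      (fun k s _ => hasDerivAt_picardTerm_succ hA x k s)
      (fun k s hs => ((A s).le_opNorm _).trans (mul_le_mul (hB s (abs_le.mpr ⟨hs.1.le, hs.2.le⟩))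
        (hbd k s (abs_le.mpr ⟨hs.1.le, hs.2.le⟩)) (norm_nonneg _) hB0))
      (abs_lt.mp (by linarith)) ((summable_nat_add_iff 1).mpr (hs t (by linarith)))
      (abs_lt.mp (by linarith))
    rw [(A t).map_tsum (hs t (by linarith))]
    refine (hder.const_add x).congr_of_eventuallyEq ?_
    filter_upwards [Ioo_mem_nhds (abs_lt.mp (show |t| < |t| + 1 by linarith)).1
      (abs_lt.mp (show |t| < |t| + 1 by linarith)).2] with s hs'
    rw [(hs s (abs_le.mpr ⟨hs'.1.le, hs'.2.le⟩)).tsum_eq_zero_add]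
    rfl

end LinearODE

/-! ### The scalar oscillator `w'' = -b(t) w`: existence, uniqueness, dependence on `b`. -/

section SecondOrder

/-- The pair `(w, w')` solves `w'' = -b(t) w` at the point `t`. -/
def SolvesAt (b : ℝ → ℝ) (x : ℝ → ℝ × ℝ) (t : ℝ) : Prop :=
  HasDerivAt x ((x t).2, -(b t * (x t).1)) t

theorem exists_solvesAt {b : ℝ → ℝ} (hb : Continuous b) (x : ℝ × ℝ) :
    ∃ y : ℝ → ℝ × ℝ, y 0 = x ∧ ∀ t, SolvesAt b y t := by
  obtain ⟨y, h0, hy⟩ := exists_linear_ode_solution (E := ℝ × ℝ)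
    (A := fun t => (ContinuousLinearMap.inl ℝ ℝ ℝ).comp (ContinuousLinearMap.snd ℝ ℝ ℝ) -
      b t • (ContinuousLinearMap.inr ℝ ℝ ℝ).comp (ContinuousLinearMap.fst ℝ ℝ ℝ))
    (by fun_prop) x
  exact ⟨y, h0, fun t => by simpa [SolvesAt] using hy t⟩

theorem SolvesAt.fst {b : ℝ → ℝ} {x : ℝ → ℝ × ℝ} {t : ℝ} (h : SolvesAt b x t) :
    HasDerivAt (fun s => (x s).1) (x t).2 t := by
  exact (hasFDerivAt_fst (𝕜 := ℝ) (p := x t)).comp_hasDerivAt t h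

theorem SolvesAt.snd {b : ℝ → ℝ} {x : ℝ → ℝ × ℝ} {t : ℝ} (h : SolvesAt b x t) :
    HasDerivAt (fun s => (x s).2) (-(b t * (x t).1)) t := by
  exact (hasFDerivAt_snd (𝕜 := ℝ) (p := x t)).comp_hasDerivAt t h

/-- The difference solves the equation with coefficient `b` and the forcing `(b - c) y`, so only `y`
needs an a priori bound. The condition `1 ≤ B` accounts for the first component, whose equation has
coefficient `1` in the sup norm. -/
theorem norm_sub_le_gronwallBound {b c : ℝ → ℝ} {x y : ℝ → ℝ × ℝ} {T B Y η : ℝ}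
    (hx : ∀ t ∈ Icc 0 T, SolvesAt b x t) (hy : ∀ t ∈ Icc 0 T, SolvesAt c y t)
    (h0 : x 0 = y 0) (hB1 : 1 ≤ B) (hB : ∀ t ∈ Icc 0 T, |b t| ≤ B)
    (hY : ∀ t ∈ Icc 0 T, ‖y t‖ ≤ Y) (hη : ∀ t ∈ Icc 0 T, |b t - c t| ≤ η) :
    ∀ t ∈ Icc 0 T, ‖x t - y t‖ ≤ gronwallBound 0 B (η * Y) t := by
  intro t ht
  have hd : ∀ s ∈ Icc 0 T, HasDerivAt (fun s => x s - y s)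
      (((x s).2, -(b s * (x s).1)) - ((y s).2, -(c s * (y s).1))) s :=
    fun s hs => (hx s hs).sub (hy s hs)
  have := norm_le_gronwallBound_of_norm_deriv_right_le (f := fun s => x s - y s) (δ := 0)
    (K := B) (ε := η * Y) (a := 0) (b := T)
    (fun s hs => (hd s hs).continuousAt.continuousWithinAt)
    (fun s hs => (hd s ⟨hs.1, hs.2.le⟩).hasDerivWithinAt) (by simp [h0]) ?_ t ht
  · simpa using this
  · intro s hs
    have hs' : s ∈ Icc 0 T := ⟨hs.1, hs.2.le⟩
    have h1 : |(x s).1 - (y s).1| ≤ ‖x s - y s‖ := norm_fst_le (x s - y s)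
    have h2 : |(x s).2 - (y s).2| ≤ ‖x s - y s‖ := norm_snd_le (x s - y s)
    have h3 : |(y s).1| ≤ Y := (norm_fst_le (y s)).trans (hY s hs')
    have hη0 : 0 ≤ η := (abs_nonneg _).trans (hη s hs')
    have hY0 : 0 ≤ Y := (abs_nonneg _).trans h3
    refine norm_prod_le_iff.mpr ⟨?_, ?_⟩
    · simp only [Prod.fst_sub, Real.norm_eq_abs]
      have : ‖x s - y s‖ ≤ B * ‖x s - y s‖ := le_mul_of_one_le_left (norm_nonneg _) hB1
      have : 0 ≤ η * Y := by positivity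
      linarith
    · simp only [Prod.snd_sub, Real.norm_eq_abs]
      have e : -(b s * (x s).1) - -(c s * (y s).1) =
          -(b s * ((x s).1 - (y s).1) + (b s - c s) * (y s).1) := by ring
      rw [e, abs_neg]
      refine (abs_add_le _ _).trans (add_le_add ?_ ?_)
      · rw [abs_mul]
        exact mul_le_mul (hB s hs') h1 (abs_nonneg _) (by linarith)
      · rw [abs_mul]
        exact mul_le_mul (hη s hs') h3 (abs_nonneg _) hη0

theorem SolvesAt.eqOn {b c : ℝ → ℝ} {x y : ℝ → ℝ × ℝ} {T : ℝ} (hb : Continuous b)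
    (hx : ∀ t ∈ Icc 0 T, SolvesAt b x t) (hy : ∀ t ∈ Icc 0 T, SolvesAt c y t)
    (h0 : x 0 = y 0) (hbc : EqOn b c (Icc 0 T)) : EqOn x y (Icc 0 T) := by
  intro t ht
  obtain ⟨B, hB⟩ := (isCompact_Icc (a := (0 : ℝ)) (b := T)).exists_bound_of_continuousOn
    hb.continuousOn
  obtain ⟨Y, hY⟩ := (isCompact_Icc (a := (0 : ℝ)) (b := T)).exists_bound_of_continuousOn
    (fun s hs => (hy s hs).continuousAt.continuousWithinAt)
  have := norm_sub_le_gronwallBound (B := max B 1) (η := 0) hx hy h0 (le_max_right _ _)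
    (fun s hs => (hB s hs).trans (le_max_left _ _)) hY (fun s hs => by simp [hbc hs]) t ht
  rw [zero_mul, gronwallBound_ε0_δ0] at this
  exact sub_eq_zero.mp (norm_le_zero_iff.mp this)

theorem tendsto_of_solvesAt {ι : Type*} {l : Filter ι} {b : ι → ℝ → ℝ} {c : ℝ → ℝ}
    {x : ι → ℝ → ℝ × ℝ} {y : ℝ → ℝ × ℝ} {T : ℝ} (hc : Continuous c)
    (hx : ∀ i, ∀ t ∈ Icc 0 T, SolvesAt (b i) (x i) t) (hy : ∀ t ∈ Icc 0 T, SolvesAt c y t)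
    (h0 : ∀ i, x i 0 = y 0) (hbc : TendstoUniformlyOn b c l (Icc 0 T)) {t : ℝ}
    (ht : t ∈ Icc 0 T) : Tendsto (fun i => x i t) l (𝓝 (y t)) := by
  obtain ⟨B, hB⟩ := (isCompact_Icc (a := (0 : ℝ)) (b := T)).exists_bound_of_continuousOn
    hc.continuousOn
  obtain ⟨Y, hY⟩ := (isCompact_Icc (a := (0 : ℝ)) (b := T)).exists_bound_of_continuousOn
    (fun s hs => (hy s hs).continuousAt.continuousWithinAt)
  have hB0 : 0 ≤ B := (norm_nonneg _).trans (hB t ht)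
  rw [tendsto_iff_norm_sub_tendsto_zero, Metric.tendsto_nhds]
  intro ε hε
  have hg : Tendsto (fun η => gronwallBound 0 (B + 1) (η * Y) t) (𝓝 0) (𝓝 0) := by
    have : Continuous fun η => gronwallBound 0 (B + 1) (η * Y) t :=
      (gronwallBound_continuous_ε 0 (B + 1) t).comp (continuous_id.mul continuous_const)
    simpa [gronwallBound_ε0_δ0] using this.tendsto 0
  -- The condition `η ≤ 1` makes `B + 1` a common bound for all the coefficients that are `η`-close
  -- to `c`.
  have hg' : ∀ᶠ η in 𝓝[>] (0 : ℝ), gronwallBound 0 (B + 1) (η * Y) t < ε ∧ η ≤ 1 ∧ 0 < η := by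
    filter_upwards [nhdsWithin_le_nhds (hg.eventually (gt_mem_nhds hε)),
      nhdsWithin_le_nhds (Iic_mem_nhds (show (0 : ℝ) < 1 by norm_num)), self_mem_nhdsWithin]
      with η h1 h2 h3 using ⟨h1, h2, h3⟩
  obtain ⟨η, h1, h2, h3⟩ := hg'.exists
  filter_upwards [Metric.tendstoUniformlyOn_iff.mp hbc η h3] with i hi
  have hi' : ∀ s ∈ Icc 0 T, |b i s - c s| ≤ η := fun s hs => by
    have := (hi s hs).le
    rwa [dist_comm, Real.dist_eq] at this
  rw [dist_zero_right, norm_norm]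
  refine (norm_sub_le_gronwallBound (B := B + 1) (hx i) hy (h0 i) (by linarith) (fun s hs => ?_)
    hY hi' t ht).trans_lt h1
  have e1 := hB s hs
  have e2 := hi' s hs
  rw [Real.norm_eq_abs] at e1
  have : |b i s| ≤ |b i s - c s| + |c s| := by simpa using abs_add_le (b i s - c s) (c s)
  linarith

end SecondOrder

end Kirchhoff

namespace Kirchhoff

/-! ### Approximated energies for a coefficient of small oscillation. -/

section Energy

theorem le_gronwallBound_of_deriv_le {E E' : ℝ → ℝ} {r ε T : ℝ}
    (hE : ∀ t ∈ Icc 0 T, HasDerivWithinAt E (E' t) (Ici 0) t)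
    (h : ∀ t ∈ Icc 0 T, E' t ≤ r * E t + ε) :
    ∀ t ∈ Icc 0 T, E t ≤ gronwallBound (E 0) r ε t := by
  intro t ht
  have := le_gronwallBound_of_liminf_deriv_right_le (f := E) (f' := E') (δ := E 0) (K := r)
    (ε := ε) (a := 0) (b := T)
    (fun s hs => (hE s hs).continuousWithinAt.mono Icc_subset_Ici_self)
    (fun s hs q hq => ((hE s ⟨hs.1, hs.2.le⟩).mono (Ici_subset_Ici.mpr hs.1)).liminf_right_slope_le
      hq) le_rfl (fun s hs => h s ⟨hs.1, hs.2.le⟩) t ht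
  simpa using this

theorem le_mul_exp_of_deriv_le {E E' : ℝ → ℝ} {r T : ℝ}
    (hE : ∀ t ∈ Icc 0 T, HasDerivWithinAt E (E' t) (Ici 0) t)
    (h : ∀ t ∈ Icc 0 T, E' t ≤ r * E t) :
    ∀ t ∈ Icc 0 T, E t ≤ E 0 * Real.exp (r * t) := by
  intro t ht
  have := le_gronwallBound_of_deriv_le (ε := 0) hE (fun t ht => by simpa using h t ht) t ht
  rwa [gronwallBound_ε0] at this

/-- The basic estimate for the approximated energy `w'² + b a² w²` of `w'' = -c a² w`. -/
theorem approx_energy_le {a κ D₀ D₁ T : ℝ} {b b' c : ℝ → ℝ} {x : ℝ → ℝ × ℝ}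
    (ha : 0 ≤ a) (hκ : 0 < κ)
    (hb : ∀ t ∈ Icc 0 T, HasDerivAt b (b' t) t) (hbκ : ∀ t ∈ Icc 0 T, κ ≤ b t)
    (hb' : ∀ t ∈ Icc 0 T, |b' t| ≤ D₁) (hbc : ∀ t ∈ Icc 0 T, |b t - c t| ≤ D₀)
    (hx : ∀ t ∈ Icc 0 T, SolvesAt (fun s => c s * a ^ 2) x t) :
    ∀ t ∈ Icc 0 T, (x t).2 ^ 2 + b t * (a ^ 2 * (x t).1 ^ 2) ≤
      ((x 0).2 ^ 2 + b 0 * (a ^ 2 * (x 0).1 ^ 2)) *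
        Real.exp ((D₁ / κ + a * D₀ / √κ) * t) := by
  -- In the derivative of the energy only `b' a² w²` and `2 (b - c) a² w w'` survive. Since `κ ≤ b`,
  -- the first is absorbed at the rate `D₁ / κ`, the second, by Young's inequality for `√κ a |w|`
  -- and `|w'|`, at the rate `a D₀ / √κ`.
  refine le_mul_exp_of_deriv_le (E := fun t => (x t).2 ^ 2 + b t * (a ^ 2 * (x t).1 ^ 2))
    (E' := fun t => b' t * (a ^ 2 * (x t).1 ^ 2) +
      2 * ((b t - c t) * (a ^ 2 * ((x t).1 * (x t).2)))) (fun t ht => ?_) (fun t ht => ?_)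
  · have h1 := (hx t ht).fst
    have h2 := (hx t ht).snd
    refine (((h2.pow 2).add ((hb t ht).mul ((h1.pow 2).const_mul (a ^ 2)))).congr_deriv
      ?_).hasDerivWithinAt
    simp only [Pi.pow_apply]
    push_cast
    ring
  · set w := (x t).1
    set v := (x t).2
    have hs : 0 < √κ := Real.sqrt_pos.mpr hκ
    have hsq : √κ ^ 2 = κ := Real.sq_sqrt hκ.le
    have hN : v ^ 2 + κ * (a ^ 2 * w ^ 2) ≤ v ^ 2 + b t * (a ^ 2 * w ^ 2) := by
      have := hbκ t ht
      gcongr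
    have hD0 : 0 ≤ D₀ := (abs_nonneg _).trans (hbc t ht)
    have hD1 : 0 ≤ D₁ := (abs_nonneg _).trans (hb' t ht)
    have e1 : b' t * (a ^ 2 * w ^ 2) ≤ D₁ / κ * (v ^ 2 + b t * (a ^ 2 * w ^ 2)) :=
      calc b' t * (a ^ 2 * w ^ 2) ≤ D₁ * (a ^ 2 * w ^ 2) := by
            gcongr
            exact (le_abs_self _).trans (hb' t ht)
        _ = D₁ / κ * (κ * (a ^ 2 * w ^ 2)) := by field_simp
        _ ≤ _ := by
            gcongr
            nlinarith [sq_nonneg v]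
    have e2 : 2 * ((b t - c t) * (a ^ 2 * (w * v))) ≤
        a * D₀ / √κ * (v ^ 2 + b t * (a ^ 2 * w ^ 2)) :=
      calc 2 * ((b t - c t) * (a ^ 2 * (w * v)))
          ≤ |2 * ((b t - c t) * (a ^ 2 * (w * v)))| := le_abs_self _
        _ = |b t - c t| * (a * (2 * (a * |w| * |v|))) := by
            simp only [abs_mul, abs_pow, abs_of_nonneg ha, Nat.abs_ofNat]; ring
        _ ≤ D₀ * (a * (2 * (a * |w| * |v|))) := by
            gcongr
            exact hbc t ht
        _ = a * D₀ / √κ * (2 * (√κ * (a * |w|)) * |v|) := by field_simp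
        _ ≤ a * D₀ / √κ * ((√κ * (a * |w|)) ^ 2 + |v| ^ 2) := by
            gcongr
            exact two_mul_le_add_sq _ _
        _ = a * D₀ / √κ * (v ^ 2 + κ * (a ^ 2 * w ^ 2)) := by
            rw [mul_pow, mul_pow, hsq, sq_abs, sq_abs]; ring
        _ ≤ _ := by gcongr
    linarith

/-- Steklov averages. -/
theorem exists_smooth_approx {c : ℝ → ℝ} (hc : Continuous c) {δ η ν Γ : ℝ} (hδ : 0 < δ)
    (h : ∀ s t, |s - t| ≤ δ → |c s - c t| ≤ η) (hν : ∀ t, ν ≤ c t) (hΓ : ∀ t, c t ≤ Γ) :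
    ∃ b b' : ℝ → ℝ, ∀ t, HasDerivAt b (b' t) t ∧ |b' t| ≤ η / δ ∧ |b t - c t| ≤ η ∧
      ν ≤ b t ∧ b t ≤ Γ := by
  set F : ℝ → ℝ := fun t => ∫ s in (0 : ℝ)..t, c s
  have hF : ∀ t, HasDerivAt F (c t) t := fun t => (hc.integral_hasStrictDerivAt 0 t).hasDerivAt
  have hb : ∀ t, F (t + δ) - F t = ∫ s in t..t + δ, c s := fun t =>
    intervalIntegral.integral_interval_sub_left (hc.intervalIntegrable _ _)
      (hc.intervalIntegrable _ _)
  have hlow : ∀ t (ν : ℝ), (∀ s ∈ Icc t (t + δ), ν ≤ c s) → ν ≤ δ⁻¹ * (F (t + δ) - F t) := by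
    intro t ν hν
    have := intervalIntegral.integral_mono_on (μ := volume) (a := t) (b := t + δ)
      (f := fun _ => ν) (g := c) (by linarith)
      (by simp) (hc.intervalIntegrable _ _) hν
    rw [hb, le_inv_mul_iff₀ hδ]
    simpa [mul_comm] using this
  have hupp : ∀ t (ν : ℝ), (∀ s ∈ Icc t (t + δ), c s ≤ ν) → δ⁻¹ * (F (t + δ) - F t) ≤ ν := by
    intro t ν hν
    have := intervalIntegral.integral_mono_on (μ := volume) (a := t) (b := t + δ)
      (f := c) (g := fun _ => ν) (by linarith)
      (hc.intervalIntegrable _ _) (by simp) hν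
    rw [hb, inv_mul_le_iff₀ hδ]
    simpa [mul_comm] using this
  have hosc : ∀ t, ∀ s ∈ Icc t (t + δ), |c s - c t| ≤ η := fun t s hs =>
    h s t (abs_le.mpr ⟨by linarith [hs.1], by linarith [hs.2]⟩)
  refine ⟨fun t => δ⁻¹ * (F (t + δ) - F t), fun t => δ⁻¹ * (c (t + δ) - c t), fun t =>
    ⟨?_, ?_, ?_, hlow t ν fun s _ => hν s, hupp t Γ fun s _ => hΓ s⟩⟩
  · exact (((hF (t + δ)).comp_add_const t δ).sub (hF t)).const_mul _
  · rw [abs_mul, abs_of_pos (inv_pos.mpr hδ), inv_mul_eq_div]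
    gcongr
    exact h _ _ (by simp [abs_of_pos hδ])
  · have h1 := hlow t (c t - η) fun s hs => by linarith [(abs_le.mp (hosc t s hs)).1]
    have h2 := hupp t (c t + η) fun s hs => by linarith [(abs_le.mp (hosc t s hs)).2]
    exact abs_le.mpr ⟨by linarith, by linarith⟩

/-- The coefficient of the energy is the mean over the scale `δ` plus `μ`. The shift keeps the
energy coercive when `ν = 0` and costs the additional approximation error `μ`. -/
theorem energy_le_of_oscillation {a T δ η ν μ Γ : ℝ} {c : ℝ → ℝ} {x : ℝ → ℝ × ℝ}
    (hc : Continuous c) (ha : 0 ≤ a) (hδ : 0 < δ) (hμ : 0 ≤ μ) (hκ : 0 < ν + μ)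
    (h : ∀ s t, |s - t| ≤ δ → |c s - c t| ≤ η) (hν : ∀ t, ν ≤ c t) (hΓ : ∀ t, c t ≤ Γ)
    (hx : ∀ t ∈ Icc 0 T, SolvesAt (fun s => c s * a ^ 2) x t) :
    ∀ t ∈ Icc 0 T, (x t).2 ^ 2 + (ν + μ) * (a ^ 2 * (x t).1 ^ 2) ≤
      ((x 0).2 ^ 2 + (Γ + μ) * (a ^ 2 * (x 0).1 ^ 2)) *
        Real.exp ((η / δ / (ν + μ) + a * (η + μ) / √(ν + μ)) * t) := by
  intro t ht
  obtain ⟨b, b', hb⟩ := exists_smooth_approx hc hδ h hν hΓ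
  have := approx_energy_le (b := fun t => b t + μ) (b' := b') (c := c) (D₁ := η / δ)
    (D₀ := η + μ) ha hκ (fun t _ => (hb t).1.add_const μ)
    (fun t _ => by linarith [(hb t).2.2.2.1])
    (fun t _ => (hb t).2.1)
    (fun t _ => by
      have e : b t + μ - c t = (b t - c t) + μ := by ring
      rw [e]
      refine (abs_add_le _ _).trans ?_
      rw [abs_of_nonneg hμ]
      linarith [(hb t).2.2.1]) hx t ht
  refine le_trans ?_ (this.trans ?_)
  · have := (hb t).2.2.2.1
    gcongr
  · have := (hb 0).2.2.2.2
    gcongr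

end Energy

/-! ### Moduli of continuity. -/

section Modulus

variable {ω : ℝ → ℝ}

/-- Subadditivity treats integer factors; rounding `q` up costs the summand `1`. -/
theorem IsContinuityModulus.mul_le (hω : IsContinuityModulus ω) {q x : ℝ} (hq : 0 ≤ q)
    (hx : 0 ≤ x) : ω (q * x) ≤ (q + 1) * ω x := by
  have hn : ∀ n : ℕ, ω (n * x) ≤ n * ω x := by
    intro n
    induction n with
    | zero => simp [hω.map_zero]
    | succ n ih =>
      have := hω.subadditive (n * x) x (by positivity) hx
      push_cast
      rw [add_mul, one_mul, add_mul, one_mul]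
      linarith
  calc ω (q * x) ≤ ω (⌈q⌉₊ * x) :=
        hω.monotoneOn (mem_Ici.mpr (by positivity)) (mem_Ici.mpr (by positivity))
          (by gcongr; exact Nat.le_ceil q)
    _ ≤ ⌈q⌉₊ * ω x := hn _
    _ ≤ (q + 1) * ω x := by
        gcongr
        · exact hω.nonneg x hx
        · exact (Nat.ceil_lt_add_one hq).le

theorem IsContinuityModulus.pos (hω : IsContinuityModulus ω) {y : ℝ} (hy0 : 0 ≤ y)
    (hy : ω y ≠ 0) {x : ℝ} (hx : 0 < x) : 0 < ω x := by
  refine lt_of_le_of_ne (hω.nonneg x hx.le) fun h0 => hy (le_antisymm ?_ (hω.nonneg y hy0))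
  have := hω.mul_le (q := y / x) (x := x) (by positivity) hx.le
  rwa [← h0, mul_zero, div_mul_cancel₀ _ hx.ne'] at this

theorem IsContinuityModulus.tendsto_zero (hω : IsContinuityModulus ω) :
    Tendsto (fun t => ω |t|) (𝓝 0) (𝓝 0) := by
  have h1 : Tendsto (fun t : ℝ => |t|) (𝓝 0) (𝓝[Ici 0] 0) :=
    tendsto_nhdsWithin_iff.mpr ⟨by simpa using (continuous_abs (G := ℝ)).tendsto 0,
      Eventually.of_forall fun t => abs_nonneg t⟩
  have h2 := (hω.continuousOn 0 self_mem_Ici).tendsto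
  rw [hω.map_zero] at h2
  exact h2.comp h1

theorem IsOmegaContinuous.exists_one_le {m : ℝ → ℝ} (hω : IsContinuityModulus ω)
    (hm : IsOmegaContinuous ω m) :
    ∃ L : ℝ, 1 ≤ L ∧ ∀ x y : ℝ, 0 ≤ x → 0 ≤ y → |m x - m y| ≤ L * ω |x - y| := by
  obtain ⟨L, hL⟩ := hm
  refine ⟨max L 1, le_max_right _ _, fun x y hx hy => (hL x y hx hy).trans ?_⟩
  have := hω.nonneg |x - y| (abs_nonneg _)
  gcongr
  exact le_max_left _ _

theorem IsOmegaContinuous.continuousOn {m : ℝ → ℝ} (hω : IsContinuityModulus ω)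
    (hm : IsOmegaContinuous ω m) : ContinuousOn m (Ici 0) := by
  obtain ⟨L, -, hL⟩ := hm.exists_one_le hω
  intro x hx
  rw [ContinuousWithinAt, tendsto_iff_norm_sub_tendsto_zero]
  have h : Tendsto (fun y => L * ω |y - x|) (𝓝[Ici 0] x) (𝓝 0) := by
    have h1 : Tendsto (fun y => y - x) (𝓝[Ici 0] x) (𝓝 0) := by
      have : Tendsto (fun y => y - x) (𝓝 x) (𝓝 (x - x)) := (continuous_sub_right x).tendsto x
      rw [sub_self] at this
      exact this.mono_left nhdsWithin_le_nhds
    simpa using (hω.tendsto_zero.comp h1).const_mul L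
  refine squeeze_zero' (Eventually.of_forall fun y => norm_nonneg _) ?_ h
  filter_upwards [self_mem_nhdsWithin] with y hy using hL y x hy hx

end Modulus

/-! ### Growth of a component in terms of the Lipschitz constant of `τ`. -/

section Growth

/-- The exponential growth estimate for the components of the solutions of the linear equation
`w'' = -m(τ(t)) a² w`, for a function `τ` with Lipschitz constant `q ^ j`. -/
def HasGrowth (m φ : ℝ → ℝ) (j : ℕ) (C : ℝ) : Prop :=
  ∀ (q T : ℝ) (τ : ℝ → ℝ), 1 ≤ q → (∀ t ∈ Icc 0 T, 0 ≤ τ t) →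
    (∀ s ∈ Icc 0 T, ∀ t ∈ Icc 0 T, |τ s - τ t| ≤ q ^ j * |s - t|) →
    ∀ (a : ℝ) (x : ℝ → ℝ × ℝ), 0 < a →
    (∀ t ∈ Icc 0 T, SolvesAt (fun s => m (τ s) * a ^ 2) x t) →
    ∀ t ∈ Icc 0 T, a ^ 2 * (x t).1 ^ 2 + (x t).2 ^ 2 ≤
      C * (1 + m (τ 0) + q ^ j * (1 + T)) * (a ^ 2 * (x 0).1 ^ 2 + (x 0).2 ^ 2) *
        Real.exp (C * (1 + T) * q * φ a)

variable {ω m φ : ℝ → ℝ} {L : ℝ}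

/-- The estimate with the parameters `ν, μ, δ` of the approximation of the coefficient still
free. -/
theorem energy_le_of_lipschitz (hω : IsContinuityModulus ω)
    (hmω : ContinuousOn m (Ici 0)) (hL1 : 1 ≤ L)
    (hL : ∀ x y : ℝ, 0 ≤ x → 0 ≤ y → |m x - m y| ≤ L * ω |x - y|)
    {ν : ℝ} (hν : ∀ x, 0 ≤ x → ν ≤ m x)
    {K T : ℝ} {τ : ℝ → ℝ} (hK : 0 ≤ K) (hT : 0 ≤ T) (hτ : ∀ t ∈ Icc 0 T, 0 ≤ τ t)
    (hτK : ∀ s ∈ Icc 0 T, ∀ t ∈ Icc 0 T, |τ s - τ t| ≤ K * |s - t|)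
    {a μ δ : ℝ} (ha : 0 ≤ a) (hδ : 0 < δ) (hμ : 0 ≤ μ) (hκ : 0 < ν + μ)
    {x : ℝ → ℝ × ℝ} (hx : ∀ t ∈ Icc 0 T, SolvesAt (fun s => m (τ s) * a ^ 2) x t) :
    ∀ t ∈ Icc 0 T, (x t).2 ^ 2 + (ν + μ) * (a ^ 2 * (x t).1 ^ 2) ≤
      ((x 0).2 ^ 2 + (m (τ 0) + L * ω 1 * (1 + K * T) + μ) * (a ^ 2 * (x 0).1 ^ 2)) *
        Real.exp ((L * ω (K * δ) / δ / (ν + μ) + a * (L * ω (K * δ) + μ) / √(ν + μ)) * t) := by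
  -- The means reach beyond `T`, where nothing is known of `τ`. Composing with the projection onto
  -- `[0, T]`, which is 1-Lipschitz, gives a coefficient on the whole line with the same modulus.
  set p : ℝ → ℝ := fun t => max 0 (min t T)
  have hp : ∀ t, p t ∈ Icc 0 T := fun t => ⟨le_max_left _ _, max_le hT (min_le_right _ _)⟩
  have hpe : ∀ t ∈ Icc 0 T, p t = t := fun t ht => by
    simp only [p, min_eq_left ht.2, max_eq_right ht.1]
  have hpl : ∀ s t, |p s - p t| ≤ |s - t| := fun s t =>
    (by
      have h1 := abs_max_sub_max_le_max 0 (min s T) 0 (min t T)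
      have h2 := abs_min_sub_min_le_max s T t T
      rw [sub_self, abs_zero, max_eq_right (abs_nonneg (min s T - min t T))] at h1
      rw [sub_self, abs_zero, max_eq_left (abs_nonneg (s - t))] at h2
      exact h1.trans h2)
  have hτp : Continuous (τ ∘ p) := by
    have h1 : ContinuousOn τ (Icc 0 T) := by
      refine LipschitzOnWith.continuousOn (K := ⟨K, hK⟩) ?_
      exact LipschitzOnWith.of_dist_le_mul fun s hs t ht => hτK s hs t ht
    exact h1.comp_continuous (by fun_prop) hp
  set c : ℝ → ℝ := fun t => m (τ (p t))
  have hc : Continuous c := hmω.comp_continuous hτp fun t => hτ _ (hp t)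
  have hcω : ∀ s t, |c s - c t| ≤ L * ω (K * |p s - p t|) := by
    intro s t
    refine (hL _ _ (hτ _ (hp s)) (hτ _ (hp t))).trans ?_
    gcongr
    exact hω.monotoneOn (mem_Ici.mpr (abs_nonneg _)) (mem_Ici.mpr (by positivity)) (hτK _ (hp s) _ (hp t))
  have hΓ : ∀ t, c t ≤ m (τ 0) + L * ω 1 * (1 + K * T) := by
    intro t
    have h1 := (le_abs_self _).trans (hcω t 0)
    have h0 : p 0 = 0 := hpe 0 ⟨le_rfl, hT⟩
    have h2 : ω (K * |p t - p 0|) ≤ (K * T + 1) * ω 1 := by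
      refine le_trans ?_ (hω.mul_le (by positivity) zero_le_one)
      refine hω.monotoneOn (mem_Ici.mpr (by positivity)) (mem_Ici.mpr (by positivity)) ?_
      rw [h0, sub_zero, abs_of_nonneg (hp t).1, mul_one]
      gcongr
      exact (hp t).2
    have h3 : L * ω (K * |p t - p 0|) ≤ L * ((K * T + 1) * ω 1) := by gcongr
    have h4 : c 0 = m (τ 0) := by simp only [c, h0]
    rw [h4] at h1
    linarith
  have hxc : ∀ t ∈ Icc 0 T, SolvesAt (fun s => c s * a ^ 2) x t := by
    intro t ht
    have := hx t ht
    simp only [SolvesAt, c, hpe t ht] at this ⊢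
    exact this
  refine energy_le_of_oscillation hc ha hδ hμ hκ (fun s t hst => (hcω s t).trans ?_)
    (fun t => hν _ (hτ _ (hp t))) hΓ hxc
  gcongr
  exact hω.monotoneOn (mem_Ici.mpr (by positivity)) (mem_Ici.mpr (by positivity))
    (by gcongr; exact (hpl s t).trans hst)

/-- At the scale `δ = 1 / a` both terms of the rate are multiples of `a ω(q / a) ≤ 2 q a ω(1 / a)`,
and `a ω(1 / a)` is controlled by `φ a`. No shift `μ` is needed. -/
theorem hasGrowth_of_strictlyHyperbolic (hω : IsContinuityModulus ω) (hφ : ∀ x, 0 ≤ x → 1 ≤ φ x)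
    (hm : IsOmegaContinuous ω m) {ν Λ : ℝ} (hν0 : 0 < ν)
    (hν : ∀ x, 0 ≤ x → ν ≤ m x)
    (hΛ : ∀ σ : ℝ, 0 < σ → σ * ω (1 / σ) ≤ Λ * φ σ) : ∃ C, 1 ≤ C ∧ HasGrowth m φ 1 C := by
  obtain ⟨L, hL1, hL⟩ := hm.exists_one_le hω
  have hω1 := hω.nonneg 1 zero_le_one
  have hs : 0 < √ν := Real.sqrt_pos.mpr hν0
  set C₁ := (1 + 1 / ν) * (1 + L * ω 1)
  set C₂ := 2 * L * (1 / ν + 1 / √ν) * |Λ|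
  have hC₁ : 1 ≤ C₁ := one_le_mul_of_one_le_of_one_le (by simp; positivity) (by simp; positivity)
  have hC₂ : 0 ≤ C₂ := by positivity
  refine ⟨C₁ + C₂, by linarith, ?_⟩
  intro q T τ hq hτ hτq a x ha hx t ht
  have hT : 0 ≤ T := ht.1.trans ht.2
  rw [pow_one] at hτq ⊢
  have hφa := hφ a ha.le
  have hE := energy_le_of_lipschitz (μ := 0) (δ := 1 / a) hω (hm.continuousOn hω) hL1 hL hν
    (by linarith) hT hτ hτq ha.le (by positivity) le_rfl (by linarith) hx t ht
  rw [add_zero, add_zero, add_zero] at hE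
  have hm0 : 0 ≤ m (τ 0) := hν0.le.trans (hν _ (hτ 0 ⟨le_rfl, hT⟩))
  have hωa := hω.nonneg (1 / a) (by positivity)
  have hη : L * ω (q * (1 / a)) ≤ 2 * L * q * ω (1 / a) := by
    have h1 := hω.mul_le (q := q) (x := 1 / a) (by linarith) (by positivity)
    have h2 : (q + 1) * ω (1 / a) ≤ 2 * q * ω (1 / a) := by gcongr; linarith
    calc L * ω (q * (1 / a)) ≤ L * (2 * q * ω (1 / a)) := by gcongr; linarith
      _ = _ := by ring
  have haφ : a * ω (1 / a) ≤ |Λ| * φ a := (hΛ a ha).trans (by gcongr; exact le_abs_self _)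
  have hrate : L * ω (q * (1 / a)) / (1 / a) / ν + a * (L * ω (q * (1 / a))) / √ν ≤
      C₂ * q * φ a :=
    calc L * ω (q * (1 / a)) / (1 / a) / ν + a * (L * ω (q * (1 / a))) / √ν
        = a * (L * ω (q * (1 / a))) * (1 / ν + 1 / √ν) := by field_simp
      _ ≤ a * (2 * L * q * ω (1 / a)) * (1 / ν + 1 / √ν) := by gcongr
      _ = 2 * L * q * (1 / ν + 1 / √ν) * (a * ω (1 / a)) := by ring
      _ ≤ 2 * L * q * (1 / ν + 1 / √ν) * (|Λ| * φ a) := by gcongr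
      _ = _ := by simp only [C₂]; ring
  have hexp : (L * ω (q * (1 / a)) / (1 / a) / ν + a * (L * ω (q * (1 / a))) / √ν) * t ≤
      (C₁ + C₂) * (1 + T) * q * φ a :=
    calc _ ≤ C₂ * q * φ a * (1 + T) := by
          gcongr
          · exact ht.1
          · linarith [ht.2]
      _ ≤ (C₁ + C₂) * q * φ a * (1 + T) := by gcongr; linarith
      _ = _ := by ring
  have hpre : (x 0).2 ^ 2 + (m (τ 0) + L * ω 1 * (1 + q * T)) * (a ^ 2 * (x 0).1 ^ 2) ≤
      (1 + L * ω 1) * (1 + m (τ 0) + q * (1 + T)) * (a ^ 2 * (x 0).1 ^ 2 + (x 0).2 ^ 2) := by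
    have hLω : 0 ≤ L * ω 1 := by positivity
    have h1 : m (τ 0) + L * ω 1 * (1 + q * T) ≤ (1 + L * ω 1) * (1 + m (τ 0) + q * (1 + T)) := by
      have : 0 ≤ q * T := by positivity
      nlinarith [mul_nonneg hLω hm0]
    have h2 : 1 ≤ (1 + L * ω 1) * (1 + m (τ 0) + q * (1 + T)) :=
      one_le_mul_of_one_le_of_one_le (by linarith) (by nlinarith)
    have h3 := mul_le_mul_of_nonneg_right h1 (show 0 ≤ a ^ 2 * (x 0).1 ^ 2 by positivity)
    have h4 := mul_le_mul_of_nonneg_right h2 (sq_nonneg (x 0).2)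
    linarith
  calc a ^ 2 * (x t).1 ^ 2 + (x t).2 ^ 2
      ≤ (1 + 1 / ν) * ((x t).2 ^ 2 + ν * (a ^ 2 * (x t).1 ^ 2)) := by
        have e : (1 + 1 / ν) * ((x t).2 ^ 2 + ν * (a ^ 2 * (x t).1 ^ 2)) =
          a ^ 2 * (x t).1 ^ 2 + (x t).2 ^ 2 + (ν * (a ^ 2 * (x t).1 ^ 2) +
            1 / ν * (x t).2 ^ 2) := by field_simp; ring
        rw [e]
        have : 0 ≤ ν * (a ^ 2 * (x t).1 ^ 2) + 1 / ν * (x t).2 ^ 2 := by positivity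
        linarith
    _ ≤ (1 + 1 / ν) * ((1 + L * ω 1) * (1 + m (τ 0) + q * (1 + T)) *
          (a ^ 2 * (x 0).1 ^ 2 + (x 0).2 ^ 2) * Real.exp ((C₁ + C₂) * (1 + T) * q * φ a)) := by
        gcongr
        exact hE.trans (by gcongr)
    _ = C₁ * ((1 + m (τ 0) + q * (1 + T)) * (a ^ 2 * (x 0).1 ^ 2 + (x 0).2 ^ 2) *
          Real.exp ((C₁ + C₂) * (1 + T) * q * φ a)) := by simp only [C₁]; ring
    _ ≤ (C₁ + C₂) * ((1 + m (τ 0) + q * (1 + T)) * (a ^ 2 * (x 0).1 ^ 2 + (x 0).2 ^ 2) *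
          Real.exp ((C₁ + C₂) * (1 + T) * q * φ a)) := by
        gcongr
        linarith
    _ = _ := by ring

/-- In the weakly hyperbolic case, the scale `δ` that balances the two terms of the growth rate
at the frequency `a`. -/
theorem exists_scale (hω : IsContinuityModulus ω) (hφ : ∀ x, 0 ≤ x → 1 ≤ φ x) {Λ : ℝ}
    (hΛ : ∀ σ : ℝ, 0 < σ → σ ≤ Λ * φ (σ / √(ω (1 / σ)))) :
    0 < ω 1 ∧ ∃ C, 1 ≤ C ∧ ∀ a, 0 < a → ∃ δ, 0 < δ ∧ δ ≤ 1 ∧ 1 / δ ≤ C * φ a ∧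
      a ^ 2 * ω δ ≤ (1 / δ) ^ 2 := by
  -- If `ω` vanished identically, the quotient in `hΛ` would be `σ / 0 = 0`, and `Λ * φ 0` would
  -- bound every `σ`.
  have hpos : ∀ x, 0 < x → 0 < ω x := by
    intro x hx
    obtain ⟨y, hy0, hy⟩ : ∃ y, 0 ≤ y ∧ ω y ≠ 0 := by
      by_contra! hc
      have h1 := hΛ (|Λ * φ 0| + 1) (by positivity)
      rw [hc _ (by positivity), Real.sqrt_zero, div_zero] at h1
      linarith [le_abs_self (Λ * φ 0)]
    exact hω.pos hy0 hy hx
  have hω1 := hpos 1 one_pos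
  have hs1 : 0 < √(ω 1) := Real.sqrt_pos.mpr hω1
  refine ⟨hω1, 1 + |Λ|, by simp, fun a ha => ?_⟩
  -- The intermediate value theorem solves `a = σ / √(ω (1 / σ))`. Then `hΛ` reads `σ ≤ Λ * φ a`,
  -- and `δ = 1 / σ` satisfies `a² ω(δ) = (1 / δ)²`.
  have hcont : ContinuousOn (fun σ => σ / √(ω (1 / σ))) (Ioi 0) := by
    have h1 : ContinuousOn (fun σ : ℝ => 1 / σ) (Ioi 0) :=
      continuousOn_const.div continuousOn_id fun σ hσ => (mem_Ioi.mp hσ).ne'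
    have h2 : ContinuousOn (fun σ : ℝ => ω (1 / σ)) (Ioi 0) :=
      hω.continuousOn.comp h1 fun σ hσ => mem_Ici.mpr (by have := mem_Ioi.mp hσ; positivity)
    exact continuousOn_id.div h2.sqrt fun σ hσ =>
      (Real.sqrt_pos.mpr (hpos _ (by have := mem_Ioi.mp hσ; positivity))).ne'
  have hlo : (fun σ => σ / √(ω (1 / σ))) (min 1 (a * √(ω 1))) ≤ a := by
    have h0 : 0 < min 1 (a * √(ω 1)) := lt_min one_pos (by positivity)
    have h1 : √(ω 1) ≤ √(ω (1 / min 1 (a * √(ω 1)))) := by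
      refine Real.sqrt_le_sqrt (hω.monotoneOn (mem_Ici.mpr zero_le_one)
        (mem_Ici.mpr (by positivity)) ?_)
      rw [one_le_div h0]
      exact min_le_left _ _
    calc _ ≤ min 1 (a * √(ω 1)) / √(ω 1) := div_le_div_of_nonneg_left h0.le hs1 h1
      _ ≤ a * √(ω 1) / √(ω 1) := by gcongr; exact min_le_right _ _
      _ = a := by field_simp
  have hhi : a ≤ (fun σ => σ / √(ω (1 / σ))) (max 1 (a * √(ω 1))) := by
    have h0 : 0 < max 1 (a * √(ω 1)) := lt_max_of_lt_left one_pos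
    have h1 : √(ω (1 / max 1 (a * √(ω 1)))) ≤ √(ω 1) := by
      refine Real.sqrt_le_sqrt (hω.monotoneOn (mem_Ici.mpr (by positivity))
        (mem_Ici.mpr zero_le_one) ?_)
      rw [div_le_one h0]
      exact le_max_left _ _
    calc a = a * √(ω 1) / √(ω 1) := by field_simp
      _ ≤ max 1 (a * √(ω 1)) / √(ω 1) := by gcongr; exact le_max_right _ _
      _ ≤ _ := div_le_div_of_nonneg_left h0.le
        (Real.sqrt_pos.mpr (hpos _ (by positivity))) h1
  obtain ⟨σ, hσ, hσa⟩ := isPreconnected_Ioi.intermediate_value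
    (mem_Ioi.mpr (lt_min one_pos (by positivity))) (mem_Ioi.mpr (lt_max_of_lt_left one_pos))
    hcont ⟨hlo, hhi⟩
  rw [mem_Ioi] at hσ
  have hφa := hφ a ha.le
  have hσφ : σ ≤ |Λ| * φ a := by
    have h1 := hΛ σ hσ
    rw [show σ / √(ω (1 / σ)) = a from hσa] at h1
    exact h1.trans (by gcongr; exact le_abs_self _)
  have hσ2 : a ^ 2 * ω (1 / σ) = σ ^ 2 := by
    have h1 := hpos (1 / σ) (by positivity)
    rw [← hσa, div_pow, Real.sq_sqrt h1.le]
    field_simp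
  -- For `σ ≤ 1` the scale is cut down to `δ = 1`, which is harmless because `a² ω(1) ≤ a² ω(1 / σ)
  -- = σ² ≤ 1`.
  rcases le_total 1 σ with h | h
  · exact ⟨1 / σ, by positivity, by rw [div_le_one hσ]; exact h, by
      rw [one_div_one_div]; linarith, by rw [hσ2, one_div_one_div]⟩
  · refine ⟨1, one_pos, le_rfl, ?_, ?_⟩
    · have : 0 ≤ |Λ| * φ a := hσ.le.trans hσφ
      linarith
    · have h1 : a ^ 2 * ω 1 ≤ a ^ 2 * ω (1 / σ) := by
        gcongr
        exact hω.monotoneOn (mem_Ici.mpr zero_le_one) (mem_Ici.mpr (by positivity))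
          (by rwa [one_le_div hσ])
      rw [hσ2] at h1
      have : σ ^ 2 ≤ 1 := pow_le_one₀ hσ.le h
      linarith

/-- The shift `μ` is the oscillation `η = L ω(q² δ)` itself, so the rate becomes `1 / δ + 2 a √η`.
Since `η ≤ 2 L q² ω(δ)`, the square root turns the Lipschitz constant `q²` into a factor `q`; this
is why `j = 2` goes with an exponent linear in `q`. The scale from `exists_scale` makes both terms
at most a multiple of `q φ(a)`. -/
theorem hasGrowth_of_weaklyHyperbolic (hω : IsContinuityModulus ω) (hφ : ∀ x, 0 ≤ x → 1 ≤ φ x)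
    (hm : IsOmegaContinuous ω m) (hm0 : ∀ x, 0 ≤ x → 0 ≤ m x) {Λ : ℝ}
    (hΛ : ∀ σ : ℝ, 0 < σ → σ ≤ Λ * φ (σ / √(ω (1 / σ)))) :
    ∃ C, 1 ≤ C ∧ HasGrowth m φ 2 C := by
  obtain ⟨L, hL1, hL⟩ := hm.exists_one_le hω
  obtain ⟨hω1, D, hD1, hD⟩ := exists_scale hω hφ hΛ
  set C₁ := (1 + 2 * D / ω 1) * (1 + 3 * (L * ω 1))
  set C₂ := 1 + (1 + 2 * √(2 * L)) * D
  have hC₁ : 1 ≤ C₁ := one_le_mul_of_one_le_of_one_le (by simp; positivity) (by simp; positivity)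
  have hC₂ : 0 ≤ C₂ := by positivity
  refine ⟨C₁ + C₂, by linarith, ?_⟩
  intro q T τ hq hτ hτq a x ha hx t ht
  have hT : 0 ≤ T := ht.1.trans ht.2
  have hφa := hφ a ha.le
  obtain ⟨δ, hδ0, hδ1, hδφ, haδ⟩ := hD a ha
  have hmτ : 0 ≤ m (τ 0) := hm0 _ (hτ 0 ⟨le_rfl, hT⟩)
  have hq2 : 1 ≤ q ^ 2 := one_le_pow₀ hq
  set η := L * ω (q ^ 2 * δ)
  have hωδ : 0 ≤ ω δ := hω.nonneg δ hδ0.le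
  have hδη : δ * ω 1 / 2 ≤ η := by
    have h1 := hω.mul_le (q := 1 / δ) (x := δ) (by positivity) hδ0.le
    rw [one_div_mul_cancel hδ0.ne'] at h1
    have h2 : (1 / δ + 1) * ω δ ≤ 2 / δ * ω δ := by
      gcongr
      have : 1 ≤ 1 / δ := by rwa [one_le_div hδ0]
      have e : 2 / δ = 1 / δ + 1 / δ := by ring
      linarith
    have h3 : ω δ ≤ η :=
      calc ω δ ≤ ω (q ^ 2 * δ) := hω.monotoneOn (mem_Ici.mpr hδ0.le)
            (mem_Ici.mpr (by positivity)) (le_mul_of_one_le_left hδ0.le hq2)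
        _ ≤ η := le_mul_of_one_le_left (hω.nonneg _ (by positivity)) hL1
    calc δ * ω 1 / 2 ≤ δ * (2 / δ * ω δ) / 2 := by gcongr; exact h1.trans h2
      _ = ω δ := by field_simp
      _ ≤ η := h3
  have hη0 : 0 < η := lt_of_lt_of_le (by positivity) hδη
  have hηu : η ≤ 2 * L * q ^ 2 * ω δ := by
    have h1 := hω.mul_le (q := q ^ 2) (x := δ) (by positivity) hδ0.le
    have h2 : (q ^ 2 + 1) * ω δ ≤ 2 * q ^ 2 * ω δ := by gcongr; linarith
    calc η ≤ L * (2 * q ^ 2 * ω δ) := by simp only [η]; gcongr; linarith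
      _ = _ := by ring
  have hη1 : η ≤ 2 * (L * ω 1) * q ^ 2 := by
    refine hηu.trans ?_
    have : ω δ ≤ ω 1 := hω.monotoneOn (mem_Ici.mpr hδ0.le) (mem_Ici.mpr zero_le_one) hδ1
    calc 2 * L * q ^ 2 * ω δ ≤ 2 * L * q ^ 2 * ω 1 := by gcongr
      _ = _ := by ring
  have hE := energy_le_of_lipschitz (ν := 0) (μ := η) (δ := δ) hω (hm.continuousOn hω) hL1 hL hm0
    (by positivity) hT hτ hτq ha.le hδ0 hη0.le (by linarith) hx t ht
  rw [zero_add] at hE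
  have hsη : 0 < √η := Real.sqrt_pos.mpr hη0
  have haη : a * √η ≤ √(2 * L) * q / δ := by
    rw [← abs_of_nonneg (show 0 ≤ a * √η by positivity),
      ← abs_of_nonneg (show 0 ≤ √(2 * L) * q / δ by positivity), ← sq_le_sq, mul_pow,
      Real.sq_sqrt hη0.le, div_pow, mul_pow, Real.sq_sqrt (by positivity)]
    calc a ^ 2 * η ≤ a ^ 2 * (2 * L * q ^ 2 * ω δ) := by gcongr
      _ = 2 * L * q ^ 2 * (a ^ 2 * ω δ) := by ring
      _ ≤ 2 * L * q ^ 2 * (1 / δ) ^ 2 := by gcongr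
      _ = _ := by field_simp
  have hrate : η / δ / η + a * (η + η) / √η ≤ (1 + 2 * √(2 * L)) * D * (q * φ a) :=
    calc η / δ / η + a * (η + η) / √η = 1 / δ + 2 * (a * √η) := by
          have : η / √η = √η := Real.div_sqrt
          rw [div_right_comm, div_self hη0.ne', ← two_mul, mul_div_assoc, mul_div_assoc, this]
          ring
      _ ≤ 1 / δ + 2 * (√(2 * L) * q / δ) := by gcongr
      _ ≤ q / δ + 2 * (√(2 * L) * q / δ) := by gcongr
      _ = (1 + 2 * √(2 * L)) * q * (1 / δ) := by ring
      _ ≤ (1 + 2 * √(2 * L)) * q * (D * φ a) := by gcongr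
      _ = _ := by ring
  have hexp : φ a + (η / δ / η + a * (η + η) / √η) * t ≤ (C₁ + C₂) * (1 + T) * q * φ a :=
    calc _ ≤ q * φ a * (1 + T) + (1 + 2 * √(2 * L)) * D * (q * φ a) * (1 + T) := by
          gcongr
          · have h1 : φ a ≤ q * φ a := le_mul_of_one_le_left (by linarith) hq
            exact h1.trans (le_mul_of_one_le_right (by positivity) (by linarith))
          · exact ht.1
          · linarith [ht.2]
      _ = C₂ * (q * φ a * (1 + T)) := by simp only [C₂]; ring
      _ ≤ (C₁ + C₂) * (q * φ a * (1 + T)) := by gcongr; linarith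
      _ = _ := by ring
  have hpre : (x 0).2 ^ 2 + (m (τ 0) + L * ω 1 * (1 + q ^ 2 * T) + η) * (a ^ 2 * (x 0).1 ^ 2) ≤
      (1 + 3 * (L * ω 1)) * (1 + m (τ 0) + q ^ 2 * (1 + T)) *
        (a ^ 2 * (x 0).1 ^ 2 + (x 0).2 ^ 2) := by
    have hLω : 0 ≤ L * ω 1 := by positivity
    have hqT : 0 ≤ q ^ 2 * T := by positivity
    have h1 : m (τ 0) + L * ω 1 * (1 + q ^ 2 * T) + η ≤
        (1 + 3 * (L * ω 1)) * (1 + m (τ 0) + q ^ 2 * (1 + T)) := by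
      nlinarith [mul_nonneg hLω hmτ, mul_nonneg hLω hqT]
    have h2 : 1 ≤ (1 + 3 * (L * ω 1)) * (1 + m (τ 0) + q ^ 2 * (1 + T)) :=
      one_le_mul_of_one_le_of_one_le (by linarith) (by nlinarith)
    have h3 := mul_le_mul_of_nonneg_right h1 (show 0 ≤ a ^ 2 * (x 0).1 ^ 2 by positivity)
    have h4 := mul_le_mul_of_nonneg_right h2 (sq_nonneg (x 0).2)
    linarith
  -- Undoing the weight `η` of the degenerate energy costs `1 / η`, which is of order `1 / δ`, hence
  -- of order `φ a`. The resulting exponential is the extra summand `φ a` in `hexp`.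
  have hpref : 1 + 1 / η ≤ (1 + 2 * D / ω 1) * Real.exp (φ a) := by
    have h1 : φ a ≤ Real.exp (φ a) := by linarith [Real.add_one_le_exp (φ a)]
    have h2 : 1 / η ≤ 2 * D / ω 1 * Real.exp (φ a) :=
      calc 1 / η ≤ 1 / (δ * ω 1 / 2) := one_div_le_one_div_of_le (by positivity) hδη
        _ = 2 / ω 1 * (1 / δ) := by field_simp
        _ ≤ 2 / ω 1 * (D * φ a) := by gcongr
        _ = 2 * D / ω 1 * φ a := by ring
        _ ≤ _ := by gcongr
    linarith
  calc a ^ 2 * (x t).1 ^ 2 + (x t).2 ^ 2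
      ≤ (1 + 1 / η) * ((x t).2 ^ 2 + η * (a ^ 2 * (x t).1 ^ 2)) := by
        have e : (1 + 1 / η) * ((x t).2 ^ 2 + η * (a ^ 2 * (x t).1 ^ 2)) =
          a ^ 2 * (x t).1 ^ 2 + (x t).2 ^ 2 + (η * (a ^ 2 * (x t).1 ^ 2) +
            1 / η * (x t).2 ^ 2) := by field_simp; ring
        rw [e]
        have : 0 ≤ η * (a ^ 2 * (x t).1 ^ 2) + 1 / η * (x t).2 ^ 2 := by positivity
        linarith
    _ ≤ (1 + 2 * D / ω 1) * Real.exp (φ a) *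
          ((1 + 3 * (L * ω 1)) * (1 + m (τ 0) + q ^ 2 * (1 + T)) *
          (a ^ 2 * (x 0).1 ^ 2 + (x 0).2 ^ 2) *
            Real.exp ((η / δ / η + a * (η + η) / √η) * t)) := by
        gcongr
        exact hE.trans (by gcongr)
    _ = C₁ * ((1 + m (τ 0) + q ^ 2 * (1 + T)) * (a ^ 2 * (x 0).1 ^ 2 + (x 0).2 ^ 2) *
          Real.exp (φ a + (η / δ / η + a * (η + η) / √η) * t)) := by
        rw [Real.exp_add]
        simp only [C₁]
        ring
    _ ≤ (C₁ + C₂) * ((1 + m (τ 0) + q ^ 2 * (1 + T)) * (a ^ 2 * (x 0).1 ^ 2 + (x 0).2 ^ 2) *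
          Real.exp ((C₁ + C₂) * (1 + T) * q * φ a)) := by
        gcongr
        linarith
    _ = _ := by ring

end Growth

end Kirchhoff

namespace Kirchhoff

/-! ### Differentiation under the integral sign on a half-line. -/

section ParametricIntegral

variable {M : Type*} [MeasurableSpace M] {μ : Measure M}

theorem abs_slope_le {F F' : ℝ → ℝ} {T G : ℝ}
    (hd : ∀ s ∈ Icc 0 T, HasDerivWithinAt F (F' s) (Icc 0 T) s)
    (hb : ∀ s ∈ Icc 0 T, |F' s| ≤ G) {s t : ℝ} (hs : s ∈ Icc 0 T) (ht : t ∈ Icc 0 T) :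
    |(s - t)⁻¹ * (F s - F t)| ≤ G := by
  have hG : 0 ≤ G := (abs_nonneg _).trans (hb t ht)
  have := (convex_Icc 0 T).norm_image_sub_le_of_norm_hasDerivWithin_le hd hb ht hs
  rw [Real.norm_eq_abs, Real.norm_eq_abs] at this
  rcases eq_or_ne s t with rfl | hne
  · simpa using hG
  · rw [abs_mul, abs_inv, inv_mul_le_iff₀ (abs_pos.mpr (sub_ne_zero.mpr hne)), mul_comm]
    exact this

theorem eventually_mem_Icc {T t : ℝ} (ht : t ∈ Ico 0 T) (s : Set ℝ) (hs : s ⊆ Ici 0) :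
    ∀ᶠ x in 𝓝[s] t, x ∈ Icc 0 T := by
  filter_upwards [nhdsWithin_le_nhds (Iio_mem_nhds ht.2), self_mem_nhdsWithin] with x h1 h2
    using ⟨hs h2, (mem_Iio.mp h1).le⟩

theorem tendsto_slope_of_hasDerivWithinAt {F F' : ℝ → ℝ} {T t : ℝ} (ht : t ∈ Ico 0 T)
    (hd : HasDerivWithinAt F (F' t) (Icc 0 T) t) :
    Tendsto (fun s => (s - t)⁻¹ * (F s - F t)) (𝓝[Ici 0 \ {t}] t) (𝓝 (F' t)) := by
  have h1 : HasDerivWithinAt F (F' t) (Ici 0) t :=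
    hd.mono_of_mem_nhdsWithin (eventually_mem_Icc ht _ subset_rfl)
  simpa [slope_fun_def] using hasDerivWithinAt_iff_tendsto_slope.mp h1

theorem hasDerivWithinAt_integral {F F' : ℝ → M → ℝ} {g : M → ℝ} {T : ℝ}
    (hF : ∀ s ∈ Icc 0 T, Integrable (F s) μ)
    (hd : ∀ ξ, ∀ s ∈ Icc 0 T, HasDerivWithinAt (fun r => F r ξ) (F' s ξ) (Icc 0 T) s)
    (hb : ∀ ξ, ∀ s ∈ Icc 0 T, |F' s ξ| ≤ g ξ) (hg : Integrable g μ) {t : ℝ}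
    (ht : t ∈ Ico 0 T) :
    HasDerivWithinAt (fun s => ∫ ξ, F s ξ ∂μ) (∫ ξ, F' t ξ ∂μ) (Ici 0) t := by
  have ht' : t ∈ Icc 0 T := ⟨ht.1, ht.2.le⟩
  rw [hasDerivWithinAt_iff_tendsto_slope]
  have hev := eventually_mem_Icc ht (Ici 0 \ {t}) sdiff_subset
  have h := tendsto_integral_filter_of_dominated_convergence (μ := μ)
    (l := 𝓝[Ici 0 \ {t}] t) (F := fun s ξ => (s - t)⁻¹ * (F s ξ - F t ξ)) (f := F' t) g
    (hev.mono fun s hs => (((hF s hs).sub (hF t ht')).const_mul _).aestronglyMeasurable)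
    (hev.mono fun s hs => Eventually.of_forall fun ξ =>
      abs_slope_le (F := fun r => F r ξ) (hd ξ) (hb ξ) hs ht') hg
    (Eventually.of_forall fun ξ =>
      tendsto_slope_of_hasDerivWithinAt (F := fun r => F r ξ) (F' := fun r => F' r ξ) ht
        (hd ξ t ht'))
  refine h.congr' (hev.mono fun s hs => ?_)
  rw [slope_def_field, integral_const_mul, integral_sub (hF s hs) (hF t ht'), inv_mul_eq_div]

end ParametricIntegral

/-! ### The solution of the linear problem, frequency by frequency. -/

section Flow

open Classical in
/-- The solution `(w, w')` of `w'' = -b(t) w` with `(w(0), w'(0)) = x`. -/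
noncomputable def flow (b : ℝ → ℝ) (x : ℝ × ℝ) : ℝ → ℝ × ℝ :=
  if h : Continuous b then (exists_solvesAt h x).choose else 0

theorem flow_zero {b : ℝ → ℝ} (hb : Continuous b) (x : ℝ × ℝ) : flow b x 0 = x := by
  rw [flow, dif_pos hb]
  exact (exists_solvesAt hb x).choose_spec.1

theorem solvesAt_flow {b : ℝ → ℝ} (hb : Continuous b) (x : ℝ × ℝ) (t : ℝ) :
    SolvesAt b (flow b x) t := by
  rw [flow, dif_pos hb]
  exact (exists_solvesAt hb x).choose_spec.2 t

/-- This serves the measurability of `wave` in `ξ`: apart from the factors `f₀ ξ` and `f₁ ξ`, it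
depends on `ξ` only through `l = a ξ ^ 2`. -/
theorem continuous_flow_mul {c : ℝ → ℝ} (hc : Continuous c) (x : ℝ × ℝ) {t : ℝ} (ht : 0 ≤ t) :
    Continuous fun l : ℝ => flow (fun s => c s * l) x t := by
  rw [continuous_iff_continuousAt]
  intro l
  refine tendsto_of_solvesAt (T := t) (b := fun k s => c s * k) (c := fun s => c s * l)
    (x := fun k => flow (fun s => c s * k) x) (by fun_prop)
    (fun k s _ => solvesAt_flow (by fun_prop) x s) (fun s _ => solvesAt_flow (by fun_prop) x s)
    (fun k => by rw [flow_zero (by fun_prop), flow_zero (by fun_prop)]) ?_ ⟨ht, le_rfl⟩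
  obtain ⟨B, hB⟩ := (isCompact_Icc (a := (0 : ℝ)) (b := t)).exists_bound_of_continuousOn
    hc.continuousOn
  have hB0 : 0 ≤ B := (norm_nonneg _).trans (hB t ⟨ht, le_rfl⟩)
  rw [Metric.tendstoUniformlyOn_iff]
  intro ε hε
  filter_upwards [Metric.ball_mem_nhds l (show 0 < ε / (B + 1) by positivity)] with k hk s hs
  have h1 := hB s hs
  rw [Metric.mem_ball, lt_div_iff₀ (by positivity), dist_comm] at hk
  rw [Real.dist_eq, ← mul_sub, abs_mul, ← Real.dist_eq]
  rw [Real.norm_eq_abs] at h1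
  nlinarith [dist_nonneg (x := l) (y := k)]

variable {M : Type*}

/-- The function `(û(t), û'(t))` for the linear problem with the coefficient `m(τ(t))`. -/
noncomputable def wave (m : ℝ → ℝ) (a f₀ f₁ : M → ℝ) (τ : ℝ → ℝ) (t : ℝ) (ξ : M) : ℝ × ℝ :=
  f₀ ξ • flow (fun s => m (τ s) * a ξ ^ 2) (1, 0) t +
    f₁ ξ • flow (fun s => m (τ s) * a ξ ^ 2) (0, 1) t

variable {m : ℝ → ℝ} {a f₀ f₁ : M → ℝ} {τ : ℝ → ℝ}

theorem wave_zero (hc : Continuous fun s => m (τ s)) (ξ : M) :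
    wave m a f₀ f₁ τ 0 ξ = (f₀ ξ, f₁ ξ) := by
  have hb : Continuous fun s => m (τ s) * a ξ ^ 2 := hc.mul continuous_const
  rw [wave, flow_zero hb, flow_zero hb]
  simp

theorem solvesAt_wave (hc : Continuous fun s => m (τ s)) (ξ : M) (t : ℝ) :
    SolvesAt (fun s => m (τ s) * a ξ ^ 2) (fun s => wave m a f₀ f₁ τ s ξ) t := by
  have h0 := solvesAt_flow (b := fun s => m (τ s) * a ξ ^ 2) (hc.mul continuous_const) (1, 0) t
  have h1 := solvesAt_flow (b := fun s => m (τ s) * a ξ ^ 2) (hc.mul continuous_const) (0, 1) t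
  have h := (h0.const_smul (f₀ ξ)).add (h1.const_smul (f₁ ξ))
  refine h.congr_deriv ?_
  ext
  · simp [wave]
  · simp [wave]
    ring

theorem measurable_wave [MeasurableSpace M] (hc : Continuous fun s => m (τ s))
    (ha : Measurable a) (h0 : Measurable f₀) (h1 : Measurable f₁) {t : ℝ} (ht : 0 ≤ t) :
    Measurable (wave m a f₀ f₁ τ t) :=
  (h0.smul ((continuous_flow_mul hc _ ht).measurable.comp (ha.pow_const 2))).add
    (h1.smul ((continuous_flow_mul hc _ ht).measurable.comp (ha.pow_const 2)))

/-- Causality: the past of `τ` determines the solution. The iteration for the delayed problem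
terminates for this reason. -/
theorem wave_congr {τ' : ℝ → ℝ} (hc : Continuous fun s => m (τ s))
    (hc' : Continuous fun s => m (τ' s)) {T : ℝ} (h : EqOn τ τ' (Icc 0 T)) {t : ℝ}
    (ht : t ∈ Icc 0 T) (ξ : M) : wave m a f₀ f₁ τ t ξ = wave m a f₀ f₁ τ' t ξ := by
  refine SolvesAt.eqOn (b := fun s => m (τ s) * a ξ ^ 2) (hc.mul continuous_const)
    (fun s _ => solvesAt_wave hc ξ s) (fun s _ => solvesAt_wave hc' ξ s)
    (by rw [wave_zero hc, wave_zero hc']) (fun s hs => ?_) ht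
  simp only [h hs]

theorem tendsto_wave {ι : Type*} {l : Filter ι} {τs : ι → ℝ → ℝ}
    (hc : Continuous fun s => m (τ s)) (hcs : ∀ i, Continuous fun s => m (τs i s)) {T : ℝ}
    (h : TendstoUniformlyOn (fun i s => m (τs i s)) (fun s => m (τ s)) l (Icc 0 T)) {t : ℝ}
    (ht : t ∈ Icc 0 T) (ξ : M) :
    Tendsto (fun i => wave m a f₀ f₁ (τs i) t ξ) l (𝓝 (wave m a f₀ f₁ τ t ξ)) := by
  refine tendsto_of_solvesAt (T := T) (b := fun i s => m (τs i s) * a ξ ^ 2)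
    (c := fun s => m (τ s) * a ξ ^ 2) (x := fun i s => wave m a f₀ f₁ (τs i) s ξ) (hc.mul continuous_const)
    (fun i s _ => solvesAt_wave (hcs i) ξ s) (fun s _ => solvesAt_wave hc ξ s)
    (fun i => by rw [wave_zero hc, wave_zero (hcs i)]) ?_ ht
  rw [Metric.tendstoUniformlyOn_iff] at h ⊢
  intro ε hε
  filter_upwards [h (ε / (a ξ ^ 2 + 1)) (by positivity)] with i hi s hs
  have := hi s hs
  rw [Real.dist_eq, lt_div_iff₀ (by positivity)] at this
  rw [Real.dist_eq, ← sub_mul, abs_mul, abs_of_nonneg (sq_nonneg (a ξ))]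
  nlinarith [abs_nonneg (m (τ s) - m (τs i s))]

end Flow

/-! ### Hypotheses in spectral form and integrable dominating functions. -/

section Setting

variable {M : Type*} [MeasurableSpace M] {μ : Measure M} {m φ : ℝ → ℝ} {a f₀ f₁ : M → ℝ}
  {j : ℕ} {C : ℝ}

/-- The assumptions on the coefficient and on the (transformed) initial data. -/
structure Setting (μ : Measure M) (m φ : ℝ → ℝ) (a f₀ f₁ : M → ℝ) (j : ℕ) (C : ℝ) : Prop where
  m_cont : ContinuousOn m (Ici 0)
  m_nonneg : ∀ x, 0 ≤ x → 0 ≤ m x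
  one_le_φ : ∀ x, 0 ≤ x → 1 ≤ φ x
  one_le_C : 1 ≤ C
  strict_or : (j = 1 ∧ ∃ ν, 0 < ν ∧ ∀ x, 0 ≤ x → ν ≤ m x) ∨ j = 2
  growth : HasGrowth m φ j C
  meas_a : Measurable a
  a_nonneg : ∀ ξ, 0 ≤ a ξ
  meas_φ : AEMeasurable (fun ξ => φ (a ξ)) μ
  meas_f₀ : Measurable f₀
  meas_f₁ : Measurable f₁
  int_sq : Integrable (fun ξ => f₀ ξ ^ 2 + f₁ ξ ^ 2) μ
  int_exp : ∀ r, 0 < r → Integrable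
    (fun ξ => a ξ * (a ξ ^ 2 * f₀ ξ ^ 2 + f₁ ξ ^ 2) * Real.exp (r * φ (a ξ))) μ

/-- `τ` has the Lipschitz constant `K` on `[0, T]`. -/
def LipTo (K T : ℝ) (τ : ℝ → ℝ) : Prop :=
  ∀ s ∈ Icc 0 T, ∀ t ∈ Icc 0 T, |τ s - τ t| ≤ K * |s - t|

/-- The functions that are admitted as arguments of `m` in the linear problem. -/
structure Admissible (σ₀ : ℝ) (τ : ℝ → ℝ) : Prop where
  cont : Continuous τ
  nonneg : ∀ t, 0 ≤ τ t
  zero : τ 0 = σ₀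
  lip : ∀ T, ∃ K, 1 ≤ K ∧ LipTo K T τ

theorem LipTo.mono {K K' T T' : ℝ} {τ : ℝ → ℝ} (h : LipTo K T τ) (hK : K ≤ K') (hT : T' ≤ T) :
    LipTo K' T' τ := fun s hs t ht =>
  (h s ⟨hs.1, hs.2.trans hT⟩ t ⟨ht.1, ht.2.trans hT⟩).trans (by gcongr)

theorem Setting.continuous_coeff (h : Setting μ m φ a f₀ f₁ j C) {σ₀ : ℝ} {τ : ℝ → ℝ}
    (hτ : Admissible σ₀ τ) : Continuous fun s => m (τ s) :=
  h.m_cont.comp_continuous hτ.cont hτ.nonneg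

theorem Setting.j_ne_zero (h : Setting μ m φ a f₀ f₁ j C) : j ≠ 0 := by
  rcases h.strict_or with ⟨rfl, -⟩ | rfl <;> norm_num

/-- Bounds for the components of the solutions that are uniform with respect to `τ`. -/
theorem Setting.exists_domination (h : Setting μ m φ a f₀ f₁ j C) (σ₀ : ℝ) {K T : ℝ}
    (hK : 1 ≤ K) (hT : 0 ≤ T) :
    ∃ (g : ℝ → M → ℝ) (Γ : ℝ), (∀ r, 0 ≤ r → Integrable (g r) μ) ∧
      ∀ τ, Admissible σ₀ τ → LipTo K T τ → ∀ t ∈ Icc 0 T, m (τ t) ≤ Γ ∧ ∀ ξ, ∀ r, 0 ≤ r →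
        (wave m a f₀ f₁ τ t ξ).1 ^ 2 + (wave m a f₀ f₁ τ t ξ).2 ^ 2 +
          a ξ * (a ξ ^ 2 * (wave m a f₀ f₁ τ t ξ).1 ^ 2 + (wave m a f₀ f₁ τ t ξ).2 ^ 2) *
            Real.exp (r * φ (a ξ)) ≤ g r ξ := by
  obtain ⟨Γ, hΓ⟩ : ∃ Γ, ∀ x ∈ Icc 0 (σ₀ + K * T), m x ≤ Γ := by
    obtain ⟨Γ, hΓ⟩ := (isCompact_Icc (a := (0 : ℝ)) (b := σ₀ + K * T)).exists_bound_of_continuousOn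
      (h.m_cont.mono Icc_subset_Ici_self)
    exact ⟨Γ, fun x hx => (le_abs_self _).trans (hΓ x hx)⟩
  -- These are the constants of the growth estimate with `q = K`, which is available because `K ≤ K
  -- ^ j`. The size of `G` does not matter, as the data are integrable against every exponential
  -- weight.
  set P := C * (1 + m σ₀ + K ^ j * (1 + T)) with hP
  set G := C * (1 + T) * K with hG
  have hC := h.one_le_C
  have hG0 : 0 < G := by positivity
  refine ⟨fun r ξ => Real.exp ((1 + Γ) * T) * (f₀ ξ ^ 2 + f₁ ξ ^ 2) +
    2 * P * (a ξ * (a ξ ^ 2 * f₀ ξ ^ 2 + f₁ ξ ^ 2) * Real.exp ((G + r) * φ (a ξ))), Γ,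
    fun r hr => (h.int_sq.const_mul _).add ((h.int_exp _ (by linarith)).const_mul _), ?_⟩
  intro τ hτ hLip t ht
  have hc := h.continuous_coeff hτ
  have hmem : ∀ s ∈ Icc 0 T, τ s ∈ Icc 0 (σ₀ + K * T) := by
    intro s hs
    refine ⟨hτ.nonneg s, ?_⟩
    have h1 := (le_abs_self _).trans (hLip s hs 0 ⟨le_rfl, hT⟩)
    rw [hτ.zero, sub_zero, abs_of_nonneg hs.1] at h1
    have : K * s ≤ K * T := by gcongr; exact hs.2
    linarith
  refine ⟨hΓ _ (hmem t ht), fun ξ r hr => ?_⟩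
  have hσ₀ : 0 ≤ σ₀ := hτ.zero ▸ hτ.nonneg 0
  have hm0 := h.m_nonneg σ₀ hσ₀
  have hP0 : 0 ≤ P := by positivity
  have ha := h.a_nonneg ξ
  have hφ := h.one_le_φ _ ha
  set x := fun s => wave m a f₀ f₁ τ s ξ with hx
  have hx0 : x 0 = (f₀ ξ, f₁ ξ) := wave_zero hc ξ
  have hsol : ∀ s, SolvesAt (fun s => m (τ s) * a ξ ^ 2) x s := solvesAt_wave hc ξ
  change (x t).1 ^ 2 + (x t).2 ^ 2 + a ξ * (a ξ ^ 2 * (x t).1 ^ 2 + (x t).2 ^ 2) *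
            Real.exp (r * φ (a ξ)) ≤ _
  have key : ∀ r, 0 ≤ r → a ξ * (a ξ ^ 2 * (x t).1 ^ 2 + (x t).2 ^ 2) * Real.exp (r * φ (a ξ)) ≤
      P * (a ξ * (a ξ ^ 2 * f₀ ξ ^ 2 + f₁ ξ ^ 2) * Real.exp ((G + r) * φ (a ξ))) := by
    intro r hr
    rcases ha.eq_or_lt with h0 | hpos
    · rw [← h0]; simp
    · have hgr := h.growth K T τ hK (fun s _ => hτ.nonneg s)
        (hLip.mono (le_self_pow₀ hK h.j_ne_zero) le_rfl)
        (a ξ) x hpos (fun s _ => hsol s) t ht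
      rw [hτ.zero, hx0] at hgr
      calc a ξ * (a ξ ^ 2 * (x t).1 ^ 2 + (x t).2 ^ 2) * Real.exp (r * φ (a ξ))
          ≤ a ξ * (P * (a ξ ^ 2 * f₀ ξ ^ 2 + f₁ ξ ^ 2) * Real.exp (G * φ (a ξ))) *
            Real.exp (r * φ (a ξ)) := by gcongr
        _ = _ := by rw [add_mul, Real.exp_add]; ring
  have hr := key r hr
  have h0 := key 0 le_rfl
  rw [zero_mul, Real.exp_zero, mul_one, add_zero] at h0
  have hexp : P * (a ξ * (a ξ ^ 2 * f₀ ξ ^ 2 + f₁ ξ ^ 2) * Real.exp (G * φ (a ξ))) ≤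
      P * (a ξ * (a ξ ^ 2 * f₀ ξ ^ 2 + f₁ ξ ^ 2) * Real.exp ((G + r) * φ (a ξ))) := by
    gcongr
    linarith
  have hlow : (x t).1 ^ 2 + (x t).2 ^ 2 ≤ Real.exp ((1 + Γ) * T) * (f₀ ξ ^ 2 + f₁ ξ ^ 2) +
      a ξ * (a ξ ^ 2 * (x t).1 ^ 2 + (x t).2 ^ 2) := by
    have hΓ0 : 0 ≤ Γ := (h.m_nonneg _ (hτ.nonneg t)).trans (hΓ _ (hmem t ht))
    -- The weighted energy does not control `w² + w'²` near `a = 0`. For `a ≤ 1` this sum has growth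
    -- rate at most `1 + Γ`; for `a ≥ 1` the weighted energy dominates it.
    rcases le_total (a ξ) 1 with h1 | h1
    · have := le_mul_exp_of_deriv_le (E := fun s => (x s).1 ^ 2 + (x s).2 ^ 2)
        (E' := fun s => 2 * (1 - m (τ s) * a ξ ^ 2) * ((x s).1 * (x s).2)) (r := 1 + Γ) (T := T)
        (fun s _ => (((hsol s).fst.pow 2).add ((hsol s).snd.pow 2)).congr_deriv
          (by push_cast; ring) |>.hasDerivWithinAt) (fun s hs => by
          have e1 : |1 - m (τ s) * a ξ ^ 2| ≤ 1 + Γ := by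
            have e2 := hΓ _ (hmem s hs)
            have e3 := h.m_nonneg _ (hτ.nonneg s)
            have e4 : a ξ ^ 2 ≤ 1 := pow_le_one₀ ha h1
            have e5 : m (τ s) * a ξ ^ 2 ≤ m (τ s) := mul_le_of_le_one_right e3 e4
            exact abs_le.mpr ⟨by linarith, by nlinarith [mul_nonneg e3 (sq_nonneg (a ξ))]⟩
          calc 2 * (1 - m (τ s) * a ξ ^ 2) * ((x s).1 * (x s).2)
              ≤ |2 * (1 - m (τ s) * a ξ ^ 2) * ((x s).1 * (x s).2)| := le_abs_self _
            _ = |1 - m (τ s) * a ξ ^ 2| * (2 * |(x s).1| * |(x s).2|) := by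
              simp only [abs_mul, Nat.abs_ofNat]; ring
            _ ≤ (1 + Γ) * (|(x s).1| ^ 2 + |(x s).2| ^ 2) := by
              gcongr
              exact two_mul_le_add_sq _ _
            _ = _ := by rw [sq_abs, sq_abs]) t ht
      simp only [hx0] at this
      have e : (f₀ ξ ^ 2 + f₁ ξ ^ 2) * Real.exp ((1 + Γ) * t) ≤
          Real.exp ((1 + Γ) * T) * (f₀ ξ ^ 2 + f₁ ξ ^ 2) := by
        rw [mul_comm]
        gcongr
        exact ht.2
      have : 0 ≤ a ξ * (a ξ ^ 2 * (x t).1 ^ 2 + (x t).2 ^ 2) := by positivity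
      linarith
    · have e1 : (x t).1 ^ 2 ≤ a ξ ^ 2 * (x t).1 ^ 2 :=
        le_mul_of_one_le_left (sq_nonneg _) (one_le_pow₀ h1)
      have e2 : a ξ ^ 2 * (x t).1 ^ 2 + (x t).2 ^ 2 ≤
          a ξ * (a ξ ^ 2 * (x t).1 ^ 2 + (x t).2 ^ 2) :=
        le_mul_of_one_le_left (by positivity) h1
      have : 0 ≤ Real.exp ((1 + Γ) * T) * (f₀ ξ ^ 2 + f₁ ξ ^ 2) := by positivity
      linarith
  linarith

end Setting

end Kirchhoff

namespace Kirchhoff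

/-! ### The quadratic functionals of the solution and the problem with delay. -/

section Functionals

variable {M : Type*} [MeasurableSpace M] {μ : Measure M} {m φ : ℝ → ℝ} {a f₀ f₁ : M → ℝ}
  {j : ℕ} {C : ℝ}

/-- `|A^(1/2) u(t)|²` for the solution of the linear problem with the coefficient `m(τ(t))`. -/
noncomputable def potential (μ : Measure M) (m : ℝ → ℝ) (a f₀ f₁ : M → ℝ) (τ : ℝ → ℝ) (t : ℝ) :
    ℝ := ∫ ξ, a ξ ^ 2 * (wave m a f₀ f₁ τ t ξ).1 ^ 2 ∂μ

/-- The derivative of `potential`. -/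
noncomputable def potentialDeriv (μ : Measure M) (m : ℝ → ℝ) (a f₀ f₁ : M → ℝ) (τ : ℝ → ℝ)
    (t : ℝ) : ℝ :=
  ∫ ξ, 2 * a ξ ^ 2 * ((wave m a f₀ f₁ τ t ξ).1 * (wave m a f₀ f₁ τ t ξ).2) ∂μ

/-- `|u'(t)|²`. -/
noncomputable def kinetic (μ : Measure M) (m : ℝ → ℝ) (a f₀ f₁ : M → ℝ) (τ : ℝ → ℝ) (t : ℝ) :
    ℝ := ∫ ξ, (wave m a f₀ f₁ τ t ξ).2 ^ 2 ∂μ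

/-- `|u(t)|²`. -/
noncomputable def mass (μ : Measure M) (m : ℝ → ℝ) (a f₀ f₁ : M → ℝ) (τ : ℝ → ℝ) (t : ℝ) :
    ℝ := ∫ ξ, (wave m a f₀ f₁ τ t ξ).1 ^ 2 ∂μ

/-- A single dominating function thus serves for the potential, kinetic and mass densities and for
the integrands of their derivatives. -/
theorem sq_bounds {α x y g : ℝ} (hα : 0 ≤ α)
    (h : x ^ 2 + y ^ 2 + α * (α ^ 2 * x ^ 2 + y ^ 2) ≤ g) :
    α ^ 2 * x ^ 2 ≤ g ∧ x ^ 2 ≤ g ∧ y ^ 2 ≤ g ∧ |2 * α ^ 2 * (x * y)| ≤ g ∧ |2 * (x * y)| ≤ g ∧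
      α * (α ^ 2 * x ^ 2 + y ^ 2) ≤ g := by
  have h1 : 0 ≤ α * (α ^ 2 * x ^ 2 + y ^ 2) := by positivity
  have hx := sq_nonneg x
  have hy := sq_nonneg y
  have h2 : α ^ 2 * x ^ 2 ≤ x ^ 2 + α * (α ^ 2 * x ^ 2) := by
    rcases le_total α 1 with h | h
    · have : α ^ 2 * x ^ 2 ≤ x ^ 2 := mul_le_of_le_one_left hx (pow_le_one₀ hα h)
      have : 0 ≤ α * (α ^ 2 * x ^ 2) := by positivity
      linarith
    · have : α ^ 2 * x ^ 2 ≤ α * (α ^ 2 * x ^ 2) := le_mul_of_one_le_left (by positivity) h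
      linarith
  have h3 : |2 * α ^ 2 * (x * y)| ≤ α * (α ^ 2 * x ^ 2 + y ^ 2) := by
    have := two_mul_le_add_sq (α * |x|) |y|
    calc |2 * α ^ 2 * (x * y)| = α * (2 * (α * |x|) * |y|) := by
          simp only [abs_mul, Nat.abs_ofNat, abs_pow, abs_of_nonneg hα]; ring
      _ ≤ α * ((α * |x|) ^ 2 + |y| ^ 2) := by gcongr
      _ = _ := by rw [mul_pow, sq_abs, sq_abs]
  have h4 : |2 * (x * y)| ≤ x ^ 2 + y ^ 2 := by
    have := two_mul_le_add_sq |x| |y|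
    rw [sq_abs, sq_abs] at this
    simpa only [abs_mul, Nat.abs_ofNat, mul_assoc] using this
  have h5 : 0 ≤ α * y ^ 2 := by positivity
  refine ⟨by linarith, by linarith, by linarith, by linarith, by linarith, by linarith⟩

/-- The bounds that are needed for the differentiation under the integral sign. -/
theorem Setting.exists_bound (h : Setting μ m φ a f₀ f₁ j C) {σ₀ : ℝ} {τ : ℝ → ℝ}
    (hτ : Admissible σ₀ τ) {T : ℝ} (hT : 0 ≤ T) :
    ∃ (g : M → ℝ) (Γ : ℝ), Integrable g μ ∧ 0 ≤ Γ ∧ ∀ t ∈ Icc 0 T, m (τ t) ≤ Γ ∧ ∀ ξ,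
      (wave m a f₀ f₁ τ t ξ).1 ^ 2 + (wave m a f₀ f₁ τ t ξ).2 ^ 2 +
        a ξ * (a ξ ^ 2 * (wave m a f₀ f₁ τ t ξ).1 ^ 2 + (wave m a f₀ f₁ τ t ξ).2 ^ 2) ≤ g ξ := by
  obtain ⟨K, hK, hL⟩ := hτ.lip T
  obtain ⟨g, Γ, hg, hb⟩ := h.exists_domination σ₀ hK hT
  refine ⟨g 0, Γ, hg 0 le_rfl, (h.m_nonneg _ (hτ.nonneg 0)).trans
    (hb τ hτ hL 0 ⟨le_rfl, hT⟩).1, fun t ht => ⟨(hb τ hτ hL t ht).1, fun ξ => ?_⟩⟩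
  simpa using (hb τ hτ hL t ht).2 ξ 0 le_rfl

theorem Setting.measurable_wave (h : Setting μ m φ a f₀ f₁ j C) {σ₀ : ℝ} {τ : ℝ → ℝ}
    (hτ : Admissible σ₀ τ) {t : ℝ} (ht : 0 ≤ t) : Measurable (wave m a f₀ f₁ τ t) :=
  Kirchhoff.measurable_wave (h.continuous_coeff hτ) h.meas_a h.meas_f₀ h.meas_f₁ ht

section

variable {σ₀ : ℝ} {τ : ℝ → ℝ}

theorem Setting.integrable_potential (h : Setting μ m φ a f₀ f₁ j C) (hτ : Admissible σ₀ τ)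
    {t : ℝ} (ht : 0 ≤ t) :
    Integrable (fun ξ => a ξ ^ 2 * (wave m a f₀ f₁ τ t ξ).1 ^ 2) μ := by
  obtain ⟨g, Γ, hg, -, hb⟩ := h.exists_bound hτ ht
  refine hg.mono' ((h.meas_a.pow_const 2).mul
    ((h.measurable_wave hτ ht).fst.pow_const 2)).aestronglyMeasurable
    (Eventually.of_forall fun ξ => ?_)
  rw [Real.norm_of_nonneg (by positivity)]
  exact (sq_bounds (h.a_nonneg ξ) ((hb t ⟨ht, le_rfl⟩).2 ξ)).1

theorem Setting.integrable_kinetic (h : Setting μ m φ a f₀ f₁ j C) (hτ : Admissible σ₀ τ)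
    {t : ℝ} (ht : 0 ≤ t) : Integrable (fun ξ => (wave m a f₀ f₁ τ t ξ).2 ^ 2) μ := by
  obtain ⟨g, Γ, hg, -, hb⟩ := h.exists_bound hτ ht
  refine hg.mono' ((h.measurable_wave hτ ht).snd.pow_const 2).aestronglyMeasurable
    (Eventually.of_forall fun ξ => ?_)
  rw [Real.norm_of_nonneg (by positivity)]
  exact (sq_bounds (h.a_nonneg ξ) ((hb t ⟨ht, le_rfl⟩).2 ξ)).2.2.1

theorem Setting.integrable_mass (h : Setting μ m φ a f₀ f₁ j C) (hτ : Admissible σ₀ τ)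
    {t : ℝ} (ht : 0 ≤ t) : Integrable (fun ξ => (wave m a f₀ f₁ τ t ξ).1 ^ 2) μ := by
  obtain ⟨g, Γ, hg, -, hb⟩ := h.exists_bound hτ ht
  refine hg.mono' ((h.measurable_wave hτ ht).fst.pow_const 2).aestronglyMeasurable
    (Eventually.of_forall fun ξ => ?_)
  rw [Real.norm_of_nonneg (by positivity)]
  exact (sq_bounds (h.a_nonneg ξ) ((hb t ⟨ht, le_rfl⟩).2 ξ)).2.1

theorem Setting.integrable_potentialDeriv (h : Setting μ m φ a f₀ f₁ j C)
    (hτ : Admissible σ₀ τ) {t : ℝ} (ht : 0 ≤ t) : Integrable (fun ξ =>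
      2 * a ξ ^ 2 * ((wave m a f₀ f₁ τ t ξ).1 * (wave m a f₀ f₁ τ t ξ).2)) μ := by
  obtain ⟨g, Γ, hg, -, hb⟩ := h.exists_bound hτ ht
  refine hg.mono' (((h.meas_a.pow_const 2).const_mul 2).mul
    ((h.measurable_wave hτ ht).fst.mul (h.measurable_wave hτ ht).snd)).aestronglyMeasurable
    (Eventually.of_forall fun ξ => ?_)
  exact (sq_bounds (h.a_nonneg ξ) ((hb t ⟨ht, le_rfl⟩).2 ξ)).2.2.2.1

theorem Setting.hasDerivWithinAt_potential (h : Setting μ m φ a f₀ f₁ j C)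
    (hτ : Admissible σ₀ τ) {t : ℝ} (ht : 0 ≤ t) :
    HasDerivWithinAt (potential μ m a f₀ f₁ τ) (potentialDeriv μ m a f₀ f₁ τ t) (Ici 0) t := by
  obtain ⟨g, Γ, hg, -, hb⟩ := h.exists_bound hτ (show 0 ≤ t + 1 by linarith)
  refine hasDerivWithinAt_integral (T := t + 1)
    (F := fun t ξ => a ξ ^ 2 * (wave m a f₀ f₁ τ t ξ).1 ^ 2)
    (F' := fun t ξ => 2 * a ξ ^ 2 * ((wave m a f₀ f₁ τ t ξ).1 * (wave m a f₀ f₁ τ t ξ).2))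
    (fun s hs => h.integrable_potential hτ hs.1) (fun ξ s _ => ?_)
    (fun ξ s hs => (sq_bounds (h.a_nonneg ξ) ((hb s hs).2 ξ)).2.2.2.1) hg
    ⟨ht, by linarith⟩
  refine ((((solvesAt_wave (h.continuous_coeff hτ) ξ s).fst.pow 2).const_mul
    (a ξ ^ 2)).congr_deriv ?_).hasDerivWithinAt
  push_cast
  ring

theorem Setting.hasDerivWithinAt_kinetic (h : Setting μ m φ a f₀ f₁ j C)
    (hτ : Admissible σ₀ τ) {t : ℝ} (ht : 0 ≤ t) :
    HasDerivWithinAt (kinetic μ m a f₀ f₁ τ) (-(m (τ t)) * potentialDeriv μ m a f₀ f₁ τ t)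
      (Ici 0) t := by
  obtain ⟨g, Γ, hg, hΓ0, hb⟩ := h.exists_bound hτ (show 0 ≤ t + 1 by linarith)
  have := hasDerivWithinAt_integral (T := t + 1) (μ := μ)
    (F := fun t ξ => (wave m a f₀ f₁ τ t ξ).2 ^ 2)
    (F' := fun t ξ => -(m (τ t)) *
      (2 * a ξ ^ 2 * ((wave m a f₀ f₁ τ t ξ).1 * (wave m a f₀ f₁ τ t ξ).2)))
    (fun s hs => h.integrable_kinetic hτ hs.1) (fun ξ s _ => ?_)
    (g := fun ξ => Γ * g ξ) (fun ξ s hs => ?_) (hg.const_mul Γ) ⟨ht, by linarith⟩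
  · rwa [integral_const_mul] at this
  · refine (((solvesAt_wave (h.continuous_coeff hτ) ξ s).snd.pow 2).congr_deriv
      ?_).hasDerivWithinAt
    push_cast
    ring
  · rw [abs_mul, abs_neg, abs_of_nonneg (h.m_nonneg _ (hτ.nonneg s))]
    exact mul_le_mul (hb s hs).1 (sq_bounds (h.a_nonneg ξ) ((hb s hs).2 ξ)).2.2.2.1
      (abs_nonneg _) hΓ0

theorem Setting.hasDerivWithinAt_mass (h : Setting μ m φ a f₀ f₁ j C)
    (hτ : Admissible σ₀ τ) {t : ℝ} (ht : 0 ≤ t) :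
    HasDerivWithinAt (mass μ m a f₀ f₁ τ)
      (∫ ξ, 2 * ((wave m a f₀ f₁ τ t ξ).1 * (wave m a f₀ f₁ τ t ξ).2) ∂μ) (Ici 0) t := by
  obtain ⟨g, Γ, hg, -, hb⟩ := h.exists_bound hτ (show 0 ≤ t + 1 by linarith)
  refine hasDerivWithinAt_integral (T := t + 1)
    (F := fun t ξ => (wave m a f₀ f₁ τ t ξ).1 ^ 2)
    (F' := fun t ξ => 2 * ((wave m a f₀ f₁ τ t ξ).1 * (wave m a f₀ f₁ τ t ξ).2))
    (fun s hs => h.integrable_mass hτ hs.1) (fun ξ s _ => ?_)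
    (fun ξ s hs => (sq_bounds (h.a_nonneg ξ) ((hb s hs).2 ξ)).2.2.2.2.1) hg
    ⟨ht, by linarith⟩
  refine (((solvesAt_wave (h.continuous_coeff hτ) ξ s).fst.pow 2).congr_deriv
    ?_).hasDerivWithinAt
  push_cast
  ring

theorem Setting.mass_deriv_le (h : Setting μ m φ a f₀ f₁ j C)
    (hτ : Admissible σ₀ τ) {t : ℝ} (ht : 0 ≤ t) :
    ∫ ξ, 2 * ((wave m a f₀ f₁ τ t ξ).1 * (wave m a f₀ f₁ τ t ξ).2) ∂μ ≤
      mass μ m a f₀ f₁ τ t + kinetic μ m a f₀ f₁ τ t := by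
  rw [mass, kinetic, ← integral_add (h.integrable_mass hτ ht) (h.integrable_kinetic hτ ht)]
  have hg : Integrable (fun ξ => (wave m a f₀ f₁ τ t ξ).1 ^ 2 + (wave m a f₀ f₁ τ t ξ).2 ^ 2) μ :=
    (h.integrable_mass hτ ht).add (h.integrable_kinetic hτ ht)
  refine (Real.le_norm_self _).trans (norm_integral_le_of_norm_le hg (Eventually.of_forall fun ξ => ?_))
  have := two_mul_le_add_sq |(wave m a f₀ f₁ τ t ξ).1| |(wave m a f₀ f₁ τ t ξ).2|
  rw [sq_abs, sq_abs] at this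
  simpa only [Real.norm_eq_abs, abs_mul, Nat.abs_ofNat, mul_assoc] using this

theorem Setting.continuousOn_potentialDeriv (h : Setting μ m φ a f₀ f₁ j C)
    (hτ : Admissible σ₀ τ) : ContinuousOn (potentialDeriv μ m a f₀ f₁ τ) (Ici 0) := by
  intro t ht
  rw [mem_Ici] at ht
  obtain ⟨g, Γ, hg, -, hb⟩ := h.exists_bound hτ (show 0 ≤ t + 1 by linarith)
  have hev := eventually_mem_Icc (T := t + 1) ⟨ht, by linarith⟩ (Ici 0) subset_rfl
  refine continuousWithinAt_of_dominated (bound := g)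
    (hev.mono fun s hs => (h.integrable_potentialDeriv hτ hs.1).aestronglyMeasurable)
    (hev.mono fun s hs => Eventually.of_forall fun ξ =>
      (sq_bounds (h.a_nonneg ξ) ((hb s hs).2 ξ)).2.2.2.1) hg
    (Eventually.of_forall fun ξ => ?_)
  have h1 := (solvesAt_wave (f₀ := f₀) (f₁ := f₁) (a := a) (h.continuous_coeff hτ) ξ t)
  exact (continuousAt_const.mul (h1.fst.continuousAt.mul
    h1.snd.continuousAt)).continuousWithinAt

theorem Setting.lipTo_potential (h : Setting μ m φ a f₀ f₁ j C) (hτ : Admissible σ₀ τ)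
    {K T : ℝ} (hK : ∀ t ∈ Icc 0 T, |potentialDeriv μ m a f₀ f₁ τ t| ≤ K) :
    LipTo K T (potential μ m a f₀ f₁ τ) := fun _ hs _ ht =>
  (convex_Icc 0 T).norm_image_sub_le_of_norm_hasDerivWithin_le
    (fun _ hr => (h.hasDerivWithinAt_potential hτ hr.1).mono Icc_subset_Ici_self) hK ht hs

theorem Setting.potential_zero (h : Setting μ m φ a f₀ f₁ j C) (hτ : Admissible σ₀ τ) :
    potential μ m a f₀ f₁ τ 0 = ∫ ξ, a ξ ^ 2 * f₀ ξ ^ 2 ∂μ := by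
  simp only [potential, wave_zero (h.continuous_coeff hτ)]

theorem Setting.kinetic_zero (h : Setting μ m φ a f₀ f₁ j C) (hτ : Admissible σ₀ τ) :
    kinetic μ m a f₀ f₁ τ 0 = ∫ ξ, f₁ ξ ^ 2 ∂μ := by
  simp only [kinetic, wave_zero (h.continuous_coeff hτ)]

theorem Setting.mass_zero (h : Setting μ m φ a f₀ f₁ j C) (hτ : Admissible σ₀ τ) :
    mass μ m a f₀ f₁ τ 0 = ∫ ξ, f₀ ξ ^ 2 ∂μ := by
  simp only [mass, wave_zero (h.continuous_coeff hτ)]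

theorem potential_nonneg (τ : ℝ → ℝ) (t : ℝ) : 0 ≤ potential μ m a f₀ f₁ τ t :=
  integral_nonneg fun ξ => by positivity

theorem kinetic_nonneg (τ : ℝ → ℝ) (t : ℝ) : 0 ≤ kinetic μ m a f₀ f₁ τ t :=
  integral_nonneg fun ξ => by positivity

theorem Setting.potential_congr (h : Setting μ m φ a f₀ f₁ j C) {σ₀' : ℝ} {τ' : ℝ → ℝ}
    (hτ : Admissible σ₀ τ) (hτ' : Admissible σ₀' τ') {T : ℝ} (he : EqOn τ τ' (Icc 0 T)) :
    EqOn (potential μ m a f₀ f₁ τ) (potential μ m a f₀ f₁ τ') (Icc 0 T) := fun t ht => by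
  simp only [potential,
    wave_congr (h.continuous_coeff hτ) (h.continuous_coeff hτ') he ht]

theorem abs_max_sub_max_zero_le (s t ε : ℝ) : |max (s - ε) 0 - max (t - ε) 0| ≤ |s - t| := by
  simpa using abs_max_sub_max_le_abs (s - ε) (t - ε) 0

theorem Setting.admissible_delay (h : Setting μ m φ a f₀ f₁ j C) (hτ : Admissible σ₀ τ)
    {ε : ℝ} (hε : 0 ≤ ε) : Admissible (∫ ξ, a ξ ^ 2 * f₀ ξ ^ 2 ∂μ)
      (fun t => potential μ m a f₀ f₁ τ (max (t - ε) 0)) where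
  cont := by
    have : ContinuousOn (potential μ m a f₀ f₁ τ) (Ici 0) := fun t ht =>
      (h.hasDerivWithinAt_potential hτ ht).continuousWithinAt
    exact this.comp_continuous (by fun_prop) fun t => mem_Ici.mpr (le_max_right _ _)
  nonneg t := potential_nonneg _ _
  zero := by rw [zero_sub, max_eq_right (by linarith), h.potential_zero hτ]
  lip T := by
    obtain ⟨B, hB⟩ := (isCompact_Icc (a := (0 : ℝ)) (b := T)).exists_bound_of_continuousOn
      ((h.continuousOn_potentialDeriv hτ).mono Icc_subset_Ici_self)
    refine ⟨max B 1, le_max_right _ _, fun s hs t ht => ?_⟩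
    have hm : ∀ s ∈ Icc 0 T, max (s - ε) 0 ∈ Icc 0 T := fun s hs =>
      ⟨le_max_right _ _, max_le (by linarith [hs.2]) (hs.1.trans hs.2)⟩
    refine (h.lipTo_potential hτ (fun t ht => (hB t ht).trans (le_max_left _ 1)) _ (hm s hs) _
      (hm t ht)).trans ?_
    exact mul_le_mul_of_nonneg_left (abs_max_sub_max_zero_le s t ε)
      (le_max_of_le_right zero_le_one)

/-- The iterates of the map `τ ↦ |A^(1/2) u_τ(· - ε)|²`. -/
noncomputable def delaySeq (μ : Measure M) (m : ℝ → ℝ) (a f₀ f₁ : M → ℝ) (ε : ℝ) : ℕ → ℝ → ℝ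
  | 0 => fun _ => ∫ ξ, a ξ ^ 2 * f₀ ξ ^ 2 ∂μ
  | k + 1 => fun t => potential μ m a f₀ f₁ (delaySeq μ m a f₀ f₁ ε k) (max (t - ε) 0)

theorem Setting.admissible_delaySeq (h : Setting μ m φ a f₀ f₁ j C) {ε : ℝ} (hε : 0 ≤ ε)
    (k : ℕ) : Admissible (∫ ξ, a ξ ^ 2 * f₀ ξ ^ 2 ∂μ) (delaySeq μ m a f₀ f₁ ε k) := by
  induction k with
  | zero =>
    exact ⟨continuous_const, fun _ => integral_nonneg fun ξ => by positivity, rfl,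
      fun T => ⟨1, le_rfl, fun s _ t _ => by simp [delaySeq]⟩⟩
  | succ k ih => exact h.admissible_delay ih hε

/-- By causality the new iterate on `[0, (k + 1) ε]` depends on the old one on `[0, k ε]` only, so
each iteration settles one more interval of length `ε`. -/
theorem Setting.delaySeq_eqOn (h : Setting μ m φ a f₀ f₁ j C) {ε : ℝ} (hε : 0 ≤ ε) (k : ℕ) :
    EqOn (delaySeq μ m a f₀ f₁ ε k) (delaySeq μ m a f₀ f₁ ε (k + 1)) (Icc 0 (k * ε)) := by
  induction k with
  | zero =>
    intro t ht
    obtain rfl : t = 0 := le_antisymm (by simpa using ht.2) ht.1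
    rw [(h.admissible_delaySeq hε 0).zero, (h.admissible_delaySeq hε 1).zero]
  | succ k ih =>
    intro t ht
    refine h.potential_congr (h.admissible_delaySeq hε k) (h.admissible_delaySeq hε (k + 1)) ih
      ⟨le_max_right _ _, max_le ?_ (by positivity)⟩
    have := ht.2
    push_cast at this
    linarith

/-- The approximating problems, in which the coefficient has a delay `ε`, have solutions. -/
theorem Setting.exists_delayed (h : Setting μ m φ a f₀ f₁ j C) {ε : ℝ} (hε : 0 < ε) (T : ℝ) :
    ∃ τ, Admissible (∫ ξ, a ξ ^ 2 * f₀ ξ ^ 2 ∂μ) τ ∧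
      ∀ t ∈ Icc 0 T, τ t = potential μ m a f₀ f₁ τ (max (t - ε) 0) := by
  obtain ⟨k, hk⟩ := exists_nat_ge (T / ε)
  refine ⟨_, h.admissible_delaySeq hε.le k, fun t ht => h.delaySeq_eqOn hε.le k ⟨ht.1, ?_⟩⟩
  exact ht.2.trans ((div_le_iff₀ hε).mp hk)

end

end Functionals

end Kirchhoff

namespace Kirchhoff

/-! ### The a priori bound for the derivative of the potential. -/

section APriori

/-- At the first time when `f` reaches `K` the hypothesis of `hstep` is satisfied, and its
conclusion is violated. -/
theorem le_of_bootstrap {f : ℝ → ℝ} {T K : ℝ} (hf : ContinuousOn f (Icc 0 T)) (h0 : f 0 < K)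
    (hstep : ∀ t ∈ Icc 0 T, (∀ s ∈ Icc 0 t, f s ≤ K) → f t < K) : ∀ t ∈ Icc 0 T, f t < K := by
  by_contra! hc
  obtain ⟨t₁, ht₁, hft₁⟩ := hc
  have hA : IsCompact (Icc 0 T ∩ f ⁻¹' Ici K) :=
    isCompact_Icc.of_isClosed_subset (hf.preimage_isClosed_of_isClosed isClosed_Icc isClosed_Ici)
      inter_subset_left
  obtain ⟨t, ⟨ht, hft⟩, hmin⟩ := hA.exists_isLeast ⟨t₁, ht₁, hft₁⟩
  have hft : K ≤ f t := hft
  have hlt : ∀ s ∈ Ico 0 t, f s ≤ K := by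
    intro s hs
    by_contra! hc
    exact absurd (hmin ⟨⟨hs.1, hs.2.le.trans ht.2⟩, hc.le⟩) (not_le.mpr hs.2)
  have ht0 : 0 < t := lt_of_le_of_ne ht.1 (by rintro rfl; linarith)
  have hle : f t ≤ K := by
    have hne : (𝓝[Ico 0 t] t).NeBot := by
      rw [← mem_closure_iff_nhdsWithin_neBot, closure_Ico ht0.ne]
      exact ⟨ht.1, le_rfl⟩
    exact le_of_tendsto ((hf t ht).tendsto.mono_left (nhdsWithin_mono _
      fun s hs => ⟨hs.1, hs.2.le.trans ht.2⟩)) (eventually_nhdsWithin_of_forall hlt)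
  refine absurd (hstep t ht fun s hs => ?_) (not_lt.mpr hft)
  rcases hs.2.eq_or_lt with rfl | h
  · exact hle
  · exact hlt s ⟨hs.1, h⟩

/-- The cube arises from the prefactor of the growth estimate, of order at most `ρ²`, and the bound
`2 ρ` on the data. The exponent is at most `-ρ` once `ρ ≥ c₂ + 1`. -/
theorem eventually_cubic_mul_exp_le (c₁ c₂ : ℝ) :
    ∀ᶠ ρ : ℝ in atTop, c₁ * ρ ^ 3 * Real.exp (c₂ * ρ - ρ ^ 2) ≤ 1 / 2 := by
  have h := (Real.tendsto_pow_mul_exp_neg_atTop_nhds_zero 3).const_mul |c₁|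
  rw [mul_zero] at h
  filter_upwards [h.eventually (gt_mem_nhds (show (0 : ℝ) < 1 / 2 by norm_num)),
    eventually_ge_atTop (c₂ + 1), eventually_ge_atTop 0] with ρ h1 h2 h3
  calc c₁ * ρ ^ 3 * Real.exp (c₂ * ρ - ρ ^ 2) ≤ |c₁| * ρ ^ 3 * Real.exp (-ρ) := by
        gcongr
        · exact le_abs_self _
        · nlinarith
    _ = |c₁| * (ρ ^ 3 * Real.exp (-ρ)) := by ring
    _ ≤ 1 / 2 := h1.le

variable {M : Type*} [MeasurableSpace M] {μ : Measure M} {m φ : ℝ → ℝ} {a f₀ f₁ : M → ℝ}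
  {j : ℕ} {C : ℝ}

/-- The primitive of the coefficient. -/
noncomputable def coeffPrimitive (m : ℝ → ℝ) (x : ℝ) : ℝ := ∫ y in (0 : ℝ)..x, m (max y 0)

theorem Setting.hasDerivAt_coeffPrimitive (h : Setting μ m φ a f₀ f₁ j C) {x : ℝ} (hx : 0 ≤ x) :
    HasDerivAt (coeffPrimitive m) (m x) x := by
  have hc : Continuous fun y => m (max y 0) :=
    h.m_cont.comp_continuous (by fun_prop) fun y => mem_Ici.mpr (le_max_right _ _)
  have := (hc.integral_hasStrictDerivAt 0 x).hasDerivAt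
  rwa [max_eq_left hx] at this

theorem Setting.mul_le_coeffPrimitive (h : Setting μ m φ a f₀ f₁ j C) {ν : ℝ}
    (hν : ∀ x, 0 ≤ x → ν ≤ m x) {x : ℝ} (hx : 0 ≤ x) : ν * x ≤ coeffPrimitive m x := by
  have hc : Continuous fun y => m (max y 0) :=
    h.m_cont.comp_continuous (by fun_prop) fun y => mem_Ici.mpr (le_max_right _ _)
  have := intervalIntegral.integral_mono_on (μ := volume) (a := 0) (b := x) (f := fun _ => ν)
    (g := fun y => m (max y 0)) hx (by simp) (hc.intervalIntegrable _ _)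
    fun y _ => hν _ (le_max_right _ _)
  unfold coeffPrimitive
  simpa [mul_comm] using this

variable {σ₀ : ℝ} {τ : ℝ → ℝ}

/-- The Hamiltonian is almost conserved if the delay is small. -/
theorem Setting.hamiltonian_le (h : Setting μ m φ a f₀ f₁ j C) (hτ : Admissible σ₀ τ)
    {T K η : ℝ} (hK0 : 0 ≤ K) (hK : ∀ t ∈ Icc 0 T, |potentialDeriv μ m a f₀ f₁ τ t| ≤ K)
    (hη : ∀ t ∈ Icc 0 T, |m (potential μ m a f₀ f₁ τ t) - m (τ t)| ≤ η) :
    ∀ t ∈ Icc 0 T, kinetic μ m a f₀ f₁ τ t + coeffPrimitive m (potential μ m a f₀ f₁ τ t) ≤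
      kinetic μ m a f₀ f₁ τ 0 + coeffPrimitive m (potential μ m a f₀ f₁ τ 0) + K * η * t := by
  intro t ht
  have := le_gronwallBound_of_deriv_le (r := 0) (ε := K * η) (T := T)
    (E := fun t => kinetic μ m a f₀ f₁ τ t + coeffPrimitive m (potential μ m a f₀ f₁ τ t))
    (fun s hs => (h.hasDerivWithinAt_kinetic hτ hs.1).add
      ((h.hasDerivAt_coeffPrimitive (potential_nonneg τ s)).comp_hasDerivWithinAt s
        (h.hasDerivWithinAt_potential hτ hs.1))) (fun s hs => ?_) t ht
  · rwa [gronwallBound_K0] at this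
  -- Only the mismatch between the potential and the argument `τ` of the coefficient makes the
  -- Hamiltonian vary.
  · have e : -(m (τ s)) * potentialDeriv μ m a f₀ f₁ τ s +
        m (potential μ m a f₀ f₁ τ s) * potentialDeriv μ m a f₀ f₁ τ s =
        potentialDeriv μ m a f₀ f₁ τ s * (m (potential μ m a f₀ f₁ τ s) - m (τ s)) := by ring
    rw [e, zero_mul, zero_add]
    refine (le_abs_self _).trans ?_
    rw [abs_mul]
    exact mul_le_mul (hK s hs) (hη s hs) (abs_nonneg _) hK0

/-- The contribution of the low frequencies. -/
theorem Setting.exists_low_bound (h : Setting μ m φ a f₀ f₁ j C) {T B : ℝ} (hB : 0 ≤ B) :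
    ∃ κ, 0 ≤ κ ∧ ∀ σ₀ τ, Admissible σ₀ τ → ∀ t ∈ Icc 0 T,
      (∀ s ∈ Icc 0 t, kinetic μ m a f₀ f₁ τ s +
        coeffPrimitive m (potential μ m a f₀ f₁ τ s) ≤ B) →
      ∀ ρ, 1 ≤ ρ → ∃ g : M → ℝ, Integrable g μ ∧ (∀ ξ, 0 ≤ g ξ) ∧ ∫ ξ, g ξ ∂μ ≤ κ * ρ ^ j ∧
        ∀ ξ, a ξ ≤ ρ →
          |2 * a ξ ^ 2 * ((wave m a f₀ f₁ τ t ξ).1 * (wave m a f₀ f₁ τ t ξ).2)| ≤ g ξ := by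
  have hkin : ∀ {σ₀ τ} {t : ℝ}, Admissible σ₀ τ → kinetic μ m a f₀ f₁ τ t +
      coeffPrimitive m (potential μ m a f₀ f₁ τ t) ≤ B → kinetic μ m a f₀ f₁ τ t ≤ B := by
    intro σ₀ τ t hτ hE
    have := h.mul_le_coeffPrimitive h.m_nonneg
      (potential_nonneg (μ := μ) (m := m) (a := a) (f₀ := f₀) (f₁ := f₁) τ t)
    linarith
  rcases h.strict_or with ⟨rfl, ν, hν0, hν⟩ | rfl
  -- With `m ≥ ν` the Hamiltonian bounds `|A^(1/2) u|²` as well as `|u'|²`. The integrand is at most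
  -- `a (a² w² + w'²)`, which costs one factor `ρ`.
  · refine ⟨B / ν + B, by positivity, fun σ₀ τ hτ t ht hE ρ hρ => ?_⟩
    refine ⟨fun ξ => ρ * (a ξ ^ 2 * (wave m a f₀ f₁ τ t ξ).1 ^ 2 +
      (wave m a f₀ f₁ τ t ξ).2 ^ 2),
      ((h.integrable_potential hτ ht.1).add (h.integrable_kinetic hτ ht.1)).const_mul ρ,
      fun ξ => by positivity, ?_, fun ξ hξ => ?_⟩
    · have hEt := hE t ⟨ht.1, le_rfl⟩
      rw [integral_const_mul, integral_add (h.integrable_potential hτ ht.1)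
        (h.integrable_kinetic hτ ht.1), pow_one, mul_comm]
      have hpot : potential μ m a f₀ f₁ τ t ≤ B / ν := by
        rw [le_div_iff₀ hν0, mul_comm]
        have := h.mul_le_coeffPrimitive hν
          (potential_nonneg (μ := μ) (m := m) (a := a) (f₀ := f₀) (f₁ := f₁) τ t)
        have := kinetic_nonneg (μ := μ) (m := m) (a := a) (f₀ := f₀) (f₁ := f₁) τ t
        linarith
      have := hkin hτ hEt
      unfold potential at hpot
      unfold kinetic at this
      gcongr
    · have ha := h.a_nonneg ξ
      have := two_mul_le_add_sq (a ξ * |(wave m a f₀ f₁ τ t ξ).1|) |(wave m a f₀ f₁ τ t ξ).2|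
      calc _ = a ξ * (2 * (a ξ * |(wave m a f₀ f₁ τ t ξ).1|) * |(wave m a f₀ f₁ τ t ξ).2|) := by
            simp only [abs_mul, Nat.abs_ofNat, abs_pow, abs_of_nonneg ha]; ring
        _ ≤ ρ * ((a ξ * |(wave m a f₀ f₁ τ t ξ).1|) ^ 2 + |(wave m a f₀ f₁ τ t ξ).2| ^ 2) := by
            gcongr
        _ = _ := by rw [mul_pow, sq_abs, sq_abs]
  -- In the degenerate case the Hamiltonian bounds only `|u'|²`. Then `|u|²` is estimated by
  -- Gronwall, and the integrand by `a² (w² + w'²)`, which costs `ρ²`.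
  · set Q := (∫ ξ, f₀ ξ ^ 2 ∂μ + B) * Real.exp T
    have hf : 0 ≤ ∫ ξ, f₀ ξ ^ 2 ∂μ := integral_nonneg fun ξ => by positivity
    refine ⟨Q + B, by positivity, fun σ₀ τ hτ t ht hE ρ hρ => ?_⟩
    refine ⟨fun ξ => ρ ^ 2 * ((wave m a f₀ f₁ τ t ξ).1 ^ 2 +
      (wave m a f₀ f₁ τ t ξ).2 ^ 2),
      ((h.integrable_mass hτ ht.1).add (h.integrable_kinetic hτ ht.1)).const_mul _,
      fun ξ => by positivity, ?_, fun ξ hξ => ?_⟩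
    · have hEt := hE t ⟨ht.1, le_rfl⟩
      rw [integral_const_mul, integral_add (h.integrable_mass hτ ht.1)
        (h.integrable_kinetic hτ ht.1), mul_comm]
      have hmass : mass μ m a f₀ f₁ τ t ≤ Q := by
        have := le_gronwallBound_of_deriv_le (r := 1) (ε := B) (T := t)
          (E := mass μ m a f₀ f₁ τ) (fun s hs => h.hasDerivWithinAt_mass hτ hs.1)
          (fun s hs => by
            have := h.mass_deriv_le hτ hs.1
            have := hkin hτ (hE s hs)
            linarith) t ⟨ht.1, le_rfl⟩
        rw [gronwallBound_of_K_ne_0 one_ne_zero, h.mass_zero hτ] at this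
        simp only [one_mul, div_one] at this
        refine this.trans ?_
        have e : Real.exp t ≤ Real.exp T := Real.exp_le_exp.mpr ht.2
        calc _ ≤ (∫ ξ, f₀ ξ ^ 2 ∂μ + B) * Real.exp t := by linarith
          _ ≤ Q := mul_le_mul_of_nonneg_left e (by positivity)
      have := hkin hτ hEt
      unfold mass at hmass
      unfold kinetic at this
      gcongr
    · have ha := h.a_nonneg ξ
      have := two_mul_le_add_sq |(wave m a f₀ f₁ τ t ξ).1| |(wave m a f₀ f₁ τ t ξ).2|
      calc _ = a ξ ^ 2 * (2 * |(wave m a f₀ f₁ τ t ξ).1| * |(wave m a f₀ f₁ τ t ξ).2|) := by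
            simp only [abs_mul, Nat.abs_ofNat, abs_pow, abs_of_nonneg ha]; ring
        _ ≤ ρ ^ 2 * (|(wave m a f₀ f₁ τ t ξ).1| ^ 2 + |(wave m a f₀ f₁ τ t ξ).2| ^ 2) := by
            gcongr
        _ = _ := by rw [sq_abs, sq_abs]

/-- The condition of Gevrey-Manfrin type on the initial data. -/
def SpectralGap (μ : Measure M) (φ : ℝ → ℝ) (a f₀ f₁ : M → ℝ) : Prop :=
  ∃ᶠ ρ : ℝ in atTop, ∫ ξ in {ξ | ρ < a ξ},
    a ξ * (a ξ ^ 2 * f₀ ξ ^ 2 + f₁ ξ ^ 2) * Real.exp (ρ ^ 2 * φ (a ξ)) ∂μ ≤ 2 * ρ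

/-- The contribution of the high frequencies. -/
theorem Setting.high_bound (h : Setting μ m φ a f₀ f₁ j C) (hτ : Admissible σ₀ τ)
    {q T ρ t : ℝ} (hT : 0 ≤ T) (hq : 1 ≤ q) (hρ : 1 ≤ ρ) (ht : t ∈ Icc 0 T)
    (hL : LipTo (q ^ j) t τ) (hG : C * (1 + T) * q ≤ ρ ^ 2)
    (hgap : ∫ ξ in {ξ | ρ < a ξ},
      a ξ * (a ξ ^ 2 * f₀ ξ ^ 2 + f₁ ξ ^ 2) * Real.exp (ρ ^ 2 * φ (a ξ)) ∂μ ≤ 2 * ρ) :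
    ∃ g : M → ℝ, Integrable g μ ∧ (∀ ξ, 0 ≤ g ξ) ∧
      ∫ ξ, g ξ ∂μ ≤ C * (1 + m σ₀ + q ^ j * (1 + T)) *
        Real.exp (C * (1 + T) * q - ρ ^ 2) * (2 * ρ) ∧
      ∀ ξ, ρ < a ξ →
        |2 * a ξ ^ 2 * ((wave m a f₀ f₁ τ t ξ).1 * (wave m a f₀ f₁ τ t ξ).2)| ≤ g ξ := by
  have hC := h.one_le_C
  have hσ₀ : 0 ≤ σ₀ := hτ.zero ▸ hτ.nonneg 0
  have hm0 := h.m_nonneg σ₀ hσ₀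
  set P := C * (1 + m σ₀ + q ^ j * (1 + T)) with hP
  set G := C * (1 + T) * q with hGdef
  have hP0 : 0 ≤ P := by positivity
  have hmeas : MeasurableSet {ξ | ρ < a ξ} := measurableSet_lt measurable_const h.meas_a
  set e : M → ℝ := fun ξ =>
    a ξ * (a ξ ^ 2 * f₀ ξ ^ 2 + f₁ ξ ^ 2) * Real.exp (ρ ^ 2 * φ (a ξ)) with he
  have hei : Integrable e μ := h.int_exp _ (by positivity)
  have he0 : ∀ ξ, 0 ≤ e ξ := fun ξ => by have := h.a_nonneg ξ; positivity
  refine ⟨fun ξ => P * Real.exp (G - ρ ^ 2) * {ξ | ρ < a ξ}.indicator e ξ,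
    (hei.indicator hmeas).const_mul _, fun ξ => mul_nonneg (by positivity)
      (indicator_nonneg (fun ξ _ => he0 ξ) ξ), ?_, fun ξ hξ => ?_⟩
  · rw [integral_const_mul, integral_indicator hmeas]
    gcongr
  · have ha := h.a_nonneg ξ
    have hφ := h.one_le_φ _ ha
    beta_reduce
    rw [indicator_of_mem (show ξ ∈ {ξ | ρ < a ξ} from hξ)]
    set x := fun s => wave m a f₀ f₁ τ s ξ with hx
    change |2 * a ξ ^ 2 * ((x t).1 * (x t).2)| ≤ _
    have hx0 : x 0 = (f₀ ξ, f₁ ξ) := wave_zero (h.continuous_coeff hτ) ξ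
    -- The growth estimate is applied on `[0, t]`, since inside the continuation argument the
    -- Lipschitz bound is known only up to `t`.
    have hgr := h.growth q t τ hq (fun s _ => hτ.nonneg s) hL
      (a ξ) x (by linarith) (fun s _ => solvesAt_wave (h.continuous_coeff hτ) ξ s) t
      ⟨ht.1, le_rfl⟩
    rw [hτ.zero, hx0] at hgr
    have hgr' : a ξ ^ 2 * (x t).1 ^ 2 + (x t).2 ^ 2 ≤
        P * (a ξ ^ 2 * f₀ ξ ^ 2 + f₁ ξ ^ 2) * Real.exp (G * φ (a ξ)) := by
      refine hgr.trans ?_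
      have ht1 := ht.2
      have ht0 := ht.1
      simp only [hP, hGdef]
      gcongr
    -- This is `(G - ρ²) (φ - 1) ≤ 0`. The gain `exp (G - ρ²)` is uniform in the frequency because
    -- `φ ≥ 1`.
    have hexp : Real.exp (G * φ (a ξ)) ≤ Real.exp (G - ρ ^ 2) * Real.exp (ρ ^ 2 * φ (a ξ)) := by
      rw [← Real.exp_add]
      gcongr
      nlinarith
    have := two_mul_le_add_sq (a ξ * |(x t).1|) |(x t).2|
    calc _ = a ξ * (2 * (a ξ * |(x t).1|) * |(x t).2|) := by
          simp only [abs_mul, Nat.abs_ofNat, abs_pow, abs_of_nonneg ha]; ring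
      _ ≤ a ξ * ((a ξ * |(x t).1|) ^ 2 + |(x t).2| ^ 2) := by
          gcongr
      _ = a ξ * (a ξ ^ 2 * (x t).1 ^ 2 + (x t).2 ^ 2) := by rw [mul_pow, sq_abs, sq_abs]
      _ ≤ a ξ * (P * (a ξ ^ 2 * f₀ ξ ^ 2 + f₁ ξ ^ 2) * Real.exp (G * φ (a ξ))) := by gcongr
      _ ≤ a ξ * (P * (a ξ ^ 2 * f₀ ξ ^ 2 + f₁ ξ ^ 2) *
          (Real.exp (G - ρ ^ 2) * Real.exp (ρ ^ 2 * φ (a ξ)))) := by gcongr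
      _ = _ := by simp only [he]; ring

/-- With `S` the potential, this passes the Lipschitz bound on to the argument `τ` of the
coefficient and makes the defect of the Hamiltonian small. -/
theorem LipTo.delay {K t ε : ℝ} {τ S : ℝ → ℝ} (hS : LipTo K t S) (hK : 0 ≤ K) (hε : 0 ≤ ε)
    (h : ∀ s ∈ Icc 0 t, τ s = S (max (s - ε) 0)) :
    LipTo K t τ ∧ ∀ s ∈ Icc 0 t, |S s - τ s| ≤ K * ε := by
  have hm : ∀ s ∈ Icc 0 t, max (s - ε) 0 ∈ Icc 0 t := fun s hs =>
    ⟨le_max_right _ _, max_le (by linarith [hs.2]) (hs.1.trans hs.2)⟩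
  refine ⟨fun r hr s hs => ?_, fun s hs => ?_⟩
  · rw [h r hr, h s hs]
    exact (hS _ (hm r hr) _ (hm s hs)).trans
      (mul_le_mul_of_nonneg_left (abs_max_sub_max_zero_le r s ε) hK)
  · rw [h s hs]
    refine (hS _ hs _ (hm s hs)).trans (mul_le_mul_of_nonneg_left ?_ hK)
    have h1 : max (s - ε) 0 ≤ s := max_le (by linarith) hs.1
    rw [abs_of_nonneg (by linarith)]
    linarith [le_max_left (s - ε) 0]

/-- The a priori estimate for the solutions of the problems with a small delay. -/
theorem Setting.exists_apriori (h : Setting μ m φ a f₀ f₁ j C)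
    (hgap : SpectralGap μ φ a f₀ f₁) {T : ℝ} (hT : 0 ≤ T) :
    ∃ K, 1 ≤ K ∧ ∃ ε₀, 0 < ε₀ ∧ ∀ ε, 0 < ε → ε ≤ ε₀ → ∀ τ,
      Admissible (∫ ξ, a ξ ^ 2 * f₀ ξ ^ 2 ∂μ) τ →
      (∀ t ∈ Icc 0 T, τ t = potential μ m a f₀ f₁ τ (max (t - ε) 0)) →
      ∀ t ∈ Icc 0 T, |potentialDeriv μ m a f₀ f₁ τ t| ≤ K := by
  set σ₀ := ∫ ξ, a ξ ^ 2 * f₀ ξ ^ 2 ∂μ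
  have hσ₀ : 0 ≤ σ₀ := integral_nonneg fun ξ => by positivity
  have hm0 := h.m_nonneg σ₀ hσ₀
  have hC := h.one_le_C
  -- The summand `1` is the increase of the Hamiltonian on `[0, T]` that the delay may cause; the
  -- tolerance `1 / (K * (T + 1))` below is chosen accordingly.
  set B := ∫ ξ, f₁ ξ ^ 2 ∂μ + coeffPrimitive m σ₀ + 1
  have hB0 : 0 ≤ B := by
    have h1 : 0 ≤ ∫ ξ, f₁ ξ ^ 2 ∂μ := integral_nonneg fun ξ => by positivity
    have h2 := h.mul_le_coeffPrimitive h.m_nonneg hσ₀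
    linarith
  obtain ⟨κ₀, hκ₀, hlow⟩ := h.exists_low_bound (T := T) hB0
  -- The surplus `1` over the low-frequency constant leaves room in `K = (κ * ρ) ^ j` for the high
  -- frequencies, which contribute at most `1 / 2`.
  set κ := κ₀ + 1
  have hκ : 1 ≤ κ := by linarith
  have hj2 : j ≤ 2 := by rcases h.strict_or with ⟨rfl, -⟩ | rfl <;> norm_num
  -- the choice of the frequency that separates the low and the high components
  obtain ⟨ρ, hgapρ, hρ1, hρG, hρexp⟩ : ∃ ρ : ℝ, (∫ ξ in {ξ | ρ < a ξ},
      a ξ * (a ξ ^ 2 * f₀ ξ ^ 2 + f₁ ξ ^ 2) * Real.exp (ρ ^ 2 * φ (a ξ)) ∂μ ≤ 2 * ρ) ∧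
      1 ≤ ρ ∧ C * (1 + T) * (κ * ρ) ≤ ρ ^ 2 ∧
      C * (1 + m σ₀ + (κ * ρ) ^ j * (1 + T)) *
        Real.exp (C * (1 + T) * (κ * ρ) - ρ ^ 2) * (2 * ρ) ≤ 1 / 2 := by
    have hev := (eventually_ge_atTop (1 : ℝ)).and ((eventually_ge_atTop (C * (1 + T) * κ)).and
      (eventually_cubic_mul_exp_le (2 * (C * (1 + m σ₀ + κ ^ 2 * (1 + T)))) (C * (1 + T) * κ)))
    obtain ⟨ρ, h1, h2, h3, h4⟩ := (Frequently.and_eventually hgap hev).exists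
    refine ⟨ρ, h1, h2, by nlinarith, le_trans ?_ h4⟩
    have e1 : (κ * ρ) ^ j ≤ (κ * ρ) ^ 2 :=
      pow_le_pow_right₀ (one_le_mul_of_one_le_of_one_le hκ h2) hj2
    have e2 : 1 ≤ ρ ^ 2 := one_le_pow₀ h2
    have e3 : 1 + m σ₀ + (κ * ρ) ^ j * (1 + T) ≤ (1 + m σ₀ + κ ^ 2 * (1 + T)) * ρ ^ 2 := by
      have : (κ * ρ) ^ j * (1 + T) ≤ (κ * ρ) ^ 2 * (1 + T) := by gcongr
      nlinarith
    calc C * (1 + m σ₀ + (κ * ρ) ^ j * (1 + T)) *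
          Real.exp (C * (1 + T) * (κ * ρ) - ρ ^ 2) * (2 * ρ)
        ≤ C * ((1 + m σ₀ + κ ^ 2 * (1 + T)) * ρ ^ 2) *
          Real.exp (C * (1 + T) * (κ * ρ) - ρ ^ 2) * (2 * ρ) := by gcongr
      _ = _ := by rw [← mul_assoc (C * (1 + T)) κ ρ]; ring
  set q := κ * ρ with hq
  have hq1 : 1 ≤ q := one_le_mul_of_one_le_of_one_le hκ hρ1
  set K := q ^ j with hK
  have hK1 : 1 ≤ K := one_le_pow₀ hq1
  have hKlow : κ₀ * ρ ^ j + 1 / 2 < K := by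
    have e1 : 1 ≤ ρ ^ j := one_le_pow₀ hρ1
    have e2 : κ ≤ κ ^ j := le_self_pow₀ hκ h.j_ne_zero
    have e3 : κ * ρ ^ j ≤ K := by rw [hK, hq, mul_pow]; gcongr
    nlinarith
  -- the choice of the delay
  obtain ⟨ε₀, hε₀, hunif⟩ : ∃ ε₀, 0 < ε₀ ∧ ∀ x ∈ Icc 0 (σ₀ + K * T), ∀ y ∈ Icc 0 (σ₀ + K * T),
      |x - y| ≤ K * ε₀ → |m x - m y| ≤ 1 / (K * (T + 1)) := by
    have hu := (isCompact_Icc (a := (0 : ℝ)) (b := σ₀ + K * T)).uniformContinuousOn_of_continuous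
      (h.m_cont.mono Icc_subset_Ici_self)
    obtain ⟨δ, hδ, hd⟩ := Metric.uniformContinuousOn_iff_le.mp hu (1 / (K * (T + 1)))
      (by positivity)
    refine ⟨δ / K, by positivity, fun x hx y hy hxy => hd x hx y hy ?_⟩
    rwa [mul_div_cancel₀ _ (by positivity)] at hxy
  refine ⟨K, hK1, ε₀, hε₀, fun ε hε hεε₀ τ hτ hdelay t ht => ?_⟩
  -- the improved estimate
  have himp : ∀ t ∈ Icc 0 T, LipTo K t (potential μ m a f₀ f₁ τ) →
      (∀ s ∈ Icc 0 t, kinetic μ m a f₀ f₁ τ s +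
        coeffPrimitive m (potential μ m a f₀ f₁ τ s) ≤ B) →
      |potentialDeriv μ m a f₀ f₁ τ t| < K := by
    intro t ht hL hE
    obtain ⟨g₁, hg₁, hg₁0, hi₁, hb₁⟩ := hlow σ₀ τ hτ t ht hE ρ hρ1
    obtain ⟨g₂, hg₂, hg₂0, hi₂, hb₂⟩ := h.high_bound hτ hT hq1 hρ1 ht
      (hL.delay (by positivity) hε.le fun s hs => hdelay s ⟨hs.1, hs.2.trans ht.2⟩).1 hρG hgapρ
    have := norm_integral_le_of_norm_le (g := fun ξ => g₁ ξ + g₂ ξ)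
      (f := fun ξ => 2 * a ξ ^ 2 * ((wave m a f₀ f₁ τ t ξ).1 * (wave m a f₀ f₁ τ t ξ).2))
      (hg₁.add hg₂) (Eventually.of_forall fun ξ => by
        rw [Real.norm_eq_abs]
        rcases le_or_gt (a ξ) ρ with hξ | hξ
        · linarith [hb₁ ξ hξ, hg₂0 ξ]
        · linarith [hb₂ ξ hξ, hg₁0 ξ])
    rw [integral_add hg₁ hg₂, Real.norm_eq_abs] at this
    unfold potentialDeriv
    linarith
  have hE0 : kinetic μ m a f₀ f₁ τ 0 + coeffPrimitive m (potential μ m a f₀ f₁ τ 0) + 1 = B := by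
    rw [h.kinetic_zero hτ, h.potential_zero hτ]
  -- The strict inequality at time `0` is `himp` on the degenerate interval `[0, 0]`.
  refine (le_of_bootstrap (f := fun t => |potentialDeriv μ m a f₀ f₁ τ t|)
    ((h.continuousOn_potentialDeriv hτ).mono Icc_subset_Ici_self).abs
    (himp 0 ⟨le_rfl, hT⟩ ?_ ?_) (fun t ht hb => ?_) t ht).le
  · intro r hr s hs
    obtain rfl : r = 0 := le_antisymm hr.2 hr.1
    obtain rfl : s = 0 := le_antisymm hs.2 hs.1
    simp
  · intro s hs
    obtain rfl : s = 0 := le_antisymm hs.2 hs.1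
    linarith
  · have hL := h.lipTo_potential hτ hb
    obtain ⟨hLτ, hclose⟩ := hL.delay (by positivity) hε.le
      fun s hs => hdelay s ⟨hs.1, hs.2.trans ht.2⟩
    have hmem : ∀ S : ℝ → ℝ, LipTo K t S → S 0 = σ₀ → (∀ s, 0 ≤ S s) → ∀ s ∈ Icc 0 t,
        S s ∈ Icc 0 (σ₀ + K * T) := by
      intro S hS hS0 hSn s hs
      refine ⟨hSn s, ?_⟩
      have h1 := (le_abs_self _).trans (hS s hs 0 ⟨le_rfl, ht.1⟩)
      rw [hS0, sub_zero, abs_of_nonneg hs.1] at h1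
      have : K * s ≤ K * T := by gcongr; exact hs.2.trans ht.2
      linarith
    refine himp t ht hL fun s hs => ?_
    have hη : ∀ s ∈ Icc 0 t, |m (potential μ m a f₀ f₁ τ s) - m (τ s)| ≤ 1 / (K * (T + 1)) :=
      fun s hs => hunif _ (hmem _ hL (h.potential_zero hτ) (potential_nonneg τ) s hs) _
        (hmem _ hLτ hτ.zero hτ.nonneg s hs) ((hclose s hs).trans (by gcongr))
    have hH := h.hamiltonian_le hτ (by positivity) hb hη s hs
    have e : K * (1 / (K * (T + 1))) * s ≤ 1 := by
      have e1 : K * (1 / (K * (T + 1))) * s = s / (T + 1) := by field_simp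
      rw [e1, div_le_one (by positivity)]
      linarith [hs.2, ht.2]
    linarith

end APriori

end Kirchhoff

namespace Kirchhoff

/-! ### Compactness and removal of the delay. -/

section Compactness

/-- A locally equi-Lipschitz sequence of functions with the same value at the origin has a
locally uniformly convergent subsequence. -/
theorem exists_subseq_tendsto {σ₀ : ℝ} {K : ℕ → ℝ} {f : ℕ → ℝ → ℝ} (h0 : ∀ i, f i 0 = σ₀)
    (hL : ∀ i (n : ℕ) (s t : ℝ), |s| ≤ n → |t| ≤ n → |f i s - f i t| ≤ K n * |s - t|) :
    ∃ (g : ℝ → ℝ) (ψ : ℕ → ℕ), StrictMono ψ ∧ Continuous g ∧ g 0 = σ₀ ∧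
      (∀ (n : ℕ) (s t : ℝ), |s| ≤ n → |t| ≤ n → |g s - g t| ≤ K n * |s - t|) ∧
      ∀ T, TendstoUniformlyOn (fun i => f (ψ i)) g atTop (Icc 0 T) := by
  set F : Set (ℝ → ℝ) := {f | f 0 = σ₀ ∧
    ∀ (n : ℕ) (s t : ℝ), |s| ≤ n → |t| ≤ n → |f s - f t| ≤ K n * |s - t|} with hF
  have hlip : ∀ f ∈ F, ∀ (n : ℕ) (s t : ℝ), |s| ≤ n → |t| ≤ n →
      |f s - f t| ≤ max (K n) 1 * |s - t| := fun f hf n s t hs ht =>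
    (hf.2 n s t hs ht).trans (by gcongr; exact le_max_left _ _)
  have hmod : ∀ x : ℝ, ∀ ε > 0, ∃ δ > 0, ∀ y, dist y x < δ → ∀ f ∈ F, dist (f x) (f y) < ε := by
    intro x ε hε
    obtain ⟨n, hn⟩ := exists_nat_ge (|x| + 1)
    have hK : 0 < max (K n) 1 := lt_max_of_lt_right one_pos
    refine ⟨min 1 (ε / max (K n) 1), lt_min one_pos (by positivity), fun y hy f hf => ?_⟩
    have hy1 : |y - x| < 1 := (Real.dist_eq y x ▸ hy).trans_le (min_le_left _ _)
    have hy2 : |y - x| < ε / max (K n) 1 := (Real.dist_eq y x ▸ hy).trans_le (min_le_right _ _)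
    have hyn : |y| ≤ n := by
      have : |y| ≤ |y - x| + |x| := by simpa using abs_add_le (y - x) x
      linarith
    rw [Real.dist_eq, abs_sub_comm]
    refine (hlip f hf n y x hyn (by linarith)).trans_lt ?_
    rwa [lt_div_iff₀ hK, mul_comm] at hy2
  have hcont : ∀ f ∈ F, Continuous f := fun f hf => by
    rw [Metric.continuous_iff]
    intro x ε hε
    obtain ⟨δ, hδ, h⟩ := hmod x ε hε
    exact ⟨δ, hδ, fun y hy => by rw [dist_comm]; exact h y hy f hf⟩
  have hcl : IsClosed F := by
    have e : F = {f | f 0 = σ₀} ∩ ⋂ (n : ℕ), ⋂ (s : ℝ), ⋂ (t : ℝ), ⋂ (_ : |s| ≤ n),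
        ⋂ (_ : |t| ≤ n), {f : ℝ → ℝ | |f s - f t| ≤ K n * |s - t|} := by
      ext f; simp [hF]
    rw [e]
    refine (isClosed_eq (continuous_apply 0) continuous_const).inter ?_
    refine isClosed_iInter fun n => isClosed_iInter fun s => isClosed_iInter fun t =>
      isClosed_iInter fun _ => isClosed_iInter fun _ => isClosed_le ?_ continuous_const
    exact ((continuous_apply s).sub (continuous_apply t)).abs
  -- Tychonoff's theorem: the Lipschitz bound and the value at `0` confine each `f t` to a fixed
  -- compact interval.
  have hFc : IsCompact F := by
    refine (isCompact_univ_pi fun t : ℝ => isCompact_Icc (a := σ₀ - K ⌈|t|⌉₊ * |t|)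
      (b := σ₀ + K ⌈|t|⌉₊ * |t|)).of_isClosed_subset hcl fun f hf t _ => ?_
    have := hf.2 ⌈|t|⌉₊ t 0 (Nat.le_ceil _) (by simp)
    rw [sub_zero, hf.1, abs_le] at this
    exact ⟨by linarith, by linarith⟩
  set S : Set C(ℝ, ℝ) := {f | (f : ℝ → ℝ) ∈ F}
  have himage : ContinuousMap.toFun '' S = F := by
    ext f
    constructor
    · rintro ⟨g, hg, rfl⟩; exact hg
    · intro hf; exact ⟨⟨f, hcont f hf⟩, hf, rfl⟩
  have hS : IsCompact S := by
    refine ArzelaAscoli.isCompact_of_equicontinuous S (by rw [himage]; exact hFc) fun x => ?_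
    rw [Metric.equicontinuousAt_iff]
    intro ε hε
    obtain ⟨δ, hδ, h⟩ := hmod x ε hε
    exact ⟨δ, hδ, fun y hy f => h y hy _ f.2⟩
  have hfF : ∀ i, f i ∈ F := fun i => ⟨h0 i, hL i⟩
  obtain ⟨g, hg, ψ, hψ, hlim⟩ := hS.tendsto_subseq
    (x := fun i => (⟨f i, hcont _ (hfF i)⟩ : C(ℝ, ℝ))) hfF
  exact ⟨g, ψ, hψ, g.continuous, hg.1, hg.2, fun T =>
    ContinuousMap.tendsto_iff_forall_isCompact_tendstoUniformlyOn.mp hlim _ isCompact_Icc⟩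

variable {M : Type*} [MeasurableSpace M] {μ : Measure M} {m φ : ℝ → ℝ} {a f₀ f₁ : M → ℝ}
  {j : ℕ} {C : ℝ}

theorem LipTo.mem_Icc {K T σ₀ : ℝ} {τ : ℝ → ℝ} (h : LipTo K T τ) (hK : 0 ≤ K)
    (hτ : Admissible σ₀ τ) {t : ℝ} (ht : t ∈ Icc 0 T) : τ t ∈ Icc 0 (σ₀ + K * T) := by
  refine ⟨hτ.nonneg t, ?_⟩
  have h1 := (le_abs_self _).trans (h t ht 0 ⟨le_rfl, ht.1.trans ht.2⟩)
  rw [hτ.zero, sub_zero, abs_of_nonneg ht.1] at h1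
  have : K * t ≤ K * T := by gcongr; exact ht.2
  linarith

/-- Continuous dependence of `|A^(1/2) u|²` on `τ`. -/
theorem Setting.tendsto_potential (h : Setting μ m φ a f₀ f₁ j C) {σ₀ K T : ℝ} {τ : ℝ → ℝ}
    {τs : ℕ → ℝ → ℝ} (hK : 1 ≤ K) (hτ : Admissible σ₀ τ) (hτs : ∀ i, Admissible σ₀ (τs i))
    (hL : LipTo K T τ) (hLs : ∀ᶠ i in atTop, LipTo K T (τs i))
    (hlim : TendstoUniformlyOn τs τ atTop (Icc 0 T)) {t : ℝ} (ht : t ∈ Icc 0 T) :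
    Tendsto (fun i => potential μ m a f₀ f₁ (τs i) t) atTop (𝓝 (potential μ m a f₀ f₁ τ t)) := by
  have hT : 0 ≤ T := ht.1.trans ht.2
  obtain ⟨g, Γ, hg, hb⟩ := h.exists_domination σ₀ hK hT
  have hu := (isCompact_Icc (a := (0 : ℝ)) (b := σ₀ + K * T)).uniformContinuousOn_of_continuous
    (h.m_cont.mono Icc_subset_Ici_self)
  have hlim' : TendstoUniformlyOn (fun i s => m (τs i s)) (fun s => m (τ s)) atTop (Icc 0 T) := by
    rw [Metric.tendstoUniformlyOn_iff] at hlim ⊢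
    intro ε hε
    obtain ⟨δ, hδ, hd⟩ := Metric.uniformContinuousOn_iff.mp hu ε hε
    filter_upwards [hlim δ hδ, hLs] with i hi hLi s hs
    exact hd _ (hL.mem_Icc (by linarith) hτ hs) _ (hLi.mem_Icc (by linarith) (hτs i) hs) (hi s hs)
  refine tendsto_integral_filter_of_dominated_convergence (g 0)
    (Eventually.of_forall fun i => (h.integrable_potential (hτs i) ht.1).aestronglyMeasurable)
    (hLs.mono fun i hi => Eventually.of_forall fun ξ => ?_) (hg 0 le_rfl)
    (Eventually.of_forall fun ξ => ?_)
  · rw [Real.norm_of_nonneg (by positivity)]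
    refine (sq_bounds (y := (wave m a f₀ f₁ (τs i) t ξ).2) (h.a_nonneg ξ) ?_).1
    simpa using (hb (τs i) (hτs i) hi t ht).2 ξ 0 le_rfl
  · have := tendsto_wave (a := a) (f₀ := f₀) (f₁ := f₁) (h.continuous_coeff hτ)
      (fun i => h.continuous_coeff (hτs i)) hlim' ht ξ
    exact (((continuous_fst.tendsto _).comp this).pow 2).const_mul _

/-- The nonlinear problem has a solution. -/
theorem Setting.exists_fixed (h : Setting μ m φ a f₀ f₁ j C) (hgap : SpectralGap μ φ a f₀ f₁) :
    ∃ σ, Admissible (∫ ξ, a ξ ^ 2 * f₀ ξ ^ 2 ∂μ) σ ∧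
      ∀ t, 0 ≤ t → potential μ m a f₀ f₁ σ t = σ t := by
  set σ₀ := ∫ ξ, a ξ ^ 2 * f₀ ξ ^ 2 ∂μ
  choose K' hK' ε' hε' hap using fun n : ℕ => h.exists_apriori hgap (T := n) n.cast_nonneg
  -- The function `f N` below is frozen after the time `N`, so its constant on `[-n, n]` is `K' (min
  -- n N)`. The sum dominates all these values independently of `N`.
  set K : ℕ → ℝ := fun n => ∑ k ∈ Finset.range (n + 1), K' k with hK
  have hKK : ∀ k n, k ≤ n → K' k ≤ K n := fun k n hkn =>
    Finset.single_le_sum (f := K') (fun i _ => zero_le_one.trans (hK' i))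
      (Finset.mem_range.mpr (by omega))
  have hK1 : ∀ n, 1 ≤ K n := fun n => (hK' n).trans (hKK n n le_rfl)
  -- The delay `ε N` is admissible for every horizon `k ≤ N`, so that the Lipschitz constant on `[0,
  -- k]` does not depend on `N`, and it tends to `0`.
  obtain ⟨ε, hε, hεε', hε1⟩ : ∃ ε : ℕ → ℝ, (∀ N, 0 < ε N) ∧ (∀ N k, k ≤ N → ε N ≤ ε' k) ∧
      ∀ N : ℕ, ε N ≤ 1 / ((N : ℝ) + 1) := by
    refine ⟨fun N => min ((Finset.range (N + 1)).inf' (by simp) ε') (1 / ((N : ℝ) + 1)),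
      fun N => lt_min ?_ (by positivity), fun N k hk => (min_le_left _ _).trans
        (Finset.inf'_le _ (Finset.mem_range.mpr (by omega))), fun N => min_le_right _ _⟩
    rw [Finset.lt_inf'_iff]
    exact fun i _ => hε' i
  choose τ hτ hdelay using fun N : ℕ => h.exists_delayed (hε N) N
  have hLip : ∀ N k : ℕ, k ≤ N → LipTo (K' k) k (potential μ m a f₀ f₁ (τ N)) := fun N k hk =>
    h.lipTo_potential (hτ N) (hap k (ε N) (hε N) (hεε' N k hk) (τ N) (hτ N)
      fun t ht => hdelay N t ⟨ht.1, ht.2.trans (by exact_mod_cast hk)⟩)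
  set f : ℕ → ℝ → ℝ := fun N t => potential μ m a f₀ f₁ (τ N) (max (min t N) 0) with hf
  have hf_eq : ∀ (N : ℕ) t, t ∈ Icc 0 (N : ℝ) → f N t = potential μ m a f₀ f₁ (τ N) t := by
    intro N t ht
    simp only [hf, min_eq_left ht.2, max_eq_left ht.1]
  obtain ⟨g, ψ, hψ, hgc, hg0, hgL, hlim⟩ := exists_subseq_tendsto (σ₀ := σ₀) (K := K) (f := f)
    (fun i => by rw [hf_eq i 0 ⟨le_rfl, i.cast_nonneg⟩, h.potential_zero (hτ i)])
    (fun N n s t hs ht => by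
      have hmem : ∀ s : ℝ, |s| ≤ n → max (min s N) 0 ∈ Icc (0 : ℝ) (min n N : ℕ) := by
        intro s hs
        push_cast
        exact ⟨le_max_right _ _, max_le (min_le_min_right _ ((le_abs_self s).trans hs))
          (by positivity)⟩
      refine (hLip N (min n N) (min_le_right _ _) _ (hmem s hs) _ (hmem t ht)).trans ?_
      refine mul_le_mul (hKK _ n (min_le_left _ _)) ?_ (abs_nonneg _)
        (zero_le_one.trans (hK1 n))
      refine (abs_max_sub_max_le_abs _ _ _).trans ?_
      have := abs_min_sub_min_le_max s N t N
      rwa [sub_self, abs_zero, max_eq_left (abs_nonneg (s - t))] at this)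
  have hg_nonneg : ∀ t, 0 ≤ t → 0 ≤ g t := fun t ht =>
    ge_of_tendsto ((hlim t).tendsto_at (show t ∈ Icc 0 t from ⟨ht, le_rfl⟩))
      (Eventually.of_forall fun i => potential_nonneg _ _)
  have hσ : Admissible σ₀ fun t => g (max t 0) :=
    { cont := by fun_prop
      nonneg := fun t => hg_nonneg _ (le_max_right _ _)
      zero := by simpa using hg0
      lip := fun T => by
        refine ⟨K ⌈T⌉₊, hK1 _, fun s hs t ht => ?_⟩
        simp only [max_eq_left hs.1, max_eq_left ht.1]
        exact hgL _ s t (by rw [abs_of_nonneg hs.1]; exact hs.2.trans (Nat.le_ceil T))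
          (by rw [abs_of_nonneg ht.1]; exact ht.2.trans (Nat.le_ceil T)) }
  refine ⟨fun t => g (max t 0), hσ, fun t ht => ?_⟩
  obtain ⟨n, hn⟩ := exists_nat_ge t
  have hψn : ∀ᶠ i in atTop, n ≤ ψ i := hψ.tendsto_atTop.eventually_ge_atTop n
  have hdel : ∀ N, n ≤ N → LipTo (K n) n (τ N) ∧
      ∀ s ∈ Icc 0 (n : ℝ), |potential μ m a f₀ f₁ (τ N) s - τ N s| ≤ K n * ε N := by
    intro N hN
    exact ((hLip N n hN).mono (hKK n n le_rfl) le_rfl).delay (zero_le_one.trans (hK1 n)) (hε N).le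
      fun s hs => hdelay N s ⟨hs.1, hs.2.trans (by exact_mod_cast hN)⟩
  have hLσ : LipTo (K n) n fun t => g (max t 0) := fun s hs t ht => by
    simp only [max_eq_left hs.1, max_eq_left ht.1]
    exact hgL n s t (by rw [abs_of_nonneg hs.1]; exact hs.2) (by rw [abs_of_nonneg ht.1]; exact ht.2)
  -- The arguments `τ N` are `K n * ε N`-close to their potentials, so they share the limit `g`; by
  -- continuous dependence the potentials also converge to the potential of `g`.
  have hτlim : TendstoUniformlyOn (fun i => τ (ψ i)) (fun t => g (max t 0)) atTop
      (Icc 0 (n : ℝ)) := by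
    have h1 := hlim n
    rw [Metric.tendstoUniformlyOn_iff] at h1 ⊢
    intro η hη
    have hε0 : Tendsto (fun i => K n * ε (ψ i)) atTop (𝓝 0) := by
      have : Tendsto ε atTop (𝓝 0) := squeeze_zero (fun N => (hε N).le) hε1
        tendsto_one_div_add_atTop_nhds_zero_nat
      simpa using (this.comp hψ.tendsto_atTop).const_mul (K n)
    filter_upwards [h1 (η / 2) (by positivity), hψn,
      hε0.eventually (gt_mem_nhds (show (0 : ℝ) < η / 2 by positivity))] with i h1 h2 h3 s hs
    have e1 := h1 s hs
    have e2 := (hdel (ψ i) h2).2 s hs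
    rw [hf_eq (ψ i) s ⟨hs.1, hs.2.trans (by exact_mod_cast h2)⟩] at e1
    rw [max_eq_left hs.1]
    refine (dist_triangle _ _ _).trans_lt ((add_lt_add_of_lt_of_le e1 (by
      rw [Real.dist_eq])).trans (by linarith))
  have hpot := h.tendsto_potential (hK1 n) hσ (fun i => hτ (ψ i)) hLσ
    (hψn.mono fun i hi => (hdel (ψ i) hi).1) hτlim ⟨ht, hn⟩
  have hpot' : Tendsto (fun i => potential μ m a f₀ f₁ (τ (ψ i)) t) atTop (𝓝 (g (max t 0))) := by
    rw [max_eq_left ht]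
    refine ((hlim n).tendsto_at ⟨ht, hn⟩).congr' (hψn.mono fun i hi => ?_)
    exact hf_eq (ψ i) t ⟨ht, hn.trans (by exact_mod_cast hi)⟩
  exact tendsto_nhds_unique hpot hpot'

end Compactness

end Kirchhoff

namespace Kirchhoff

/-! ### From pointwise bounds to the generalized Gevrey spaces. -/

section Spaces

variable {H : Type*} [NormedAddCommGroup H] [InnerProductSpace ℝ H]
  {A : H →ₗ.[ℝ] H} {M : Type*} [MeasurableSpace M] {μ : Measure M}

theorem rpow_four_mul_three_quarters (x : ℝ) : x ^ (4 * (3 / 4) : ℝ) = x ^ 3 := by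
  rw [show (4 * (3 / 4) : ℝ) = ((3 : ℕ) : ℝ) by norm_num, Real.rpow_natCast]

theorem rpow_four_mul_quarter (x : ℝ) : x ^ (4 * (1 / 4) : ℝ) = x := by
  rw [show (4 * (1 / 4) : ℝ) = 1 by norm_num, Real.rpow_one]

theorem rpow_four_mul_half (x : ℝ) : x ^ (4 * (1 / 2) : ℝ) = x ^ 2 := by
  rw [show (4 * (1 / 2) : ℝ) = ((2 : ℕ) : ℝ) by norm_num, Real.rpow_natCast]

/-- The weight of the norm of the generalized Gevrey space. -/
noncomputable def gevreyWeight (R : SpectralRep A μ) (φ : ℝ → ℝ) (r α : ℝ) (ξ : M) : ℝ :=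
  1 + R.a ξ ^ (4 * α) * Real.exp (r * φ (R.a ξ))

variable {R : SpectralRep A μ} {φ : ℝ → ℝ} {r α : ℝ}

theorem one_le_gevreyWeight (ξ : M) : 1 ≤ gevreyWeight R φ r α ξ := by
  have := Real.rpow_nonneg (R.a_nonneg ξ) (4 * α)
  have : 0 ≤ R.a ξ ^ (4 * α) * Real.exp (r * φ (R.a ξ)) := by positivity
  unfold gevreyWeight
  linarith

theorem aemeasurable_gevreyWeight (hφ : AEMeasurable (fun ξ => φ (R.a ξ)) μ) :
    AEMeasurable (gevreyWeight R φ r α) μ :=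
  ((R.measurable_a.pow_const (4 * α)).aemeasurable.mul
    (hφ.const_mul r).exp).const_add 1

theorem norm_sq_eq_integral {v : H} {F : M → ℝ} (hv : R.U v =ᵐ[μ] F) :
    ‖v‖ ^ 2 = ∫ ξ, F ξ ^ 2 ∂μ := by
  rw [← R.U.norm_map v, ← real_inner_self_eq_norm_sq, L2.inner_def]
  refine integral_congr_ae ?_
  filter_upwards [hv] with ξ hξ
  rw [hξ]
  simp [sq]

theorem gevreyNormSq_eq {v : H} {F g : M → ℝ} (hφ : AEMeasurable (fun ξ => φ (R.a ξ)) μ)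
    (hv : R.U v =ᵐ[μ] F) (hF : Measurable F) (hg : Integrable g μ)
    (hb : ∀ ξ, gevreyWeight R φ r α ξ * F ξ ^ 2 ≤ g ξ) :
    gevreyNormSq R φ r α v = ENNReal.ofReal (∫ ξ, gevreyWeight R φ r α ξ * F ξ ^ 2 ∂μ) := by
  have h0 : ∀ ξ, 0 ≤ R.a ξ ^ (4 * α) * F ξ ^ 2 * Real.exp (r * φ (R.a ξ)) := fun ξ => by
    have := Real.rpow_nonneg (R.a_nonneg ξ) (4 * α)
    positivity
  have he : ∀ ξ, gevreyWeight R φ r α ξ * F ξ ^ 2 =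
      F ξ ^ 2 + R.a ξ ^ (4 * α) * F ξ ^ 2 * Real.exp (r * φ (R.a ξ)) := fun ξ => by
    unfold gevreyWeight; ring
  have i1 : Integrable (fun ξ => F ξ ^ 2) μ := by
    refine hg.mono' (hF.pow_const 2).aestronglyMeasurable (Eventually.of_forall fun ξ => ?_)
    rw [Real.norm_of_nonneg (sq_nonneg _)]
    linarith [hb ξ, he ξ, h0 ξ]
  have i2 : Integrable (fun ξ => R.a ξ ^ (4 * α) * F ξ ^ 2 * Real.exp (r * φ (R.a ξ))) μ := by
    refine hg.mono' (((R.measurable_a.pow_const (4 * α)).mul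
      (hF.pow_const 2)).aemeasurable.mul (hφ.const_mul r).exp).aestronglyMeasurable
      (Eventually.of_forall fun ξ => ?_)
    rw [Real.norm_of_nonneg (h0 ξ)]
    linarith [hb ξ, he ξ, sq_nonneg (F ξ)]
  simp only [he]
  rw [integral_add i1 i2, ENNReal.ofReal_add (integral_nonneg fun ξ => sq_nonneg _)
    (integral_nonneg h0), gevreyNormSq, norm_sq_eq_integral hv, gevreySeminormSq,
    ofReal_integral_eq_lintegral_ofReal i2 (Eventually.of_forall h0)]
  congr 1
  refine lintegral_congr_ae ?_
  filter_upwards [hv] with ξ hξ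
  rw [hξ]

/-- Dominated convergence: continuity and differentiability in the Gevrey norms reduce to those of
each component, together with one integrable bound for the weighted squares. -/
theorem tendsto_gevreyNormSq {l : Filter ℝ} [l.IsCountablyGenerated] {v : ℝ → H}
    {F : ℝ → M → ℝ} {g : M → ℝ} (hφ : AEMeasurable (fun ξ => φ (R.a ξ)) μ) (hg : Integrable g μ)
    (hv : ∀ᶠ s in l, R.U (v s) =ᵐ[μ] F s ∧ Measurable (F s) ∧
      ∀ ξ, gevreyWeight R φ r α ξ * F s ξ ^ 2 ≤ g ξ)
    (hlim : ∀ ξ, Tendsto (fun s => F s ξ) l (𝓝 0)) :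
    Tendsto (fun s => gevreyNormSq R φ r α (v s)) l (𝓝 0) := by
  have h : Tendsto (fun s => ∫ ξ, gevreyWeight R φ r α ξ * F s ξ ^ 2 ∂μ) l
      (𝓝 (∫ _, (0 : ℝ) ∂μ)) := by
    refine tendsto_integral_filter_of_dominated_convergence g (hv.mono fun s hs => ?_)
      (hv.mono fun s hs => Eventually.of_forall fun ξ => ?_) hg (Eventually.of_forall fun ξ => ?_)
    · exact ((aemeasurable_gevreyWeight hφ).mul
        (hs.2.1.pow_const 2).aemeasurable).aestronglyMeasurable
    · have := one_le_gevreyWeight (R := R) (φ := φ) (r := r) (α := α) ξ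
      rw [Real.norm_of_nonneg (by positivity)]
      exact hs.2.2 ξ
    · simpa using ((hlim ξ).pow 2).const_mul (gevreyWeight R φ r α ξ)
  rw [integral_zero] at h
  have h' := ENNReal.tendsto_ofReal h
  rw [ENNReal.ofReal_zero] at h'
  exact h'.congr' (hv.mono fun s hs => (gevreyNormSq_eq hφ hs.1 hs.2.1 hg hs.2.2).symm)

theorem mul_sub_sq_le {W x y G : ℝ} (hW : 0 ≤ W) (hx : W * x ^ 2 ≤ G) (hy : W * y ^ 2 ≤ G) :
    W * (x - y) ^ 2 ≤ 4 * G := by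
  have h : (x - y) ^ 2 ≤ 2 * x ^ 2 + 2 * y ^ 2 := by nlinarith [sq_nonneg (x + y)]
  nlinarith [mul_le_mul_of_nonneg_left h hW]

theorem continuousInto_of_pointwise {v : ℝ → H} {y : ℝ → M → ℝ}
    (hφ : AEMeasurable (fun ξ => φ (R.a ξ)) μ) (hv : ∀ t, 0 ≤ t → R.U (v t) =ᵐ[μ] y t)
    (hy : ∀ t, 0 ≤ t → Measurable (y t)) (hc : ∀ t, 0 ≤ t → ∀ ξ, ContinuousAt (fun s => y s ξ) t)
    (hb : ∀ T, 0 ≤ T → ∃ g, Integrable g μ ∧ ∀ t ∈ Icc 0 T, ∀ ξ,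
      gevreyWeight R φ r α ξ * y t ξ ^ 2 ≤ g ξ) : ContinuousInto R φ r α v := by
  refine ⟨fun t ht => ?_, fun t ht => ?_⟩
  · obtain ⟨g, hg, hb⟩ := hb t ht
    have := gevreyNormSq_eq hφ (hv t ht) (hy t ht) hg (hb t ⟨ht, le_rfl⟩)
    refine lt_of_le_of_lt ?_ (this ▸ ENNReal.ofReal_lt_top)
    exact le_add_self
  · obtain ⟨g, hg, hb⟩ := hb (t + 1) (by linarith)
    have hev := eventually_mem_Icc (T := t + 1) ⟨ht, by linarith⟩ (Ici 0) subset_rfl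
    refine tendsto_gevreyNormSq (F := fun s ξ => y s ξ - y t ξ) (g := fun ξ => 4 * g ξ) hφ
      (hg.const_mul 4) (hev.mono fun s hs => ⟨?_, (hy s hs.1).sub (hy t ht), fun ξ => ?_⟩)
      fun ξ => ?_
    · rw [map_sub]
      filter_upwards [Lp.coeFn_sub (R.U (v s)) (R.U (v t)), hv s hs.1, hv t ht] with ξ h1 h2 h3
      rw [h1, Pi.sub_apply, h2, h3]
    · exact mul_sub_sq_le (zero_le_one.trans (one_le_gevreyWeight ξ)) (hb s hs ξ)
        (hb t ⟨ht, by linarith⟩ ξ)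
    · have := ((hc t ht ξ).tendsto.sub_const (y t ξ)).mono_left
        (nhdsWithin_le_nhds (s := Ici 0))
      simpa using this

theorem tendsto_slope_of_pointwise {v v' : ℝ → H} {y y' : ℝ → M → ℝ}
    (hφ : AEMeasurable (fun ξ => φ (R.a ξ)) μ) (hv : ∀ t, 0 ≤ t → R.U (v t) =ᵐ[μ] y t)
    (hv' : ∀ t, 0 ≤ t → R.U (v' t) =ᵐ[μ] y' t)
    (hy : ∀ t, 0 ≤ t → Measurable (y t)) (hy' : ∀ t, 0 ≤ t → Measurable (y' t))
    (hd : ∀ t, 0 ≤ t → ∀ ξ, HasDerivAt (fun s => y s ξ) (y' t ξ) t)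
    (hb : ∀ T, 0 ≤ T → ∃ g, Integrable g μ ∧ ∀ t ∈ Icc 0 T, ∀ ξ,
      gevreyWeight R φ r α ξ * y' t ξ ^ 2 ≤ g ξ) {t : ℝ} (ht : 0 ≤ t) :
    Tendsto (fun s => gevreyNormSq R φ r α ((s - t)⁻¹ • (v s - v t) - v' t))
      (𝓝[Ici 0 \ {t}] t) (𝓝 0) := by
  obtain ⟨g, hg, hb⟩ := hb (t + 1) (by linarith)
  have htI : t ∈ Icc 0 (t + 1) := ⟨ht, by linarith⟩
  have hev := eventually_mem_Icc (T := t + 1) ⟨ht, by linarith⟩ (Ici 0 \ {t}) sdiff_subset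
  refine tendsto_gevreyNormSq (F := fun s ξ => (s - t)⁻¹ * (y s ξ - y t ξ) - y' t ξ)
    (g := fun ξ => 4 * g ξ) hφ (hg.const_mul 4)
    (hev.mono fun s hs => ⟨?_, (((hy s hs.1).sub (hy t ht)).const_mul _).sub (hy' t ht),
      fun ξ => ?_⟩) fun ξ => ?_
  · rw [map_sub, map_smul, map_sub]
    filter_upwards [Lp.coeFn_sub ((s - t)⁻¹ • (R.U (v s) - R.U (v t))) (R.U (v' t)),
      Lp.coeFn_smul (s - t)⁻¹ (R.U (v s) - R.U (v t)),
      Lp.coeFn_sub (R.U (v s)) (R.U (v t)), hv s hs.1, hv t ht, hv' t ht] with ξ h1 h2 h3 h4 h5 h6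
    rw [h1, Pi.sub_apply, h2, Pi.smul_apply, h3, Pi.sub_apply, h4, h5, h6, smul_eq_mul]
  · have hW := one_le_gevreyWeight (R := R) (φ := φ) (r := r) (α := α) ξ
    have hW0 : 0 < gevreyWeight R φ r α ξ := zero_lt_one.trans_le hW
    have hg0 : 0 ≤ g ξ := (by positivity : (0 : ℝ) ≤ gevreyWeight R φ r α ξ * y' t ξ ^ 2).trans
      (hb t htI ξ)
    refine mul_sub_sq_le hW0.le ?_ (hb t htI ξ)
    -- For fixed `ξ` the mean value inequality transfers the bound `√(g / W)`, with `W` the Gevrey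
    -- weight, from `y'` to the difference quotients of `y`.
    have := abs_slope_le (F := fun s => y s ξ) (F' := fun s => y' s ξ) (T := t + 1)
      (G := √(g ξ / gevreyWeight R φ r α ξ)) (fun s hs => (hd s hs.1 ξ).hasDerivWithinAt)
      (fun s hs => Real.abs_le_sqrt (by rw [le_div_iff₀' hW0]; exact hb s hs ξ)) hs htI
    have h2 := pow_le_pow_left₀ (abs_nonneg _) this 2
    rw [sq_abs, Real.sq_sqrt (by positivity), le_div_iff₀' hW0] at h2
    exact h2
  · have := (tendsto_slope_of_hasDerivWithinAt (F := fun s => y s ξ) (F' := fun s => y' s ξ)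
      (T := t + 1) ⟨ht, by linarith⟩ (hd t ht ξ).hasDerivWithinAt).sub_const (y' t ξ)
    simpa using this

theorem hasDerivWithinAt_of_tendsto_gevreyNormSq {v : ℝ → H} {v' : H} {t : ℝ}
    (h : Tendsto (fun s => gevreyNormSq R φ r α ((s - t)⁻¹ • (v s - v t) - v'))
      (𝓝[Ici 0 \ {t}] t) (𝓝 0)) : HasDerivWithinAt v v' (Ici 0) t := by
  rw [hasDerivWithinAt_iff_tendsto_slope, tendsto_iff_norm_sub_tendsto_zero]
  have h1 : Tendsto (fun s => ENNReal.ofReal (‖slope v t s - v'‖ ^ 2))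
      (𝓝[Ici 0 \ {t}] t) (𝓝 0) :=
    tendsto_of_tendsto_of_tendsto_of_le_of_le tendsto_const_nhds h (fun _ => zero_le)
      fun _ => le_self_add
  have h2 := (ENNReal.tendsto_toReal ENNReal.zero_ne_top).comp h1
  have h3 : Tendsto (fun s => ‖slope v t s - v'‖ ^ 2) (𝓝[Ici 0 \ {t}] t) (𝓝 0) := by
    refine h2.congr fun s => ?_
    simp
  have h4 := h3.sqrt
  simpa using h4

theorem integrable_of_gevreySeminormSq_lt_top {u : H}
    (hφ : AEMeasurable (fun ξ => φ (R.a ξ)) μ) (hu : u ∈ gevreySpace R φ r α) :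
    Integrable (fun ξ => R.a ξ ^ (4 * α) * R.U u ξ ^ 2 * Real.exp (r * φ (R.a ξ))) μ := by
  refine (lintegral_ofReal_ne_top_iff_integrable ?_ (Eventually.of_forall fun ξ => ?_)).mp
    (ne_of_lt hu)
  · exact (((R.measurable_a.pow_const (4 * α)).mul
      ((Lp.stronglyMeasurable (R.U u)).measurable.pow_const 2)).aemeasurable.mul
      (hφ.const_mul r).exp).aestronglyMeasurable
  · have := Real.rpow_nonneg (R.a_nonneg ξ) (4 * α)
    simp only [Pi.zero_apply]
    positivity

theorem setIntegral_le_of_mem_gevreyManfrinSpace {u : H} {β : ℝ} {ρ : ℕ → ℝ}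
    (hφ : AEMeasurable (fun ξ => φ (R.a ξ)) μ) (hφ1 : ∀ x, 0 ≤ x → 1 ≤ φ x)
    (hmem : ∀ r, 0 < r → u ∈ gevreySpace R φ r α)
    (hu : u ∈ gevreyManfrinSpace R β φ ρ α) (hβ : 2 ≤ β) {n : ℕ} (hn : 1 ≤ ρ n) :
    ∫ ξ in {ξ | ρ n < R.a ξ},
      R.a ξ ^ (4 * α) * R.U u ξ ^ 2 * Real.exp (ρ n ^ 2 * φ (R.a ξ)) ∂μ ≤ ρ n := by
  have h0 : ∀ (s : ℝ) ξ, 0 ≤ R.a ξ ^ (4 * α) * R.U u ξ ^ 2 * Real.exp (s * φ (R.a ξ)) := by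
    intro s ξ
    have := Real.rpow_nonneg (R.a_nonneg ξ) (4 * α)
    positivity
  rw [integral_eq_lintegral_of_nonneg_ae (Eventually.of_forall (h0 _))
    (integrable_of_gevreySeminormSq_lt_top hφ
      (hmem _ (by positivity))).integrableOn.aestronglyMeasurable]
  refine ENNReal.toReal_le_of_le_ofReal (by linarith) (le_trans (lintegral_mono fun ξ => ?_) (hu n))
  refine ENNReal.ofReal_le_ofReal ?_
  have h1 := Real.rpow_nonneg (R.a_nonneg ξ) (4 * α)
  have h2 := hφ1 _ (R.a_nonneg ξ)
  have h3 : ρ n ^ 2 ≤ ρ n ^ β := by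
    rw [← Real.rpow_natCast]
    exact Real.rpow_le_rpow_of_exponent_le hn (by exact_mod_cast hβ)
  gcongr

/-- The hypotheses on the data, transformed by the unitary operator. -/
theorem setting_of_gevrey {m : ℝ → ℝ} {j : ℕ} {C : ℝ} (hm_cont : ContinuousOn m (Ici 0))
    (hm_nonneg : ∀ x, 0 ≤ x → 0 ≤ m x) (hφ1 : ∀ x, 0 ≤ x → 1 ≤ φ x) (hC : 1 ≤ C)
    (hj : (j = 1 ∧ ∃ ν, 0 < ν ∧ ∀ x, 0 ≤ x → ν ≤ m x) ∨ j = 2) (hgrowth : HasGrowth m φ j C)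
    (hφ : AEMeasurable (fun ξ => φ (R.a ξ)) μ) {u₀ u₁ : H}
    (hu₀ : ∀ r : ℝ, 0 < r → u₀ ∈ gevreySpace R φ r (3 / 4))
    (hu₁ : ∀ r : ℝ, 0 < r → u₁ ∈ gevreySpace R φ r (1 / 4)) :
    Setting μ m φ R.a (R.U u₀) (R.U u₁) j C where
  m_cont := hm_cont
  m_nonneg := hm_nonneg
  one_le_φ := hφ1
  one_le_C := hC
  strict_or := hj
  growth := hgrowth
  meas_a := R.measurable_a
  a_nonneg := R.a_nonneg
  meas_φ := hφ
  meas_f₀ := (Lp.stronglyMeasurable _).measurable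
  meas_f₁ := (Lp.stronglyMeasurable _).measurable
  int_sq := (Lp.memLp (R.U u₀)).integrable_sq.add (Lp.memLp (R.U u₁)).integrable_sq
  int_exp r hr := by
    have h0 := integrable_of_gevreySeminormSq_lt_top hφ (hu₀ r hr)
    have h1 := integrable_of_gevreySeminormSq_lt_top hφ (hu₁ r hr)
    simp only [rpow_four_mul_three_quarters, rpow_four_mul_quarter] at h0 h1
    refine (h0.add h1).congr (Eventually.of_forall fun ξ => ?_)
    simp only [Pi.add_apply]
    ring

/-- Adding the conditions on `u₀` and `u₁` produces `2 ρ`. As `ρ n ≥ 1` eventually, the weight with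
`ρ n ^ β` dominates the one with `ρ n ^ 2`. -/
theorem spectralGap_of_gevreyManfrin {β : ℝ} {ρ : ℕ → ℝ} (hφ1 : ∀ x, 0 ≤ x → 1 ≤ φ x)
    (hφ : AEMeasurable (fun ξ => φ (R.a ξ)) μ) (hβ : 2 ≤ β) (hρ : Tendsto ρ atTop atTop)
    {u₀ u₁ : H} (hu₀ : u₀ ∈ gevreyManfrinSpace R β φ ρ (3 / 4))
    (hu₁ : u₁ ∈ gevreyManfrinSpace R β φ ρ (1 / 4))
    (hu₀_mem : ∀ r : ℝ, 0 < r → u₀ ∈ gevreySpace R φ r (3 / 4))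
    (hu₁_mem : ∀ r : ℝ, 0 < r → u₁ ∈ gevreySpace R φ r (1 / 4)) :
    SpectralGap μ φ R.a (R.U u₀) (R.U u₁) := by
  refine hρ.frequently (Eventually.frequently ?_)
  filter_upwards [hρ.eventually_ge_atTop 1] with n hn
  have h0 := setIntegral_le_of_mem_gevreyManfrinSpace hφ hφ1 hu₀_mem hu₀ hβ hn
  have h1 := setIntegral_le_of_mem_gevreyManfrinSpace hφ hφ1 hu₁_mem hu₁ hβ hn
  have i0 := integrable_of_gevreySeminormSq_lt_top hφ (hu₀_mem (ρ n ^ 2) (by positivity))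
  have i1 := integrable_of_gevreySeminormSq_lt_top hφ (hu₁_mem (ρ n ^ 2) (by positivity))
  simp only [rpow_four_mul_three_quarters, rpow_four_mul_quarter] at h0 h1 i0 i1
  rw [two_mul]
  refine le_trans (le_of_eq ?_) (add_le_add h0 h1)
  rw [← integral_add i0.integrableOn i1.integrableOn]
  refine integral_congr_ae (Eventually.of_forall fun ξ => ?_)
  ring

end Spaces

/-! ### The solution in the original space and the theorem. -/

section Solution

variable {H : Type*} [NormedAddCommGroup H] [InnerProductSpace ℝ H]
  {A : H →ₗ.[ℝ] H} {M : Type*} [MeasurableSpace M] {μ : Measure M} {R : SpectralRep A μ}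
  {m φ : ℝ → ℝ} {u₀ u₁ : H} {j : ℕ} {C : ℝ}

/-- The inverse unitary operator carries the components to `u` and `u'`. By `hfix` the linear
coefficient `m (σ t)` is `m (|A^(1/2) u(t)|²)`. -/
theorem exists_globalSolution_of_fixed
    (h : Setting μ m φ R.a (R.U u₀) (R.U u₁) j C) {σ₀ : ℝ} {σ : ℝ → ℝ} (hσ : Admissible σ₀ σ)
    (hfix : ∀ t, 0 ≤ t → potential μ m R.a (R.U u₀) (R.U u₁) σ t = σ t) :
    ∃ u u' : ℝ → H, IsGlobalSolution R m u₀ u₁ u u' ∧ ∀ r : ℝ, 0 < r →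
      ContDiffInto R φ r (1 / 4) u u' ∧ ContinuousInto R φ r (3 / 4) u := by
  set w := wave m R.a (R.U u₀) (R.U u₁) σ with hw
  have hc := h.continuous_coeff hσ
  have hmeas : ∀ t, 0 ≤ t → Measurable (w t) := fun t ht => h.measurable_wave hσ ht
  have hsol : ∀ ξ t, SolvesAt (fun s => m (σ s) * R.a ξ ^ 2) (fun s => w s ξ) t :=
    solvesAt_wave hc
  have hmem : ∀ t, 0 ≤ t → MemLp (fun ξ => (w t ξ).1) 2 μ := fun t ht =>
    (memLp_two_iff_integrable_sq (hmeas t ht).fst.aestronglyMeasurable).mpr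
      (h.integrable_mass hσ ht)
  have hmem' : ∀ t, 0 ≤ t → MemLp (fun ξ => (w t ξ).2) 2 μ := fun t ht =>
    (memLp_two_iff_integrable_sq (hmeas t ht).snd.aestronglyMeasurable).mpr
      (h.integrable_kinetic hσ ht)
  have hex : ∀ t, ∃ v : H, 0 ≤ t → R.U v =ᵐ[μ] fun ξ => (w t ξ).1 := by
    intro t
    by_cases ht : 0 ≤ t
    · exact ⟨R.U.symm (hmem t ht).toLp, fun _ => by
        rw [LinearIsometryEquiv.apply_symm_apply]; exact (hmem t ht).coeFn_toLp⟩
    · exact ⟨0, fun h => absurd h ht⟩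
  have hex' : ∀ t, ∃ v : H, 0 ≤ t → R.U v =ᵐ[μ] fun ξ => (w t ξ).2 := by
    intro t
    by_cases ht : 0 ≤ t
    · exact ⟨R.U.symm (hmem' t ht).toLp, fun _ => by
        rw [LinearIsometryEquiv.apply_symm_apply]; exact (hmem' t ht).coeFn_toLp⟩
    · exact ⟨0, fun h => absurd h ht⟩
  choose u hu using hex
  choose u' hu' using hex'
  -- the bounds of the weighted norms
  have hdom : ∀ T, 0 ≤ T → ∃ g : ℝ → M → ℝ, (∀ r, 0 ≤ r → Integrable (g r) μ) ∧
      ∀ t ∈ Icc 0 T, ∀ ξ, ∀ r, 0 ≤ r → (w t ξ).1 ^ 2 + (w t ξ).2 ^ 2 +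
        R.a ξ * (R.a ξ ^ 2 * (w t ξ).1 ^ 2 + (w t ξ).2 ^ 2) * Real.exp (r * φ (R.a ξ)) ≤
          g r ξ := by
    intro T hT
    obtain ⟨K, hK, hL⟩ := hσ.lip T
    obtain ⟨g, Γ, hg, hb⟩ := h.exists_domination σ₀ hK hT
    exact ⟨g, hg, fun t ht => (hb σ hσ hL t ht).2⟩
  have hb₁ : ∀ r, 0 < r → ∀ T, 0 ≤ T → ∃ g, Integrable g μ ∧ ∀ t ∈ Icc 0 T, ∀ ξ,
      gevreyWeight R φ r (3 / 4) ξ * (w t ξ).1 ^ 2 ≤ g ξ := by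
    intro r hr T hT
    obtain ⟨g, hg, hb⟩ := hdom T hT
    refine ⟨g r, hg r hr.le, fun t ht ξ => le_trans ?_ (hb t ht ξ r hr.le)⟩
    have ha := R.a_nonneg ξ
    have h1 : 0 ≤ R.a ξ * (w t ξ).2 ^ 2 * Real.exp (r * φ (R.a ξ)) := by positivity
    rw [gevreyWeight, rpow_four_mul_three_quarters]
    linarith [sq_nonneg (w t ξ).2]
  have hb₂ : ∀ r, 0 < r → ∀ T, 0 ≤ T → ∃ g, Integrable g μ ∧ ∀ t ∈ Icc 0 T, ∀ ξ,
      gevreyWeight R φ r (1 / 4) ξ * (w t ξ).2 ^ 2 ≤ g ξ := by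
    intro r hr T hT
    obtain ⟨g, hg, hb⟩ := hdom T hT
    refine ⟨g r, hg r hr.le, fun t ht ξ => le_trans ?_ (hb t ht ξ r hr.le)⟩
    have ha := R.a_nonneg ξ
    have h1 : 0 ≤ R.a ξ * (R.a ξ ^ 2 * (w t ξ).1 ^ 2) * Real.exp (r * φ (R.a ξ)) := by positivity
    rw [gevreyWeight, rpow_four_mul_quarter]
    linarith [sq_nonneg (w t ξ).1]
  have hb₃ : ∀ r, 0 < r → ∀ T, 0 ≤ T → ∃ g, Integrable g μ ∧ ∀ t ∈ Icc 0 T, ∀ ξ,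
      gevreyWeight R φ r (1 / 4) ξ * (w t ξ).1 ^ 2 ≤ g ξ := by
    intro r hr T hT
    obtain ⟨g, hg, hb⟩ := hdom T hT
    -- The domination of `w²` carries the factor `a³`, not `a`. With `z = a exp (r φ)` one has `z ≤
    -- 1 + z³` and `z³ = a³ exp (3 r φ)`, whence the parameter `3 * r`.
    refine ⟨fun ξ => 2 * g (3 * r) ξ, (hg _ (by linarith)).const_mul 2, fun t ht ξ => ?_⟩
    have hb' := hb t ht ξ (3 * r) (by linarith)
    have ha := R.a_nonneg ξ
    have h1 : 0 ≤ R.a ξ * (w t ξ).2 ^ 2 * Real.exp (3 * r * φ (R.a ξ)) := by positivity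
    rw [gevreyWeight, rpow_four_mul_quarter]
    set z := R.a ξ * Real.exp (r * φ (R.a ξ)) with hz
    have hz0 : 0 ≤ z := by positivity
    have hz3 : z ^ 3 = R.a ξ ^ 3 * Real.exp (3 * r * φ (R.a ξ)) := by
      rw [hz, mul_pow, ← Real.exp_nat_mul]
      push_cast
      ring_nf
    have hz1 : 1 + z ≤ 2 + z ^ 3 := by
      rcases le_total z 1 with h | h
      · have : 0 ≤ z ^ 3 := by positivity
        linarith
      · linarith [le_self_pow₀ h (show 3 ≠ 0 by norm_num)]
    calc (1 + z) * (w t ξ).1 ^ 2 ≤ (2 + z ^ 3) * (w t ξ).1 ^ 2 := by gcongr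
      _ ≤ _ := by
        rw [hz3]
        have : 0 ≤ R.a ξ ^ 3 * Real.exp (3 * r * φ (R.a ξ)) * (w t ξ).1 ^ 2 := by positivity
        linarith [sq_nonneg (w t ξ).2]
  have hslope : ∀ r, 0 < r → ∀ t, 0 ≤ t →
      Tendsto (fun s => gevreyNormSq R φ r (1 / 4) ((s - t)⁻¹ • (u s - u t) - u' t))
        (𝓝[Ici 0 \ {t}] t) (𝓝 0) := fun r hr t ht =>
    tendsto_slope_of_pointwise h.meas_φ hu hu' (fun t ht => (hmeas t ht).fst)
      (fun t ht => (hmeas t ht).snd) (fun t _ ξ => (hsol ξ t).fst) (hb₂ r hr) ht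
  have hpow : ∀ t, 0 ≤ t → powNormSq R (1 / 2) (u t) = σ t := by
    intro t ht
    rw [← hfix t ht]
    refine integral_congr_ae ?_
    filter_upwards [hu t ht] with ξ hξ
    rw [hξ, rpow_four_mul_half]
  refine ⟨u, u', ⟨?_, ?_, fun t ht => hasDerivWithinAt_of_tendsto_gevreyNormSq
    (hslope 1 one_pos t ht), fun t ht => ?_, fun t ht v => ?_⟩, fun r hr => ⟨⟨?_, ?_, hslope r hr⟩, ?_⟩⟩
  · refine R.U.injective (Lp.ext ?_)
    filter_upwards [hu 0 le_rfl] with ξ hξ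
    rw [hξ, hw, wave_zero hc]
  · refine R.U.injective (Lp.ext ?_)
    filter_upwards [hu' 0 le_rfl] with ξ hξ
    rw [hξ, hw, wave_zero hc]
  · refine (h.integrable_potential hσ ht).congr ?_
    filter_upwards [hu t ht] with ξ hξ
    rw [hξ, rpow_four_mul_half]
  · have hz := Lp.memLp (R.U (v : H))
    have hAz : MemLp (fun ξ => R.a ξ ^ 2 * R.U (v : H) ξ) 2 μ := (R.mem_domain_iff v).mp v.2
    obtain ⟨g, Γ, hg, hΓ, hb⟩ := h.exists_bound hσ (show 0 ≤ t + 1 by linarith)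
    -- The factor `a²` is moved to the test vector, where it is square integrable because `v` lies
    -- in the domain of `A`.
    have hder := hasDerivWithinAt_integral (μ := μ) (T := t + 1)
      (F := fun s ξ => (w s ξ).2 * R.U (v : H) ξ)
      (F' := fun s ξ => -(m (σ s)) * ((w s ξ).1 * (R.a ξ ^ 2 * R.U (v : H) ξ)))
      (g := fun ξ => Γ * (g ξ + (R.a ξ ^ 2 * R.U (v : H) ξ) ^ 2))
      (fun s hs => (hmem' s hs.1).integrable_mul hz)
      (fun ξ s _ => (((hsol ξ s).snd.mul_const (R.U (v : H) ξ)).congr_deriv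
        (by ring)).hasDerivWithinAt)
      (fun ξ s hs => by
        rw [abs_mul, abs_neg, abs_of_nonneg (h.m_nonneg _ (hσ.nonneg s))]
        refine mul_le_mul (hb s hs).1 ?_ (abs_nonneg _) hΓ
        have h1 := (sq_bounds (h.a_nonneg ξ) ((hb s hs).2 ξ)).2.1
        have h2 := two_mul_le_add_sq |(w s ξ).1| |R.a ξ ^ 2 * R.U (v : H) ξ|
        rw [sq_abs, sq_abs] at h2
        rw [abs_mul]
        have h3 : 0 ≤ |(w s ξ).1| * |R.a ξ ^ 2 * R.U (v : H) ξ| := by positivity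
        linarith)
      ((hg.add hAz.integrable_sq).const_mul Γ) (t := t) ⟨ht, by linarith⟩
    have hinner : ∀ (x y : H) (F G : M → ℝ), R.U x =ᵐ[μ] F → R.U y =ᵐ[μ] G →
        inner ℝ x y = ∫ ξ, F ξ * G ξ ∂μ := by
      intro x y F G hF hG
      rw [← R.U.inner_map_map, L2.inner_def]
      refine integral_congr_ae ?_
      filter_upwards [hF, hG] with ξ h1 h2
      rw [h1, h2]
      simp [mul_comm]
    refine (hder.congr (fun s hs => hinner _ _ _ _ (hu' s hs) EventuallyEq.rfl)
      (hinner _ _ _ _ (hu' t ht) EventuallyEq.rfl)).congr_deriv ?_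
    rw [integral_const_mul, hpow t ht, hinner _ _ _ _ (hu t ht) (R.apply_eq v), neg_mul]
  · exact continuousInto_of_pointwise h.meas_φ hu (fun t ht => (hmeas t ht).fst)
      (fun t _ ξ => (hsol ξ t).fst.continuousAt) (hb₃ r hr)
  · exact continuousInto_of_pointwise h.meas_φ hu' (fun t ht => (hmeas t ht).snd)
      (fun t _ ξ => (hsol ξ t).snd.continuousAt) (hb₂ r hr)
  · exact continuousInto_of_pointwise h.meas_φ hu (fun t ht => (hmeas t ht).fst)
      (fun t _ ξ => (hsol ξ t).fst.continuousAt) (hb₁ r hr)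

end Solution

end Kirchhoff

theorem mainTheorem3
    {H : Type*} [NormedAddCommGroup H] [InnerProductSpace ℝ H] [CompleteSpace H]
    [TopologicalSpace.SeparableSpace H]
    (A : H →ₗ.[ℝ] H) (hA_dense : Dense (A.domain : Set H)) (hA_selfAdjoint : IsSelfAdjoint A)
    (hA_nonneg : ∀ x : A.domain, 0 ≤ inner ℝ (A x) (x : H))
    {M : Type*} [MeasurableSpace M] (μ : Measure M) (R : Kirchhoff.SpectralRep A μ)
    (ω m φ : ℝ → ℝ)
    (hω : Kirchhoff.IsContinuityModulus ω)
    (hm_nonneg : ∀ x, 0 ≤ x → 0 ≤ m x)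
    (hm : Kirchhoff.IsOmegaContinuous ω m)
    (hφ : ∀ x, 0 ≤ x → 1 ≤ φ x)
    (hφ_meas : AEMeasurable (fun ξ => φ (R.a ξ)) μ)
    (Λ β : ℝ)
    (hcase :
      (Kirchhoff.StrictlyHyperbolic m ∧ β = 2 ∧
        ∀ σ : ℝ, 0 < σ → σ * ω (1 / σ) ≤ Λ * φ σ) ∨
      (Kirchhoff.WeaklyHyperbolic m ∧ β = 3 ∧
        ∀ σ : ℝ, 0 < σ → σ ≤ Λ * φ (σ / √(ω (1 / σ)))))
    (ρ : ℕ → ℝ) (hρ_pos : ∀ n, 0 < ρ n) (hρ_lim : Tendsto ρ atTop atTop)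
    (u₀ u₁ : H)
    (hu₀ : u₀ ∈ Kirchhoff.gevreyManfrinSpace R β φ ρ (3 / 4))
    (hu₁ : u₁ ∈ Kirchhoff.gevreyManfrinSpace R β φ ρ (1 / 4))
    (hu₀_mem : ∀ r : ℝ, 0 < r → u₀ ∈ Kirchhoff.gevreySpace R φ r (3 / 4))
    (hu₁_mem : ∀ r : ℝ, 0 < r → u₁ ∈ Kirchhoff.gevreySpace R φ r (1 / 4)) :
    ∃ u u' : ℝ → H,
      Kirchhoff.IsGlobalSolution R m u₀ u₁ u u' ∧
      ∀ r : ℝ, 0 < r →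
        Kirchhoff.ContDiffInto R φ r (1 / 4) u u' ∧
        Kirchhoff.ContinuousInto R φ r (3 / 4) u := by
  have hmc := hm.continuousOn hω
  obtain ⟨j, C, hC, hj, hgrowth, hβ⟩ : ∃ (j : ℕ) (C : ℝ), 1 ≤ C ∧
      ((j = 1 ∧ ∃ ν, 0 < ν ∧ ∀ x, 0 ≤ x → ν ≤ m x) ∨ j = 2) ∧ Kirchhoff.HasGrowth m φ j C ∧
      2 ≤ β := by
    rcases hcase with ⟨hs, rfl, hΛ⟩ | ⟨-, rfl, hΛ⟩
    · have hν : ∀ x, 0 ≤ x → Kirchhoff.hyperbolicityConst m ≤ m x := fun x hx =>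
        csInf_le ⟨0, by rintro _ ⟨y, hy, rfl⟩; exact hm_nonneg y hy⟩ ⟨x, hx, rfl⟩
      obtain ⟨C, hC, hg⟩ := Kirchhoff.hasGrowth_of_strictlyHyperbolic hω hφ hm hs hν hΛ
      exact ⟨1, C, hC, Or.inl ⟨rfl, _, hs, hν⟩, hg, le_rfl⟩
    · obtain ⟨C, hC, hg⟩ := Kirchhoff.hasGrowth_of_weaklyHyperbolic hω hφ hm hm_nonneg hΛ
      exact ⟨2, C, hC, Or.inr rfl, hg, by norm_num⟩
  have hset := Kirchhoff.setting_of_gevrey hmc hm_nonneg hφ hC hj hgrowth hφ_meas hu₀_mem hu₁_mem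
  obtain ⟨σ, hσ, hfix⟩ := hset.exists_fixed
    (Kirchhoff.spectralGap_of_gevreyManfrin hφ hφ_meas hβ hρ_lim hu₀ hu₁ hu₀_mem hu₁_mem)
  exact Kirchhoff.exists_globalSolution_of_fixed hset hσ hfix
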